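/- Let $(M^{2n},\omega)$ be a symplectic manifold (smooth, without boundary, Hausdorff, second countable; connectedness is not assumed) and let $Q^n\subset (M,\omega)$ be a closed Lagrangian, i.e. a compact embedded Lagrangian submanifold without boundary. For $R>0$ let $\mathbb{B}^{2n}_R=\{z\in\mathbb{C}^n : \pi|z|^2\le R\}$ be the closed ball of capacity $R$ in $(\mathbb{C}^n,\omega_0=dx\wedge dy)$. For an open set $U\subset M$ containing $Q$, define the width of $Q$ in $U$ by $$ w(Q;U)=\sup\bigl\{R>0 : \text{there is a smooth symplectic embedding } \iota:(\mathbb{B}^{2n}_R,\omega_0)\to (U,\omega|_U) \text{ with } \iota^{-1}(Q)=\mathbb{B}^{2n}_R\cap\mathbb{R}^n\bigr\}\in[0,\infty]. $$ A Weinstein neighborhood of $Q$ is an open neighborhood $\mathcal{N}\subset M$ of $Q$ for which there is a symplectomorphism $\Psi$ from an open neighborhood of the zero section in $(T^*Q,d\lambda_Q)$ onto $(\mathcal{N},\omega|_{\mathcal N})$ with $\Psi(0_q)=q$ for all $q\in Q$; here $\lambda_Q$ is the canonical $1$-form, $\lambda_Q=p\,dq$ in local coordinates. Then $$ w(Q;M)=\sup_{\mathcal{N}}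 w(Q;\mathcal{N}), $$ where $\mathcal{N}$ ranges over all Weinstein neighborhoods of $Q\subset(M,\omega)$. -/

import Mathlib

open Set Manifold Bundle
open scoped ContDiff ENNReal

noncomputable section

namespace LagrangianWidth

section Forms

variable {E H : Type*} [NormedAddCommGroup E] [NormedSpace ℝ E] [TopologicalSpace H]
  (I : ModelWithCorners ℝ E H) {M : Type*} [TopologicalSpace M] [ChartedSpace H M] {k : ℕ}

/-- A (not necessarily smooth) differential `k`-form on a manifold: an alternating `k`-linear form
on every tangent space. -/
abbrev Form (M : Type*) [TopologicalSpace M] [ChartedSpace H M] (k : ℕ) : Type _ :=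
  (x : M) → TangentSpace I x [⋀^Fin k]→L[ℝ] ℝ

/-- The coordinate expression of a `k`-form in the chart around `x₀`: the pullback of the form
under the inverse of that chart. It is meaningful on the target of the chart. -/
def Form.inChart (θ : Form I M k) (x₀ : M) (y : E) : E [⋀^Fin k]→L[ℝ] ℝ :=
  (θ ((extChartAt I x₀).symm y)).compContinuousLinearMap
    (mfderivWithin 𝓘(ℝ, E) I (extChartAt I x₀).symm (range I) y)

/-- A `k`-form is smooth if all its coordinate expressions are smooth. -/
def Form.IsSmooth (θ : Form I M k) : Prop :=
  ∀ x₀ : M, ContDiffOn ℝ ∞ (Form.inChart I θ x₀) (extChartAt I x₀).target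

/-- The exterior derivative of a `k`-form: at `x`, take the exterior derivative of the coordinate
expression in the chart around `x`, and pull it back to the tangent space at `x`. -/
def Form.d (θ : Form I M k) : Form I M (k + 1) := fun x =>
  (extDerivWithin (Form.inChart I θ x) (range I) (extChartAt I x x)).compContinuousLinearMap
    (mfderiv I 𝓘(ℝ, E) (extChartAt I x) x)

/-- A symplectic form: a smooth, closed, nondegenerate 2-form. -/
structure IsSymplectic (Ω : Form I M 2) : Prop where
  smooth : Form.IsSmooth I Ω
  closed : ∀ x : M, Form.d I Ω x = 0
  nondegenerate : ∀ (x : M) (v : TangentSpace I x),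
    (∀ w : TangentSpace I x, Ω x ![v, w] = 0) → v = 0

end Forms

section Cotangent

variable {E H : Type*} [NormedAddCommGroup E] [NormedSpace ℝ E] [TopologicalSpace H]
  (I : ModelWithCorners ℝ E H) (Q : Type*) [TopologicalSpace Q] [ChartedSpace H Q]
  [IsManifold I ∞ Q]

/-- The cotangent bundle `T*Q`, with the topology and the manifold structure that Mathlib gives to
the total space of a bundle of continuous linear maps. -/
abbrev CotangentBundle : Type _ :=
  TotalSpace (E →L[ℝ] ℝ) (fun q : Q => TangentSpace I q →L[ℝ] ℝ)

/-- The point `0_q` of the zero section of `T*Q`. -/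
def zeroCovector (q : Q) : CotangentBundle I Q := ⟨q, (0 : TangentSpace I q →L[ℝ] ℝ)⟩

/-- The canonical 1-form `λ_Q` (`p dq` in local coordinates) on `T*Q`: at a covector `a` at `q`,
its value on `ξ ∈ T_a(T*Q)` is `a (dπ ξ)`, where `π : T*Q → Q` is the projection. -/
def canonicalForm : Form (I.prod 𝓘(ℝ, E →L[ℝ] ℝ)) (CotangentBundle I Q) 1 := fun a =>
  ContinuousAlternatingMap.ofSubsingleton ℝ
      (TangentSpace (I.prod 𝓘(ℝ, E →L[ℝ] ℝ)) a) ℝ (0 : Fin 1)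
    ((a.2 : TangentSpace I a.1 →L[ℝ] ℝ).comp
      (mfderiv (I.prod 𝓘(ℝ, E →L[ℝ] ℝ)) I (fun b : CotangentBundle I Q => b.1) a))

end Cotangent

/-- The Euclidean space `ℂⁿ`. -/
abbrev Cn (n : ℕ) : Type := EuclideanSpace ℂ (Fin n)

/-- The standard symplectic form `dx ∧ dy` on `ℂⁿ`, `z = x + i y`. -/
def stdForm {n : ℕ} (u v : Cn n) : ℝ := ∑ i, ((u i).re * (v i).im - (u i).im * (v i).re)

/-- The closed ball of capacity `R` in `ℂⁿ`. -/
def capBall (n : ℕ) (R : ℝ) : Set (Cn n) := {z | Real.pi * ‖z‖ ^ 2 ≤ R}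

/-- The real part `ℝⁿ` of `ℂⁿ`. -/
def realPart (n : ℕ) : Set (Cn n) := {z | ∀ i, (z i).im = 0}

section Lagrangian

variable {n : ℕ}
  {M : Type*} [TopologicalSpace M] [ChartedSpace (EuclideanSpace ℝ (Fin (2 * n))) M]

/-- `ι` restricts to a smooth symplectic embedding of the closed ball of capacity `R` into the open
submanifold `U` of `(M, Ω)` which is relative to `Q`, i.e. `ι⁻¹(Q) = 𝔹_R ∩ ℝⁿ`. Values of `ι`
outside the ball play no role. (As the ball is compact, an injective smooth map on it is a
topological embedding; it is an immersion because it is symplectic.) -/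
structure IsRelativeBallEmbedding (Ω : Form 𝓘(ℝ, EuclideanSpace ℝ (Fin (2 * n))) M 2)
    (Q U : Set M) (R : ℝ) (ι : Cn n → M) : Prop where
  mapsTo : MapsTo ι (capBall n R) U
  smooth : ContMDiffOn 𝓘(ℝ, Cn n) 𝓘(ℝ, EuclideanSpace ℝ (Fin (2 * n))) ∞ ι (capBall n R)
  injOn : InjOn ι (capBall n R)
  symplectic : ∀ z ∈ capBall n R, ∀ u v : Cn n,
    Ω (ι z)
      ![mfderivWithin 𝓘(ℝ, Cn n) 𝓘(ℝ, EuclideanSpace ℝ (Fin (2 * n))) ι (capBall n R) z u,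
        mfderivWithin 𝓘(ℝ, Cn n) 𝓘(ℝ, EuclideanSpace ℝ (Fin (2 * n))) ι (capBall n R) z v]
      = stdForm u v
  relative : ∀ z ∈ capBall n R, ι z ∈ Q ↔ z ∈ realPart n

/-- The width `w(Q; U) ∈ [0, ∞]` of `Q ⊆ U` in the open submanifold `(U, Ω|_U)` of `(M, Ω)`: the
supremum of all capacities `R > 0` of balls that embed symplectically in `(U, Ω|_U)` relative
to `Q`. -/
def width (Ω : Form 𝓘(ℝ, EuclideanSpace ℝ (Fin (2 * n))) M 2) (Q U : Set M) : ℝ≥0∞ :=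
  ⨆ R ∈ {R : ℝ | 0 < R ∧ ∃ ι : Cn n → M, IsRelativeBallEmbedding Ω Q U R ι}, ENNReal.ofReal R

variable {Q : Type*} [TopologicalSpace Q] [ChartedSpace (EuclideanSpace ℝ (Fin n)) Q]

/-- `j : Q → M` is a Lagrangian embedding of the `n`-manifold `Q` into the `2n`-manifold `(M, Ω)`:
a smooth embedding with `j^*Ω = 0`. -/
structure IsLagrangianEmbedding (Ω : Form 𝓘(ℝ, EuclideanSpace ℝ (Fin (2 * n))) M 2)
    (j : Q → M) : Prop where
  isSmoothEmbedding : IsSmoothEmbedding 𝓘(ℝ, EuclideanSpace ℝ (Fin n))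
    𝓘(ℝ, EuclideanSpace ℝ (Fin (2 * n))) ∞ j
  isotropic : ∀ (q : Q) (u v : TangentSpace 𝓘(ℝ, EuclideanSpace ℝ (Fin n)) q),
    Ω (j q)
      ![mfderiv 𝓘(ℝ, EuclideanSpace ℝ (Fin n)) 𝓘(ℝ, EuclideanSpace ℝ (Fin (2 * n))) j q u,
        mfderiv 𝓘(ℝ, EuclideanSpace ℝ (Fin n)) 𝓘(ℝ, EuclideanSpace ℝ (Fin (2 * n))) j q v] = 0

/-- The model with corners of the cotangent bundle of an `n`-manifold. -/
abbrev cotangentModel (n : ℕ) :=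
  𝓘(ℝ, EuclideanSpace ℝ (Fin n)).prod 𝓘(ℝ, EuclideanSpace ℝ (Fin n) →L[ℝ] ℝ)

/-- `N ⊆ M` is a Weinstein neighborhood of the Lagrangian `j : Q → (M, Ω)`: there is a
symplectomorphism `Ψ` from an open neighborhood of the zero section in `(T*Q, dλ_Q)` onto the
open set `N` with its form `Ω`, which restricts to `j` on the zero section. -/
def IsWeinsteinNeighborhood [IsManifold 𝓘(ℝ, EuclideanSpace ℝ (Fin n)) ∞ Q]
    (Ω : Form 𝓘(ℝ, EuclideanSpace ℝ (Fin (2 * n))) M 2) (j : Q → M) (N : Set M) : Prop :=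
  ∃ Ψ : OpenPartialHomeomorph (CotangentBundle 𝓘(ℝ, EuclideanSpace ℝ (Fin n)) Q) M,
    Ψ.target = N ∧
    (∀ q : Q, zeroCovector 𝓘(ℝ, EuclideanSpace ℝ (Fin n)) Q q ∈ Ψ.source) ∧
    (∀ q : Q, Ψ (zeroCovector 𝓘(ℝ, EuclideanSpace ℝ (Fin n)) Q q) = j q) ∧
    ContMDiffOn (cotangentModel n) 𝓘(ℝ, EuclideanSpace ℝ (Fin (2 * n))) ∞ Ψ Ψ.source ∧
    ContMDiffOn 𝓘(ℝ, EuclideanSpace ℝ (Fin (2 * n))) (cotangentModel n) ∞ Ψ.symm Ψ.target ∧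
    ∀ a ∈ Ψ.source, ∀ ξ η : TangentSpace (cotangentModel n) a,
      Ω (Ψ a)
        ![mfderiv (cotangentModel n) 𝓘(ℝ, EuclideanSpace ℝ (Fin (2 * n))) Ψ a ξ,
          mfderiv (cotangentModel n) 𝓘(ℝ, EuclideanSpace ℝ (Fin (2 * n))) Ψ a η]
        = Form.d (cotangentModel n) (canonicalForm 𝓘(ℝ, EuclideanSpace ℝ (Fin n)) Q) a ![ξ, η]

end Lagrangian

end LagrangianWidth

end

/-! Only `≤` has content. It suffices that, when a ball of capacity `R` embeds relative to `Q`, for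
every positive `R' < R` the image of the ball of capacity `R'` lies in a Weinstein neighborhood of
`Q`.

Identify `ℂⁿ` with `ℝⁿ × ℝⁿ` and let `G` be the embedding. On the real part it is `j ∘ φ` for an
injective local diffeomorphism `φ` into `Q`. The cotangent lift of `φ` carries the open ball
symplectically onto an open subset of `T*Q`; it is defined on the whole ball because the ball
projects to its own real part. So `G` composed with the inverse of the lift is symplectic and equals
`j` on zero covectors. By the relative Weinstein theorem (`exists_isWeinsteinGerm`), its germ along
the zero section over a slightly smaller closed ball extends to a symplectic germ along the whole
zero section. The two maps glue near the compact set formed by the zero section and the lifted ball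
of capacity `R'`. On this set the result is injective, precisely because `G z` lies in `Q` only for
real `z`; being a local diffeomorphism, it is injective on a neighborhood, whose image is the
Weinstein neighborhood (`IsRelativeModel.exists_extension`).

The relative Weinstein theorem is proved one coordinate ball at a time over a finite cover. In a
chart (`exists_local_weinstein`), a cutoff and an isotropic correction produce a map with the right
derivative along the zero section, unchanged where a solution is prescribed. Moser's method
(`exists_moser_map`) makes it symplectic, and does nothing where the form is already standard. The
Moser flow comes from inverting `γ ↦ γ - ∫ X(s, γ)` on the Banach space of curves, near constant
curves at zeros of the field; smoothness of the flow thus becomes smoothness of superposition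
operators. -/

noncomputable section

namespace LagrangianWidth

open Filter Topology

set_option linter.unusedSectionVars false

/-! ### Superposition operators on spaces of continuous maps -/

section Superposition

universe u
variable {T : Type*} [TopologicalSpace T] [CompactSpace T]
  {G F : Type u} [NormedAddCommGroup G] [NormedSpace ℝ G] [NormedAddCommGroup F] [NormedSpace ℝ F]

set_option synthInstance.maxHeartbeats 400000 in
/-- Pointwise application of a continuous family of continuous linear maps to a continuous
function. -/
def applyCLM (T : Type*) [TopologicalSpace T] [CompactSpace T] (G F : Type u)
    [NormedAddCommGroup G] [NormedSpace ℝ G] [NormedAddCommGroup F] [NormedSpace ℝ F] :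
    C(T, G →L[ℝ] F) →L[ℝ] C(T, G) →L[ℝ] C(T, F) :=
  LinearMap.mkContinuous₂
    (LinearMap.mk₂ ℝ (fun (A : C(T, G →L[ℝ] F)) (h : C(T, G)) =>
        (⟨fun t => A t (h t), A.continuous.clm_apply h.continuous⟩ : C(T, F)))
      (fun _ _ _ => by ext; simp) (fun _ _ _ => by ext; simp)
      (fun _ _ _ => by ext; simp) (fun _ _ _ => by ext; simp))
    1 (fun A h => by
      rw [one_mul, ContinuousMap.norm_le _ (by positivity)]
      intro t
      exact (A t).le_opNorm_of_le (h.norm_coe_le_norm t) |>.trans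
        (mul_le_mul_of_nonneg_right (A.norm_coe_le_norm t) (norm_nonneg _)))

set_option synthInstance.maxHeartbeats 400000 in
@[simp] lemma applyCLM_apply (A : C(T, G →L[ℝ] F)) (h : C(T, G)) (t : T) :
    applyCLM T G F A h t = A t (h t) := rfl

-- The range of `γ` is compact, so `f'` is uniformly continuous along it; the mean value inequality
-- on balls around the points `γ t` bounds the remainder by `ε * ‖h t‖` with one radius `δ` for all
-- `t`.
set_option synthInstance.maxHeartbeats 400000 in
lemma hasFDerivAt_comp_continuousMap (f : C(G, F)) (f' : C(G, G →L[ℝ] F))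
    (hf : ∀ x, HasFDerivAt f (f' x) x) (γ : C(T, G)) :
    HasFDerivAt (fun γ : C(T, G) => f.comp γ) (applyCLM T G F (f'.comp γ)) γ := by
  rw [hasFDerivAt_iff_isLittleO_nhds_zero, Asymptotics.isLittleO_iff]
  intro ε hε
  have hK : IsCompact (range γ) := isCompact_range γ.continuous
  have hu := hK.uniformContinuousAt_of_continuousAt f' (fun a _ => f'.continuous.continuousAt)
    (Metric.dist_mem_uniformity hε)
  obtain ⟨δ, hδ, hd⟩ := Metric.mem_uniformity_dist.1 hu
  filter_upwards [Metric.ball_mem_nhds (0 : C(T, G)) hδ] with h hh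
  rw [mem_ball_zero_iff] at hh
  rw [ContinuousMap.norm_le _ (by positivity)]
  intro t
  have h1 : ‖h t‖ < δ := (h.norm_coe_le_norm t).trans_lt hh
  have key := (convex_ball (γ t) δ).norm_image_sub_le_of_norm_hasFDerivWithin_le'
    (f := f) (f' := f') (C := ε) (φ := f' (γ t)) (x := γ t) (y := γ t + h t)
    (fun x _ => (hf x).hasFDerivWithinAt)
    (fun x hx => by
      have := hd (a := γ t) (b := x) (by rw [dist_comm]; exact hx) ⟨t, rfl⟩
      rw [← dist_eq_norm, dist_comm]
      exact le_of_lt this)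
    (Metric.mem_ball_self hδ) (by simpa [Metric.mem_ball, dist_eq_norm] using h1)
  simp only [add_sub_cancel_left] at key
  calc _ = ‖f (γ t + h t) - f (γ t) - f' (γ t) (h t)‖ := rfl
    _ ≤ ε * ‖h t‖ := key
    _ ≤ ε * ‖h‖ := by gcongr; exact h.norm_coe_le_norm t

-- The derivative is the superposition operator of `f'` followed by the continuous linear map
-- `applyCLM`. Hence an induction on the order, with `F` generalized because it is replaced by `G
-- →L[ℝ] F`.
set_option synthInstance.maxHeartbeats 400000 in
lemma contDiff_comp_continuousMap (n : ℕ) : ∀ {F : Type u} [NormedAddCommGroup F]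
    [NormedSpace ℝ F] (f : C(G, F)), ContDiff ℝ n f →
      ContDiff ℝ n (fun γ : C(T, G) => f.comp γ) := by
  induction n with
  | zero =>
    intro F _ _ f _
    exact contDiff_zero.2 (ContinuousMap.continuous_postcomp f)
  | succ k ih =>
    intro F _ _ f hf
    obtain ⟨f', hf', h⟩ := contDiff_succ_iff_hasFDerivAt.1 (by exact_mod_cast hf)
    push_cast
    rw [contDiff_succ_iff_hasFDerivAt]
    have h1 : ContDiff ℝ k (applyCLM T G F) := ContinuousLinearMap.contDiff _
    have h2 := ih ⟨f', hf'.continuous⟩ hf'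
    refine ⟨fun γ => applyCLM T G F ((⟨f', hf'.continuous⟩ : C(G, G →L[ℝ] F)).comp γ),
      ContDiff.comp h1 h2, fun γ => ?_⟩
    exact hasFDerivAt_comp_continuousMap f ⟨f', hf'.continuous⟩ h γ

/-- The superposition operator `γ ↦ (t ↦ f (γ t))` of a smooth map is smooth. -/
theorem contDiff_infty_comp_continuousMap (f : C(G, F)) (hf : ContDiff ℝ ∞ f) :
    ContDiff ℝ ∞ (fun γ : C(T, G) => f.comp γ) :=
  contDiff_infty.2 fun n => contDiff_comp_continuousMap n f (contDiff_infty.1 hf n)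

end Superposition

/-! ### Curves on the unit interval and integration -/

section Curves

open unitInterval

variable {G F : Type} [NormedAddCommGroup G] [NormedSpace ℝ G]
  [NormedAddCommGroup F] [NormedSpace ℝ F]

/-- The inclusion of a space of curves `γ` in the space of graphs `t ↦ (t, γ t)`, linear part. -/
def curveInr (G : Type) [NormedAddCommGroup G] [NormedSpace ℝ G] :
    C(I, G) →L[ℝ] C(I, ℝ × G) :=
  (ContinuousLinearMap.inr ℝ ℝ G).compLeftContinuous ℝ I

/-- The curve `t ↦ f (t, γ t)`. -/
def timeComp (f : ℝ × G → F) (hf : Continuous f) (γ : C(I, G)) : C(I, F) :=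
  ⟨fun t => f (t, γ t), by fun_prop⟩

@[simp] lemma timeComp_apply (f : ℝ × G → F) (hf : Continuous f) (γ : C(I, G)) (t : I) :
    timeComp f hf γ t = f (t, γ t) := rfl

/-- A time-dependent map acts on `γ` as an ordinary superposition operator acts on the graph of `γ`,
and the graph depends affinely on `γ`. -/
lemma timeComp_eq (f : ℝ × G → F) (hf : Continuous f) :
    timeComp f hf = fun γ => (⟨f, hf⟩ : C(ℝ × G, F)).comp
      (curveInr G γ + ⟨fun t : I => ((t : ℝ), (0 : G)), by fun_prop⟩) := by
  ext γ t
  simp [timeComp, curveInr]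

lemma contDiff_timeComp {f : ℝ × G → F} (hf : ContDiff ℝ ∞ f) :
    ContDiff ℝ ∞ (timeComp f hf.continuous) := by
  rw [timeComp_eq]
  exact (contDiff_infty_comp_continuousMap (T := I) (⟨f, hf.continuous⟩ : C(ℝ × G, F)) hf).comp
    ((curveInr G).contDiff.add contDiff_const)

set_option synthInstance.maxHeartbeats 400000 in
lemma fderiv_timeComp_apply {f : ℝ × G → F} (hf : ContDiff ℝ ∞ f) (γ h : C(I, G)) (t : I) :
    fderiv ℝ (timeComp f hf.continuous) γ h t = fderiv ℝ f (t, γ t) (0, h t) := by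
  have hd : Differentiable ℝ f := hf.differentiable (by simp)
  have h1 := hasFDerivAt_comp_continuousMap (T := I) (⟨f, hf.continuous⟩ : C(ℝ × G, F))
    ⟨fderiv ℝ f, hf.continuous_fderiv (by simp)⟩ (fun x => (hd x).hasFDerivAt)
    (curveInr G γ + ⟨fun t : I => ((t : ℝ), (0 : G)), by fun_prop⟩)
  have h0 : HasFDerivAt (fun γ => curveInr G γ +
      (⟨fun t : I => ((t : ℝ), (0 : G)), by fun_prop⟩ : C(I, ℝ × G))) (curveInr G) γ :=
    (curveInr G).hasFDerivAt.add_const _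
  have h2 := HasFDerivAt.comp (𝕜 := ℝ) γ h1 h0
  rw [timeComp_eq]
  refine (congrArg (fun A : C(I, G) →L[ℝ] C(I, F) => A h t) h2.fderiv).trans ?_
  simp [curveInr]

variable [CompleteSpace G]

/-- The integration operator `f ↦ (t ↦ ∫₀ᵗ f)` on continuous curves. -/
def integrateCLM (G : Type) [NormedAddCommGroup G] [NormedSpace ℝ G] [CompleteSpace G] :
    C(I, G) →L[ℝ] C(I, G) :=
  LinearMap.mkContinuous
    { toFun := fun f => ⟨fun t => ∫ s in (0 : ℝ)..t, f (projIcc 0 1 zero_le_one s), by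
        have : Continuous fun t : ℝ => ∫ s in (0 : ℝ)..t, f (projIcc 0 1 zero_le_one s) :=
          intervalIntegral.continuous_primitive
            (fun a b => (by fun_prop : Continuous fun s =>
              f (projIcc 0 1 zero_le_one s)).intervalIntegrable a b) 0
        fun_prop⟩
      map_add' := fun f g => by
        ext t
        simp only [ContinuousMap.add_apply, ContinuousMap.coe_mk]
        exact intervalIntegral.integral_add
          ((by fun_prop : Continuous fun s => f (projIcc 0 1 zero_le_one s)).intervalIntegrable _ _)
          ((by fun_prop : Continuous fun s => g (projIcc 0 1 zero_le_one s)).intervalIntegrable _ _)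
      map_smul' := fun c f => by
        ext t
        simp }
    1 (fun f => by
      rw [one_mul, ContinuousMap.norm_le _ (norm_nonneg _)]
      intro t
      refine (intervalIntegral.norm_integral_le_of_norm_le_const
        (fun s _ => f.norm_coe_le_norm _)).trans ?_
      have : |(t : ℝ) - 0| ≤ 1 := by rw [sub_zero, abs_of_nonneg t.2.1]; exact t.2.2
      exact mul_le_of_le_one_right (norm_nonneg _) this)

lemma integrateCLM_apply (f : C(I, G)) (t : I) :
    integrateCLM G f t = ∫ s in (0 : ℝ)..t, f (projIcc 0 1 zero_le_one s) := rfl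

@[simp] lemma integrateCLM_zero (f : C(I, G)) : integrateCLM G f 0 = 0 := by
  simp [integrateCLM_apply]

/-- The clamp `projIcc` freezes the primitive outside `[0, 1]`, so the two-sided derivative is
claimed only inside. -/
lemma integrateCLM_hasDerivAt (f : C(I, G)) {t : ℝ} (ht : t ∈ Ioo (0 : ℝ) 1) :
    HasDerivAt (fun s => integrateCLM G f (projIcc 0 1 zero_le_one s))
      (f (projIcc 0 1 zero_le_one t)) t := by
  have hc : Continuous fun s => f (projIcc 0 1 zero_le_one s) := by fun_prop
  have h1 : HasDerivAt (fun t : ℝ => ∫ s in (0 : ℝ)..t, f (projIcc 0 1 zero_le_one s))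
      (f (projIcc 0 1 zero_le_one t)) t :=
    intervalIntegral.integral_hasDerivAt_right (hc.intervalIntegrable _ _)
      (hc.stronglyMeasurableAtFilter _ _) hc.continuousAt
  refine h1.congr_of_eventuallyEq ?_
  filter_upwards [Ioo_mem_nhds ht.1 ht.2] with s hs
  rw [integrateCLM_apply, projIcc_of_mem zero_le_one ⟨hs.1.le, hs.2.le⟩]

/-- A curve on `[0,1]` with derivative given by a continuous curve is recovered by integration. -/
lemma integrateCLM_one_eq_sub (f : C(I, G)) (g : ℝ → G) (hc : ContinuousOn g (Icc 0 1))
    (hg : ∀ t (ht : t ∈ Ioo (0 : ℝ) 1), HasDerivAt g (f ⟨t, ht.1.le, ht.2.le⟩) t) :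
    integrateCLM G f 1 = g 1 - g 0 := by
  rw [integrateCLM_apply]
  refine intervalIntegral.integral_eq_sub_of_hasDerivAt_of_le zero_le_one hc (fun t ht => ?_)
    ((by fun_prop : Continuous fun s => f (projIcc 0 1 zero_le_one s)).intervalIntegrable _ _)
  rw [projIcc_of_mem zero_le_one ⟨ht.1.le, ht.2.le⟩]
  exact hg t ht

end Curves

/-! ### Cutoffs and the inverse function theorem -/

section Cutoff

variable {X Y : Type*} [NormedAddCommGroup X] [NormedSpace ℝ X] [FiniteDimensional ℝ X]
  [NormedAddCommGroup Y] [NormedSpace ℝ Y]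

/-- Vanishing is required near every point outside `U`, not merely at it, so that `χ • f` is smooth
as soon as `f` is smooth on `U`. -/
lemma exists_contDiff_cutoff {K U : Set X} (hK : IsCompact K) (hU : IsOpen U) (hKU : K ⊆ U) :
    ∃ χ : X → ℝ, ContDiff ℝ ∞ χ ∧ (∀ z ∈ K, ∀ᶠ x in 𝓝 z, χ x = 1) ∧
      ∀ z ∉ U, ∀ᶠ x in 𝓝 z, χ x = 0 := by
  have : ProperSpace X := FiniteDimensional.proper ℝ X
  obtain ⟨L, hL, hKL, hLU⟩ := exists_compact_between hK hU hKU
  obtain ⟨χ, h1, h0, -⟩ := exists_contMDiffMap_one_nhds_of_subset_interior (n := ⊤) 𝓘(ℝ, X)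
    hK.isClosed hKL
  refine ⟨χ, ?_, fun z hz => ?_, fun z hz => ?_⟩
  · exact contMDiff_iff_contDiff.1 χ.contMDiff
  · exact (eventually_nhdsSet_iff_forall.1 h1) z hz
  · filter_upwards [hL.isClosed.isOpen_compl.mem_nhds (fun h => hz (hLU h))] with x hx
    exact h0 x hx

/-- Replaces germs along a compact set by global maps, since the superposition operators above take
globally smooth integrands. -/
lemma exists_contDiff_eventuallyEq {K : Set X} (hK : IsCompact K) (f : X → Y)
    (hf : ∀ z ∈ K, ∀ᶠ x in 𝓝 z, ContDiffAt ℝ ∞ f x) :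
    ∃ g : X → Y, ContDiff ℝ ∞ g ∧ ∀ z ∈ K, g =ᶠ[𝓝 z] f := by
  obtain ⟨χ, hχ, h1, h0⟩ := exists_contDiff_cutoff hK
    (isOpen_setOfPred_eventually_nhds (p := fun x => ContDiffAt ℝ ∞ f x)) (fun z hz => hf z hz)
  refine ⟨fun x => χ x • f x, ?_, fun z hz => ?_⟩
  · rw [contDiff_iff_contDiffAt]
    intro x
    by_cases hx : ContDiffAt ℝ ∞ f x
    · exact hχ.contDiffAt.smul hx
    · refine (contDiffAt_const (c := (0 : Y))).congr_of_eventuallyEq ?_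
      filter_upwards [h0 x (fun h => hx h.self_of_nhds)] with y hy
      simp [hy]
  · filter_upwards [h1 z hz] with x hx
    simp [hx]

end Cutoff

section Inverse

variable {X Y : Type*} [NormedAddCommGroup X] [NormedSpace ℝ X] [CompleteSpace X]
  [NormedAddCommGroup Y] [NormedSpace ℝ Y]

/-- The inverse function theorem, with smoothness of the inverse near the base point. -/
lemma exists_local_inverse {f : X → Y} {a : X} (f' : X ≃L[ℝ] Y)
    (hf : ∀ᶠ x in 𝓝 a, ContDiffAt ℝ ∞ f x) (hf' : fderiv ℝ f a = f') :
    ∃ g : Y → X, g (f a) = a ∧ (∀ᶠ y in 𝓝 (f a), f (g y) = y ∧ ContDiffAt ℝ ∞ g y) ∧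
      ∀ᶠ x in 𝓝 a, g (f x) = x := by
  have ha : ContDiffAt ℝ ∞ f a := hf.self_of_nhds
  have hd : HasFDerivAt f (f' : X →L[ℝ] Y) a := by
    rw [← hf']; exact (ha.differentiableAt (by simp)).hasFDerivAt
  let Φ := ha.toOpenPartialHomeomorph f hd (by simp)
  have haS : a ∈ Φ.source := ha.mem_toOpenPartialHomeomorph_source hd (by simp)
  have hcoe : (Φ : X → Y) = f := ha.toOpenPartialHomeomorph_coe hd (by simp)
  have hat : f a ∈ Φ.target := by rw [← hcoe]; exact Φ.map_source haS
  have hsa : Φ.symm (f a) = a := by rw [← hcoe]; exact Φ.left_inv haS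
  have htend : Tendsto Φ.symm (𝓝 (f a)) (𝓝 a) := by
    have := Φ.continuousAt_symm hat
    rwa [ContinuousAt, hsa] at this
  refine ⟨Φ.symm, hsa, ?_, ?_⟩
  · have hcont : ContinuousAt (fderiv ℝ f) a :=
      (ha.fderiv_right (m := ∞) (by simp)).continuousAt
    -- Invertibility is an open condition, so the derivative stays invertible near `a` and the
    -- inverse is smooth near `f a`, not only at it.
    have hinv : ∀ᶠ x in 𝓝 a, fderiv ℝ f x ∈ range ((↑) : (X ≃L[ℝ] Y) → X →L[ℝ] Y) :=
      hcont.eventually_mem (by rw [hf']; exact ContinuousLinearEquiv.nhds f')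
    filter_upwards [Φ.open_target.mem_nhds hat, htend.eventually hf, htend.eventually hinv]
      with y hy hfy hiy
    refine ⟨by rw [← hcoe]; exact Φ.right_inv hy, ?_⟩
    obtain ⟨e, he⟩ := hiy
    refine Φ.contDiffAt_symm hy (f₀' := e) ?_ ?_
    · rw [hcoe, he]; exact (hfy.differentiableAt (by simp)).hasFDerivAt
    · rw [hcoe]; exact hfy
  · filter_upwards [Φ.open_source.mem_nhds haS] with x hx
    rw [← hcoe]; exact Φ.left_inv hx

lemma exists_injOn_nhds {f : X → Y} {a : X} (f' : X ≃L[ℝ] Y)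
    (hf : ∀ᶠ x in 𝓝 a, ContDiffAt ℝ ∞ f x) (hf' : fderiv ℝ f a = f') :
    ∃ u ∈ 𝓝 a, InjOn f u := by
  obtain ⟨g, -, -, h⟩ := exists_local_inverse f' hf hf'
  refine ⟨_, h, fun x hx y hy hxy => ?_⟩
  rw [← show g (f x) = x from hx, ← show g (f y) = y from hy, hxy]

end Inverse

section

open unitInterval

/-! ### Flows near zeros of a vector field -/

section Flow

variable {G : Type} [NormedAddCommGroup G] [NormedSpace ℝ G] [CompleteSpace G]

/-- Constant curves. -/
def constCurve (G : Type) [NormedAddCommGroup G] [NormedSpace ℝ G] : G →L[ℝ] C(I, G) :=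
  LinearMap.mkContinuous
    { toFun := fun x => ContinuousMap.const I x
      map_add' := fun _ _ => rfl
      map_smul' := fun _ _ => rfl } 1 (fun x => by
      rw [one_mul, ContinuousMap.norm_le _ (norm_nonneg _)]
      exact fun _ => le_rfl)

@[simp] lemma constCurve_apply (x : G) (t : I) : constCurve G x t = x := rfl

/-- The time-dependent flow of a vector field near a compact set where it vanishes to second
order, as a map to the space of curves. -/
lemma exists_flow_near_zeros {X : ℝ × G → G} (hX : ContDiff ℝ ∞ X) {Z : Set G} (hZ : IsCompact Z)
    (h0 : ∀ z ∈ Z, ∀ t : I, X (t, z) = 0)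
    (h1 : ∀ z ∈ Z, ∀ t : I, ∀ a, fderiv ℝ X (t, z) (0, a) = 0) :
    ∃ Γ : G → C(I, G), ∀ z ∈ Z, Γ z = constCurve G z ∧
      (∀ᶠ x in 𝓝 z, ContDiffAt ℝ ∞ Γ x ∧
        Γ x - integrateCLM G (timeComp X hX.continuous (Γ x)) = constCurve G x) ∧
      ∀ᶠ x in 𝓝 z, (∀ t : I, X (t, x) = 0) → Γ x = constCurve G x := by
  -- A curve `γ` for which `N γ` is the constant curve `x` solves the integral equation of the field
  -- with initial value `x`; the flow is an inverse of `N` on constant curves.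
  let N : C(I, G) → C(I, G) := fun γ => γ - integrateCLM G (timeComp X hX.continuous γ)
  have hN : ContDiff ℝ ∞ N :=
    contDiff_id.sub ((integrateCLM G).contDiff.comp (contDiff_timeComp hX))
  have hNc : ∀ x, (∀ t : I, X (t, x) = 0) → N (constCurve G x) = constCurve G x := by
    intro x hx
    have : timeComp X hX.continuous (constCurve G x) = 0 := by ext t; simp [hx]
    simp [N, this]
  -- The spatial derivative of the field vanishes along such a curve, so the integral term
  -- contributes nothing to the linearization.
  have hDN : ∀ z ∈ Z, fderiv ℝ N (constCurve G z) =
      (ContinuousLinearEquiv.refl ℝ C(I, G) : C(I, G) →L[ℝ] C(I, G)) := by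
    intro z hz
    have e1 : fderiv ℝ (timeComp X hX.continuous) (constCurve G z) = 0 := by
      ext h t
      rw [fderiv_timeComp_apply hX]
      simp [h1 z hz]
    have d1 : HasFDerivAt (timeComp X hX.continuous) (0 : C(I, G) →L[ℝ] C(I, G))
        (constCurve G z) := by
      rw [← e1]
      exact ((contDiff_timeComp hX).differentiable (by simp) _).hasFDerivAt
    have d2 : HasFDerivAt N _ (constCurve G z) :=
      (hasFDerivAt_id (𝕜 := ℝ) (constCurve G z)).sub
        ((integrateCLM G).hasFDerivAt.comp _ d1)
    rw [d2.fderiv]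
    ext h t
    simp
  have hNn : ∀ γ, ∀ᶠ x in 𝓝 γ, ContDiffAt ℝ ∞ N x := fun γ =>
    Eventually.of_forall fun x => hN.contDiffAt
  have hinjS : InjOn N (constCurve G '' Z) := by
    rintro _ ⟨z, hz, rfl⟩ _ ⟨w, hw, rfl⟩ h
    rwa [hNc z (h0 z hz), hNc w (h0 w hw)] at h
  -- Injectivity on a compact set together with local injectivity at its points gives injectivity on
  -- one neighborhood `U`. The single inverse `invFunOn N U` therefore agrees with all the smooth
  -- local inverses.
  obtain ⟨U, hU, hUinj⟩ := hinjS.exists_mem_nhdsSet (hZ.image (constCurve G).continuous)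
    (fun x _ => hN.continuous.continuousAt) (by
      rintro _ ⟨z, hz, rfl⟩
      exact exists_injOn_nhds _ (hNn _) (hDN z hz))
  have hUz : ∀ z ∈ Z, U ∈ 𝓝 (constCurve G z) := fun z hz =>
    mem_nhdsSet_iff_forall.1 hU _ ⟨z, hz, rfl⟩
  refine ⟨fun x => Function.invFunOn N U (constCurve G x), fun z hz => ?_⟩
  have hcont : Tendsto (constCurve G) (𝓝 z) (𝓝 (constCurve G z)) :=
    (constCurve G).continuous.continuousAt
  have hinv : ∀ γ ∈ U, Function.invFunOn N U (N γ) = γ := fun γ hγ =>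
    hUinj (Function.invFunOn_mem ⟨γ, hγ, rfl⟩) hγ (Function.invFunOn_eq ⟨γ, hγ, rfl⟩)
  have hzero : ∀ᶠ x in 𝓝 z, (∀ t : I, X (t, x) = 0) →
      Function.invFunOn N U (constCurve G x) = constCurve G x := by
    filter_upwards [hcont.eventually (hUz z hz)] with x hx hx0
    have := hinv _ hx
    rwa [hNc x hx0] at this
  refine ⟨hzero.self_of_nhds (h0 z hz), ?_, hzero⟩
  obtain ⟨g, hg0, hg1, -⟩ := exists_local_inverse _ (hNn _) (hDN z hz)
  rw [hNc z (h0 z hz)] at hg0 hg1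
  have hgc : ContinuousAt g (constCurve G z) := hg1.self_of_nhds.2.continuousAt
  have hgU : ∀ᶠ γ in 𝓝 (constCurve G z), g γ ∈ U := by
    have : Tendsto g (𝓝 (constCurve G z)) (𝓝 (constCurve G z)) := by
      have := hgc.tendsto; rwa [hg0] at this
    exact this.eventually (hUz z hz)
  have hev : ∀ᶠ γ in 𝓝 (constCurve G z), Function.invFunOn N U γ = g γ ∧ N (g γ) = γ ∧
      ContDiffAt ℝ ∞ g γ := by
    filter_upwards [hg1, hgU] with γ h1 h2
    refine ⟨?_, h1⟩
    have := hinv _ h2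
    rwa [h1.1] at this
  filter_upwards [hcont.eventually hev.eventually_nhds] with x hx
  refine ⟨?_, ?_⟩
  · have : ContDiffAt ℝ ∞ (fun x => g (constCurve G x)) x :=
      hx.self_of_nhds.2.2.comp x (constCurve G).contDiff.contDiffAt
    refine this.congr_of_eventuallyEq ?_
    have hc : Tendsto (constCurve G) (𝓝 x) (𝓝 (constCurve G x)) :=
      (constCurve G).continuous.continuousAt
    filter_upwards [hc.eventually hx] with y hy using hy.1
  · have := hx.self_of_nhds.2.1
    rw [← hx.self_of_nhds.1] at this
    exact this

end Flow

/-! ### A relative Poincaré lemma -/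

section Primitive

variable {G : Type} [NormedAddCommGroup G] [NormedSpace ℝ G]

lemma hasDerivAt_bilin_apply {B : ℝ → G →L[ℝ] G →L[ℝ] ℝ} {B' : G →L[ℝ] G →L[ℝ] ℝ} {u v : ℝ → G}
    {u' v' : G} {t : ℝ} (hB : HasDerivAt B B' t) (hu : HasDerivAt u u' t)
    (hv : HasDerivAt v v' t) :
    HasDerivAt (fun s => B s (u s) (v s)) (B' (u t) (v t) + B t u' (v t) + B t (u t) v') t := by
  have h1 : HasDerivAt (fun s => B s (u s)) (B' (u t) + B t u') t := hB.clm_apply hu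
  exact h1.clm_apply hv

lemma hasDerivAt_comp_curve {F : Type*} [NormedAddCommGroup F] [NormedSpace ℝ F] {τ : G → F}
    {u : ℝ → G} {u' : G} {t : ℝ} (hτ : DifferentiableAt ℝ τ (u t)) (hu : HasDerivAt u u' t) :
    HasDerivAt (fun s => τ (u s)) (fderiv ℝ τ (u t) u') t :=
  hτ.hasFDerivAt.comp_hasDerivAt t hu

lemma hasDerivAt_bilin_comp {τ : G → G →L[ℝ] G →L[ℝ] ℝ} {x u v : ℝ → G} {x' u' v' : G} {t : ℝ}
    (hτ : DifferentiableAt ℝ τ (x t)) (hx : HasDerivAt x x' t) (hu : HasDerivAt u u' t)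
    (hv : HasDerivAt v v' t) :
    HasDerivAt (fun s => τ (x s) (u s) (v s))
      (fderiv ℝ τ (x t) x' (u t) (v t) + τ (x t) u' (v t) + τ (x t) (u t) v') t :=
  hasDerivAt_bilin_apply
    (hasDerivAt_comp_curve (F := G →L[ℝ] G →L[ℝ] ℝ) (τ := τ) (u := x) (t := t) hτ hx) hu hv

lemma hasDerivAt_line (x a : G) : HasDerivAt (fun r : ℝ => x + r • a) a 0 := by
  simpa using ((hasDerivAt_id (0 : ℝ)).smul_const a).const_add x

/-- The rescaling which multiplies the range of the projection `P` by `s`. -/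
def scaleMap (P : G →L[ℝ] G) (s : ℝ) : G →L[ℝ] G :=
  ContinuousLinearMap.id ℝ G - (1 - s) • P

lemma scaleMap_apply (P : G →L[ℝ] G) (s : ℝ) (x : G) :
    scaleMap P s x = x - (1 - s) • P x := rfl

lemma contDiff_scaleMap (P : G →L[ℝ] G) : ContDiff ℝ ∞ (scaleMap P) := by
  unfold scaleMap
  fun_prop

/-- The integrand of the homotopy operator. -/
def homotopyIntegrand (P : G →L[ℝ] G) (τ : G → G →L[ℝ] G →L[ℝ] ℝ) (y : ℝ × G) : G →L[ℝ] ℝ :=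
  (τ (scaleMap P y.1 y.2) (P y.2)).comp (scaleMap P y.1)

lemma contDiff_homotopyIntegrand (P : G →L[ℝ] G) {τ : G → G →L[ℝ] G →L[ℝ] ℝ}
    (hτ : ContDiff ℝ ∞ τ) : ContDiff ℝ ∞ (homotopyIntegrand P τ) := by
  have h1 : ContDiff ℝ ∞ fun y : ℝ × G => scaleMap P y.1 :=
    (contDiff_scaleMap P).comp contDiff_fst
  have h2 : ContDiff ℝ ∞ fun y : ℝ × G => scaleMap P y.1 y.2 := h1.clm_apply contDiff_snd
  exact ((hτ.comp h2).clm_apply (P.contDiff.comp contDiff_snd)).clm_comp h1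

lemma fderiv_homotopyIntegrand (P : G →L[ℝ] G) {τ : G → G →L[ℝ] G →L[ℝ] ℝ}
    (hτ : ContDiff ℝ ∞ τ) (s : ℝ) (x a b : G) :
    fderiv ℝ (homotopyIntegrand P τ) (s, x) (0, a) b =
      fderiv ℝ τ (scaleMap P s x) (scaleMap P s a) (P x) (scaleMap P s b) +
        τ (scaleMap P s x) (P a) (scaleMap P s b) := by
  have d1 : Differentiable ℝ (homotopyIntegrand P τ) :=
    (contDiff_homotopyIntegrand P hτ).differentiable (by simp)
  have d2 : Differentiable ℝ τ := hτ.differentiable (by simp)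
  have h1 : HasDerivAt (fun r : ℝ => homotopyIntegrand P τ (s, x + r • a))
      (fderiv ℝ (homotopyIntegrand P τ) (s, x) (0, a)) 0 := by
    have := hasDerivAt_comp_curve (τ := homotopyIntegrand P τ)
      (u := fun r : ℝ => (s, x + r • a)) (t := 0) (d1 _)
      ((hasDerivAt_const (0 : ℝ) s).prodMk (hasDerivAt_line x a))
    simpa using this
  have h1' : HasDerivAt (fun r : ℝ => homotopyIntegrand P τ (s, x + r • a) b)
      (fderiv ℝ (homotopyIntegrand P τ) (s, x) (0, a) b) 0 := by
    have := HasDerivAt.clm_apply h1 (hasDerivAt_const (0 : ℝ) b)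
    simpa using this
  have h2 : HasDerivAt (fun r : ℝ => scaleMap P s (x + r • a)) (scaleMap P s a) 0 :=
    (scaleMap P s).hasFDerivAt.comp_hasDerivAt 0 (hasDerivAt_line x a)
  have h3 : HasDerivAt (fun r : ℝ => P (x + r • a)) (P a) 0 :=
    P.hasFDerivAt.comp_hasDerivAt 0 (hasDerivAt_line x a)
  have h4 := hasDerivAt_bilin_comp (d2 _) h2 h3 (hasDerivAt_const (0 : ℝ) (scaleMap P s b))
  refine (h1'.unique h4).trans ?_
  simp

variable [CompleteSpace G]

/-- The homotopy operator for the rescaling `scaleMap P`. -/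
def homotopyForm (P : G →L[ℝ] G) {τ : G → G →L[ℝ] G →L[ℝ] ℝ} (hτ : ContDiff ℝ ∞ τ) (x : G) :
    G →L[ℝ] ℝ :=
  integrateCLM (G →L[ℝ] ℝ)
    (timeComp (homotopyIntegrand P τ) (contDiff_homotopyIntegrand P hτ).continuous
      (constCurve G x)) 1

lemma homotopyForm_eq_comp (P : G →L[ℝ] G) {τ : G → G →L[ℝ] G →L[ℝ] ℝ} (hτ : ContDiff ℝ ∞ τ) :
    homotopyForm P hτ = fun x => ((ContinuousMap.evalCLM ℝ (1 : I)).comp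
      (integrateCLM (G →L[ℝ] ℝ))) (timeComp (homotopyIntegrand P τ)
        (contDiff_homotopyIntegrand P hτ).continuous (constCurve G x)) := rfl

lemma contDiff_homotopyForm (P : G →L[ℝ] G) {τ : G → G →L[ℝ] G →L[ℝ] ℝ} (hτ : ContDiff ℝ ∞ τ) :
    ContDiff ℝ ∞ (homotopyForm P hτ) := by
  rw [homotopyForm_eq_comp]
  exact (ContinuousLinearMap.contDiff _).comp
    ((contDiff_timeComp (contDiff_homotopyIntegrand P hτ)).comp (constCurve G).contDiff)

lemma integrateCLM_clm_apply (f : C(I, G →L[ℝ] ℝ)) (b : G) :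
    integrateCLM (G →L[ℝ] ℝ) f 1 b =
      integrateCLM ℝ ⟨fun t => f t b, by fun_prop⟩ 1 := by
  rw [integrateCLM_apply, integrateCLM_apply]
  exact (ContinuousLinearMap.intervalIntegral_apply
    ((by fun_prop : Continuous fun s => f (projIcc 0 1 zero_le_one s)).intervalIntegrable _ _) b)

lemma fderiv_homotopyForm (P : G →L[ℝ] G) {τ : G → G →L[ℝ] G →L[ℝ] ℝ} (hτ : ContDiff ℝ ∞ τ)
    (x a : G) : fderiv ℝ (homotopyForm P hτ) x a = integrateCLM (G →L[ℝ] ℝ)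
      (fderiv ℝ (timeComp (homotopyIntegrand P τ) (contDiff_homotopyIntegrand P hτ).continuous)
        (constCurve G x) (constCurve G a)) 1 := by
  have h1 := ((contDiff_timeComp (contDiff_homotopyIntegrand P hτ)).differentiable (by simp)
    (constCurve G x)).hasFDerivAt
  have h2 := HasFDerivAt.comp x h1 (constCurve G).hasFDerivAt
  have h3 := HasFDerivAt.comp x (((ContinuousMap.evalCLM ℝ (1 : I)).comp
      (integrateCLM (G →L[ℝ] ℝ))).hasFDerivAt) h2
  rw [homotopyForm_eq_comp]
  exact congrArg (fun A : G →L[ℝ] G →L[ℝ] ℝ => A a) h3.fderiv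

lemma homotopyForm_eq_zero (P : G →L[ℝ] G) {τ : G → G →L[ℝ] G →L[ℝ] ℝ} (hτ : ContDiff ℝ ∞ τ)
    {x : G} (h : ∀ s : I, τ (scaleMap P s x) (P x) = 0) : homotopyForm P hτ x = 0 := by
  have : timeComp (homotopyIntegrand P τ) (contDiff_homotopyIntegrand P hτ).continuous
      (constCurve G x) = 0 := by
    ext s : 1
    simp [homotopyIntegrand, h]
  simp [homotopyForm, this]

-- The integrand is `τ` at the rescaled point, contracted with `P x`. Where `P x = 0` and `τ x = 0`
-- both factors vanish, so the product vanishes to second order. This is why the Moser field will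
-- vanish there with its spatial derivative.
set_option synthInstance.maxHeartbeats 400000 in
lemma fderiv_homotopyForm_eq_zero (P : G →L[ℝ] G) {τ : G → G →L[ℝ] G →L[ℝ] ℝ}
    (hτ : ContDiff ℝ ∞ τ) {x : G} (hP : P x = 0) (h : τ x = 0) :
    fderiv ℝ (homotopyForm P hτ) x = 0 := by
  ext a : 1
  rw [fderiv_homotopyForm]
  have : fderiv ℝ (timeComp (homotopyIntegrand P τ)
      (contDiff_homotopyIntegrand P hτ).continuous) (constCurve G x) (constCurve G a) = 0 := by
    ext s b
    rw [fderiv_timeComp_apply (contDiff_homotopyIntegrand P hτ)]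
    simp only [constCurve_apply]
    rw [fderiv_homotopyIntegrand P hτ]
    simp [hP, scaleMap_apply, h]
  simp [this]

/-- A bilinear-form valued map satisfies the closedness identity at `x`. -/
def IsClosedAt (τ : G → G →L[ℝ] G →L[ℝ] ℝ) (x : G) : Prop :=
  ∀ u v w, fderiv ℝ τ x u v w + fderiv ℝ τ x v w u + fderiv ℝ τ x w u v = 0

lemma fderiv_skew {τ : G → G →L[ℝ] G →L[ℝ] ℝ} {x : G} (hd : DifferentiableAt ℝ τ x)
    (h : ∀ᶠ y in 𝓝 x, ∀ u v, τ y u v = -τ y v u) (w u v : G) :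
    fderiv ℝ τ x w u v = -fderiv ℝ τ x w v u := by
  have h1 : fderiv ℝ (fun y => τ y u v) x w = fderiv ℝ τ x w u v := by
    have := ((hd.hasFDerivAt.clm_apply (hasFDerivAt_const u x)).clm_apply (hasFDerivAt_const v x))
    rw [this.fderiv]; simp
  have h2 : fderiv ℝ (fun y => τ y v u) x w = fderiv ℝ τ x w v u := by
    have := ((hd.hasFDerivAt.clm_apply (hasFDerivAt_const v x)).clm_apply (hasFDerivAt_const u x))
    rw [this.fderiv]; simp
  have h3 : (fun y => τ y u v) =ᶠ[𝓝 x] fun y => -τ y v u := h.mono fun y hy => hy u v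
  rw [← h1, ← h2, h3.fderiv_eq, fderiv_fun_neg]
  simp

/-- The Poincaré lemma relative to the fixed point set of the rescaling. -/
lemma homotopyForm_primitive (P : G →L[ℝ] G) {τ : G → G →L[ℝ] G →L[ℝ] ℝ} (hτ : ContDiff ℝ ∞ τ)
    {x : G} (hskew : ∀ s : I, ∀ᶠ y in 𝓝 (scaleMap P s x), ∀ u v, τ y u v = -τ y v u)
    (hclosed : ∀ s : I, IsClosedAt τ (scaleMap P s x)) (h0 : τ (scaleMap P 0 x) = 0) (a b : G) :
    fderiv ℝ (homotopyForm P hτ) x a b - fderiv ℝ (homotopyForm P hτ) x b a = τ x a b := by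
  rw [fderiv_homotopyForm, fderiv_homotopyForm, integrateCLM_clm_apply, integrateCLM_clm_apply,
    ← ContinuousMap.sub_apply, ← map_sub]
  have hm : ∀ (y : G) (t : ℝ), HasDerivAt (fun s => scaleMap P s y) (P y) t := by
    intro y t
    have := (((hasDerivAt_id t).const_sub 1).smul_const (P y)).const_sub y
    simpa [scaleMap_apply] using this
  have hd : Differentiable ℝ τ := hτ.differentiable (by simp)
  have hg : ∀ t : ℝ, HasDerivAt (fun s => τ (scaleMap P s x) (scaleMap P s a) (scaleMap P s b))
      (fderiv ℝ τ (scaleMap P t x) (P x) (scaleMap P t a) (scaleMap P t b) +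
        τ (scaleMap P t x) (P a) (scaleMap P t b) +
        τ (scaleMap P t x) (scaleMap P t a) (P b)) t := by
    intro t
    exact hasDerivAt_bilin_comp (hd _) (hm x t) (hm a t) (hm b t)
  rw [integrateCLM_one_eq_sub _ (fun s => τ (scaleMap P s x) (scaleMap P s a) (scaleMap P s b))
    (fun t _ => (hg t).continuousAt.continuousWithinAt)]
  · rw [h0]
    simp [scaleMap_apply]
  · intro t ht
    refine (hg t).congr_deriv ?_
    change _ = (_ : ℝ) - _
    have e := fun a b => fderiv_homotopyIntegrand P hτ t x a b
    simp only [ContinuousMap.coe_mk,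
      fderiv_timeComp_apply (contDiff_homotopyIntegrand P hτ), constCurve_apply, e]
    have k1 := hskew ⟨t, ht.1.le, ht.2.le⟩
    have k2 := hclosed ⟨t, ht.1.le, ht.2.le⟩ (scaleMap P t a) (P x) (scaleMap P t b)
    have k3 := fderiv_skew (hd _) k1 (scaleMap P t b) (scaleMap P t a) (P x)
    have k4 := fderiv_skew (hd _) k1 (P x) (scaleMap P t a) (scaleMap P t b)
    have k5 := k1.self_of_nhds (P b) (scaleMap P t a)
    linarith

end Primitive

end

section

open unitInterval

/-! ### Moser's method -/

section Moser

variable {G : Type} [NormedAddCommGroup G] [NormedSpace ℝ G] [FiniteDimensional ℝ G]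

lemma exists_equiv_of_nondegenerate (B : G →L[ℝ] G →L[ℝ] ℝ) (hB : ∀ u, B u = 0 → u = 0) :
    ∃ e : G ≃L[ℝ] (G →L[ℝ] ℝ), (e : G →L[ℝ] G →L[ℝ] ℝ) = B := by
  have hinj : Function.Injective (B : G →ₗ[ℝ] (G →L[ℝ] ℝ)) :=
    (injective_iff_map_eq_zero _).2 hB
  have hfin : Module.finrank ℝ G = Module.finrank ℝ (G →L[ℝ] ℝ) := by
    rw [← (LinearMap.toContinuousLinearMap (𝕜 := ℝ) (E := G) (F' := ℝ)).finrank_eq]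
    exact (Subspace.dual_finrank_eq (K := ℝ) (V := G)).symm
  refine ⟨(LinearEquiv.ofInjectiveOfFinrankEq _ hinj hfin).toContinuousLinearEquiv, ?_⟩
  ext u v
  rfl

/-- The tube lemma for the compact interval. -/
lemma eventually_forall_unitInterval {z : G} {p : ℝ × G → Prop}
    (h : ∀ t : I, ∀ᶠ y in 𝓝 ((t : ℝ), z), p y) : ∀ᶠ x in 𝓝 z, ∀ t : I, p (t, x) := by
  have := (isCompact_Icc (a := (0 : ℝ)) (b := 1)).eventually_forall_of_forall_eventually
    (x₀ := z) (P := fun x t => p (t, x)) (fun t ht => by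
      have hs : Tendsto (Prod.swap : G × ℝ → ℝ × G) (𝓝 (z, t)) (𝓝 (t, z)) :=
        continuous_swap.continuousAt
      exact hs.eventually (h ⟨t, ht⟩))
  exact this.mono fun x hx t => hx t t.2

-- The field is `-(ω₀ + t τ)⁻¹ α`. On `Z` the form is `ω₀`, so it is invertible near the compact set
-- `[0, 1] × Z`; a cutoff makes the field global without changing it near that set.
set_option synthInstance.maxHeartbeats 400000 in
lemma exists_moser_field_aux {ω₀ : G →L[ℝ] G →L[ℝ] ℝ} (hω₀ : ∀ u, ω₀ u = 0 → u = 0)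
    {τ : G → G →L[ℝ] G →L[ℝ] ℝ} (hτ : ContDiff ℝ ∞ τ) {α : G → G →L[ℝ] ℝ} (hα : ContDiff ℝ ∞ α)
    {Z : Set G} (hZ : IsCompact Z) (hτ0 : ∀ z ∈ Z, τ z = 0) :
    ∃ X : ℝ × G → G, ContDiff ℝ ∞ X ∧ ∀ z ∈ Z, ∀ᶠ x in 𝓝 z, ∀ t : I,
      (ω₀ (X (t, x)) + (t : ℝ) • τ x (X (t, x)) = -α x) ∧ (α x = 0 → X (t, x) = 0) := by
  obtain ⟨e, he⟩ := exists_equiv_of_nondegenerate ω₀ hω₀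
  let B : ℝ × G → G →L[ℝ] G →L[ℝ] ℝ := fun y => ω₀ + y.1 • τ y.2
  have hB : ContDiff ℝ ∞ B := by
    have h1 : ContDiff ℝ ∞ fun y : ℝ × G => τ y.2 := hτ.comp contDiff_snd
    have h2 : ContDiff ℝ ∞ fun y : ℝ × G => y.1 • τ y.2 :=
      contDiff_clm_apply_iff.2 fun u => contDiff_clm_apply_iff.2 fun v =>
        contDiff_fst.mul ((h1.clm_apply contDiff_const).clm_apply contDiff_const)
    exact contDiff_const.add h2
  have hinv : ∀ z ∈ Z, ∀ t : I, ∀ᶠ y in 𝓝 ((t : ℝ), z),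
      B y ∈ range ((↑) : (G ≃L[ℝ] (G →L[ℝ] ℝ)) → G →L[ℝ] G →L[ℝ] ℝ) := by
    intro z hz t
    refine hB.continuous.continuousAt.eventually_mem ?_
    have : B ((t : ℝ), z) = e := by
      ext u v
      simp [B, hτ0 z hz, he]
    rw [this]
    exact ContinuousLinearEquiv.nhds e
  obtain ⟨X, hX, hXe⟩ := exists_contDiff_eventuallyEq (X := ℝ × G) (Y := G)
    (K := Icc (0 : ℝ) 1 ×ˢ Z) (isCompact_Icc.prod hZ)
    (fun y => -(ContinuousLinearMap.inverse (B y) (α y.2))) (by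
      rintro ⟨t, z⟩ ⟨ht, hz⟩
      filter_upwards [hinv z hz ⟨t, ht⟩] with y ⟨e', he'⟩
      have h1 : ContDiffAt ℝ ∞ (ContinuousLinearMap.inverse :
          (G →L[ℝ] G →L[ℝ] ℝ) → (G →L[ℝ] ℝ) →L[ℝ] G) (B y) := by
        rw [← he']; exact contDiffAt_map_inverse e'
      have h2 : ContDiffAt ℝ ∞ (fun y => ContinuousLinearMap.inverse (B y)) y :=
        ContDiffAt.comp y h1 hB.contDiffAt
      exact (h2.clm_apply (hα.comp contDiff_snd).contDiffAt).neg)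
  refine ⟨X, hX, fun z hz => ?_⟩
  have := eventually_forall_unitInterval (z := z) (p := fun y => X y =
      -(ContinuousLinearMap.inverse (B y) (α y.2)) ∧
      B y ∈ range ((↑) : (G ≃L[ℝ] (G →L[ℝ] ℝ)) → G →L[ℝ] G →L[ℝ] ℝ))
    (fun t => (hXe (t, z) ⟨t.2, hz⟩).and (hinv z hz t))
  filter_upwards [this] with x hx t
  obtain ⟨h1, e', he'⟩ := hx t
  refine ⟨?_, fun h0 => by rw [h1]; simp [h0]⟩
  have h2 : ω₀ (X (t, x)) + (t : ℝ) • τ x (X (t, x)) = B (t, x) (X (t, x)) := by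
    simp [B]
  rw [h2, h1, ← he', ContinuousLinearMap.inverse_equiv, map_neg]
  simp

/-- The derivative of the defining equation of the Moser vector field. -/
lemma moser_field_fderiv {ω₀ : G →L[ℝ] G →L[ℝ] ℝ} {τ : G → G →L[ℝ] G →L[ℝ] ℝ}
    (hτ : ContDiff ℝ ∞ τ) {α : G → G →L[ℝ] ℝ} (hα : ContDiff ℝ ∞ α)
    {X : ℝ × G → G} (hX : ContDiff ℝ ∞ X) {t : ℝ} {x : G}
    (h : ∀ᶠ y in 𝓝 x, ω₀ (X (t, y)) + t • τ y (X (t, y)) = -α y) (a b : G) :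
    ω₀ (fderiv ℝ X (t, x) (0, a)) b + t * (fderiv ℝ τ x a (X (t, x)) b +
      τ x (fderiv ℝ X (t, x) (0, a)) b) = - fderiv ℝ α x a b := by
  have dX : HasDerivAt (fun r : ℝ => X (t, x + r • a)) (fderiv ℝ X (t, x) (0, a)) 0 := by
    have := hasDerivAt_comp_curve (τ := X) (u := fun r : ℝ => (t, x + r • a)) (t := 0)
      (hX.differentiable (by simp) _)
      ((hasDerivAt_const (0 : ℝ) t).prodMk (hasDerivAt_line x a))
    simpa using this
  have dα : HasDerivAt (fun r : ℝ => α (x + r • a) b) (fderiv ℝ α x a b) 0 := by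
    have h1 : HasDerivAt (fun r : ℝ => α (x + r • a)) (fderiv ℝ α x a) 0 := by
      have := hasDerivAt_comp_curve (τ := α) (u := fun r : ℝ => x + r • a) (t := 0)
        (hα.differentiable (by simp) _) (hasDerivAt_line x a)
      simpa using this
    simpa using h1.clm_apply (hasDerivAt_const (0 : ℝ) b)
  have d1 := hasDerivAt_bilin_apply (hasDerivAt_const (0 : ℝ) ω₀) dX (hasDerivAt_const (0 : ℝ) b)
  have d2 := hasDerivAt_bilin_comp (hτ.differentiable (by simp) _) (hasDerivAt_line x a) dX
    (hasDerivAt_const (0 : ℝ) b)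
  have d3 := d1.add (d2.const_mul t)
  have hev : (fun r : ℝ => ω₀ (X (t, x + r • a)) b + t * τ (x + r • a) (X (t, x + r • a)) b)
      =ᶠ[𝓝 0] fun r : ℝ => -(α (x + r • a) b) := by
    have hc : Tendsto (fun r : ℝ => x + r • a) (𝓝 0) (𝓝 x) := by
      have := (hasDerivAt_line x a).continuousAt.tendsto
      simpa using this
    filter_upwards [hc.eventually h] with r hr
    have := congrArg (fun A : G →L[ℝ] ℝ => A b) hr
    simpa using this
  have := d3.unique (dα.neg.congr_of_eventuallyEq hev)
  simpa using this

/-- Differentiating the defining equation at a point of `Z`, where `X`, `τ` and the derivative of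
`α` vanish, leaves only `ω₀` applied to the derivative of `X`; nondegeneracy concludes. -/
lemma exists_moser_field {ω₀ : G →L[ℝ] G →L[ℝ] ℝ} (hω₀ : ∀ u, ω₀ u = 0 → u = 0)
    {τ : G → G →L[ℝ] G →L[ℝ] ℝ} (hτ : ContDiff ℝ ∞ τ) {α : G → G →L[ℝ] ℝ} (hα : ContDiff ℝ ∞ α)
    {Z : Set G} (hZ : IsCompact Z) (hτ0 : ∀ z ∈ Z, τ z = 0) (hα0 : ∀ z ∈ Z, α z = 0)
    (hdα : ∀ z ∈ Z, fderiv ℝ α z = 0) :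
    ∃ X : ℝ × G → G, ContDiff ℝ ∞ X ∧ (∀ z ∈ Z, ∀ t : I, X (t, z) = 0) ∧
      (∀ z ∈ Z, ∀ t : I, ∀ a, fderiv ℝ X (t, z) (0, a) = 0) ∧
      ∀ z ∈ Z, ∀ᶠ x in 𝓝 z, ∀ t : I,
        (ω₀ (X (t, x)) + (t : ℝ) • τ x (X (t, x)) = -α x) ∧ (α x = 0 → X (t, x) = 0) := by
  obtain ⟨X, hX, h⟩ := exists_moser_field_aux hω₀ hτ hα hZ hτ0
  refine ⟨X, hX, fun z hz t => ((h z hz).self_of_nhds t).2 (hα0 z hz), fun z hz t a => ?_, h⟩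
  have h0 : X (t, z) = 0 := ((h z hz).self_of_nhds t).2 (hα0 z hz)
  apply hω₀
  ext b
  have := moser_field_fderiv hτ hα hX ((h z hz).mono fun y hy => (hy t).1) a b
  simpa [h0, hτ0 z hz, hdα z hz] using this

/-- Along a solution of the Moser equation the form `ω₀ + t τ` is transported. -/
lemma moser_transport {ω₀ : G →L[ℝ] G →L[ℝ] ℝ} (hω₀ : ∀ u v, ω₀ u v = -ω₀ v u)
    {τ : G → G →L[ℝ] G →L[ℝ] ℝ} (hτ : ContDiff ℝ ∞ τ) {α : G → G →L[ℝ] ℝ}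
    {X : ℝ × G → G} (hX : ContDiff ℝ ∞ X) {x : G} {γ : C(I, G)} {η : G → C(I, G)}
    (hγ : γ - integrateCLM G (timeComp X hX.continuous γ) = constCurve G x)
    (hη : ∀ u, η u - integrateCLM G (fderiv ℝ (timeComp X hX.continuous) γ (η u)) =
      constCurve G u)
    (hskew : ∀ t : I, ∀ᶠ y in 𝓝 (γ t), ∀ u v, τ y u v = -τ y v u)
    (hclosed : ∀ t : I, IsClosedAt τ (γ t))
    (hprim : ∀ t : I, ∀ a b, fderiv ℝ α (γ t) a b - fderiv ℝ α (γ t) b a = τ (γ t) a b)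
    (hfield : ∀ t : I, ∀ a b, ω₀ (fderiv ℝ X (t, γ t) (0, a)) b +
      t * (fderiv ℝ τ (γ t) a (X (t, γ t)) b + τ (γ t) (fderiv ℝ X (t, γ t) (0, a)) b) =
        - fderiv ℝ α (γ t) a b) (u v : G) :
    ω₀ (η u 1) (η v 1) + τ (γ 1) (η u 1) (η v 1) = ω₀ u v := by
  -- The integral equation read as an initial value problem: the curve starts at `w` with velocity
  -- `ζ`. It serves for `γ` and for its variations `η u`, `η v`.
  have key : ∀ {ξ ζ : C(I, G)} {w : G}, ξ - integrateCLM G ζ = constCurve G w →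
      ξ 0 = w ∧ ∀ t (ht : t ∈ Ioo (0 : ℝ) 1),
        HasDerivAt (fun s => ξ (projIcc 0 1 zero_le_one s)) (ζ ⟨t, ht.1.le, ht.2.le⟩) t := by
    intro ξ ζ w h
    have h' : ξ = constCurve G w + integrateCLM G ζ := by rw [← h]; abel
    refine ⟨by rw [h']; simp, fun t ht => ?_⟩
    have := (integrateCLM_hasDerivAt ζ ht).const_add w
    rw [projIcc_of_mem zero_le_one ⟨ht.1.le, ht.2.le⟩] at this
    rw [h']
    exact this
  obtain ⟨-, dγ⟩ := key hγ
  obtain ⟨u0, du⟩ := key (hη u)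
  obtain ⟨v0, dv⟩ := key (hη v)
  let pr : ℝ → I := projIcc 0 1 zero_le_one
  let h : ℝ → ℝ := fun s => ω₀ (η u (pr s)) (η v (pr s)) +
    s * τ (γ (pr s)) (η u (pr s)) (η v (pr s))
  have hpr : Continuous pr := continuous_projIcc
  have hτc : Continuous τ := hτ.continuous
  have hc : Continuous h := by
    have h1 : Continuous fun s => τ (γ (pr s)) := hτc.comp (γ.continuous.comp hpr)
    have h2 : Continuous fun s => η u (pr s) := (η u).continuous.comp hpr
    have h3 : Continuous fun s => η v (pr s) := (η v).continuous.comp hpr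
    exact (((ω₀.continuous.comp h2).clm_apply h3)).add
      (continuous_id.mul ((h1.clm_apply h2).clm_apply h3))
  -- Moser's computation: the Lie derivative of `ω₀ + t τ` along the field is `-dα = -τ`, which
  -- cancels the explicit `t`-derivative `τ`.
  have hd : ∀ t (ht : t ∈ Ioo (0 : ℝ) 1), HasDerivAt h ((0 : C(I, ℝ)) ⟨t, ht.1.le, ht.2.le⟩) t := by
    intro t ht
    have d1 := hasDerivAt_bilin_apply (hasDerivAt_const t ω₀) (du t ht) (dv t ht)
    have d2 := (hasDerivAt_id t).mul (hasDerivAt_bilin_comp (hτ.differentiable (by simp) _)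
      (dγ t ht) (du t ht) (dv t ht))
    refine (d1.add d2).congr_deriv ?_
    simp only [projIcc_of_mem zero_le_one ⟨ht.1.le, ht.2.le⟩, fderiv_timeComp_apply hX,
      timeComp_apply, id_eq, ContinuousMap.zero_apply]
    set p : I := ⟨t, ht.1.le, ht.2.le⟩
    have k1 := hskew p
    have hdτ : DifferentiableAt ℝ τ (γ p) := hτ.differentiable (by simp) _
    have f1 := hfield p (η u p) (η v p)
    have f2 := hfield p (η v p) (η u p)
    have f3 := hprim p (η u p) (η v p)
    have f4 := hclosed p (X (p, γ p)) (η u p) (η v p)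
    have f5 := fderiv_skew hdτ k1 (η u p) (η v p) (X (p, γ p))
    have f6 := k1.self_of_nhds (η u p) (fderiv ℝ X (p, γ p) (0, η v p))
    have f7 := hω₀ (η u p) (fderiv ℝ X (p, γ p) (0, η v p))
    have hp : (p : ℝ) = t := rfl
    rw [hp] at *
    simp only [zero_apply]
    rw [f6, f7]
    rw [f5] at f4
    linear_combination f1 - f2 - f3 + t * f4
  have := integrateCLM_one_eq_sub (0 : C(I, ℝ)) h hc.continuousOn hd
  have e0 : pr 0 = 0 := by simp [pr]
  have e1 : pr 1 = 1 := by simp [pr]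
  simp only [map_zero, ContinuousMap.zero_apply, h, e0, e1, u0, v0] at this
  linarith

end Moser

end

section

open unitInterval

section MoserTheorem

variable {G : Type} [NormedAddCommGroup G] [NormedSpace ℝ G] [FiniteDimensional ℝ G]

/-- Uniform closeness to a constant curve confines the whole curve; with continuity of the flow this
carries statements about germs along trajectories. -/
lemma eventually_forall_curve {z : G} {p : G → Prop} (h : ∀ᶠ x in 𝓝 z, p x) :
    ∀ᶠ γ : C(I, G) in 𝓝 (constCurve G z), ∀ t, p (γ t) := by
  obtain ⟨ε, hε, hp⟩ := Metric.eventually_nhds_iff.1 h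
  filter_upwards [Metric.ball_mem_nhds (constCurve G z) hε] with γ hγ t
  exact hp ((ContinuousMap.dist_apply_le_dist (f := γ) (g := constCurve G z) t).trans_lt hγ)

lemma IsClosedAt.congr {τ β : G → G →L[ℝ] G →L[ℝ] ℝ} {x : G} (h : IsClosedAt β x)
    (c : G →L[ℝ] G →L[ℝ] ℝ) (he : τ =ᶠ[𝓝 x] fun y => β y - c) : IsClosedAt τ x := by
  have : fderiv ℝ τ x = fderiv ℝ β x := by
    rw [he.fderiv_eq]
    exact fderiv_sub_const (𝕜 := ℝ) (F := G →L[ℝ] G →L[ℝ] ℝ) c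
  intro u v w
  rw [this]
  exact h u v w

/-- **Moser's theorem** relative to the kernel of a projection: a closed 2-form which agrees with a
constant symplectic form at the points of the kernel of `P` is normalized near a compact subset `Z`
of the kernel by a map which is the identity on the kernel and wherever this is already so. -/
theorem exists_moser_map {P : G →L[ℝ] G} (hP : ∀ x, P (P x) = P x)
    {ω₀ : G →L[ℝ] G →L[ℝ] ℝ} (hnd : ∀ u, ω₀ u = 0 → u = 0) (hsk : ∀ u v, ω₀ u v = -ω₀ v u)
    {β : G → G →L[ℝ] G →L[ℝ] ℝ} {Z : Set G} (hZ : IsCompact Z) (hZP : ∀ z ∈ Z, P z = 0)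
    (hsm : ∀ z ∈ Z, ∀ᶠ x in 𝓝 z, ContDiffAt ℝ ∞ β x)
    (hskew : ∀ z ∈ Z, ∀ᶠ x in 𝓝 z, ∀ u v, β x u v = -β x v u)
    (hcl : ∀ z ∈ Z, ∀ᶠ x in 𝓝 z, IsClosedAt β x)
    (h0 : ∀ z ∈ Z, ∀ᶠ x in 𝓝 z, P x = 0 → β x = ω₀) :
    ∃ ψ : G → G, ∀ z ∈ Z,
      (∀ᶠ x in 𝓝 z, ContDiffAt ℝ ∞ ψ x ∧
        ∀ u v, β (ψ x) (fderiv ℝ ψ x u) (fderiv ℝ ψ x v) = ω₀ u v) ∧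
      (∀ᶠ x in 𝓝 z, P x = 0 → ψ x = x) ∧
      ((∀ᶠ x in 𝓝 z, β x = ω₀) → ∀ᶠ x in 𝓝 z, ψ x = x) := by
  obtain ⟨τ, hτ, hτβ⟩ := exists_contDiff_eventuallyEq (X := G) (Y := G →L[ℝ] G →L[ℝ] ℝ) hZ
    (fun x => β x - ω₀) (fun z hz => (hsm z hz).mono fun x hx => hx.sub contDiffAt_const)
  have hscale : ∀ z ∈ Z, ∀ {p : G → Prop}, (∀ᶠ x in 𝓝 z, p x) →
      ∀ᶠ x in 𝓝 z, ∀ s : I, p (scaleMap P s x) := by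
    intro z hz p hp
    refine eventually_forall_unitInterval (p := fun y => p (scaleMap P y.1 y.2)) fun s => ?_
    have hc : Continuous fun y : ℝ × G => scaleMap P y.1 y.2 :=
      (((contDiff_scaleMap P).continuous.comp continuous_fst).clm_apply continuous_snd)
    have ht : Tendsto (fun y : ℝ × G => scaleMap P y.1 y.2) (𝓝 ((s : ℝ), z)) (𝓝 z) := by
      have := hc.tendsto ((s : ℝ), z)
      simpa [scaleMap_apply, hZP z hz] using this
    exact ht.eventually hp
  have hskew' : ∀ z ∈ Z, ∀ᶠ x in 𝓝 z, ∀ u v, τ x u v = -τ x v u := by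
    intro z hz
    filter_upwards [hτβ z hz, hskew z hz] with x hx hx2 u v
    rw [hx]
    simp only [sub_apply, hx2 u v, hsk u v]
    ring
  have hcl' : ∀ z ∈ Z, ∀ᶠ x in 𝓝 z, IsClosedAt τ x := by
    intro z hz
    filter_upwards [(hτβ z hz).eventually_nhds, hcl z hz] with x hx hx2
    exact hx2.congr ω₀ hx
  have h0' : ∀ z ∈ Z, ∀ᶠ x in 𝓝 z, P x = 0 → τ x = 0 := by
    intro z hz
    filter_upwards [hτβ z hz, h0 z hz] with x hx hx2 hp
    ext u v
    rw [hx, hx2 hp]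
    exact sub_self (ω₀ u v)
  have hprim : ∀ z ∈ Z, ∀ᶠ x in 𝓝 z, ∀ a b, fderiv ℝ (homotopyForm P hτ) x a b -
      fderiv ℝ (homotopyForm P hτ) x b a = τ x a b := by
    intro z hz
    filter_upwards [hscale z hz (hskew' z hz).eventually_nhds, hscale z hz (hcl' z hz),
      hscale z hz (h0' z hz)] with x h1 h2 h3
    refine homotopyForm_primitive P hτ h1 h2 (h3 0 ?_)
    simp [scaleMap_apply, hP]
  have hτz : ∀ z ∈ Z, τ z = 0 := fun z hz => (h0' z hz).self_of_nhds (hZP z hz)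
  -- The primitive vanishes on the kernel of `P`; hence near `Z` so does the field, and the flow
  -- fixes the points of the kernel.
  have hαP : ∀ x, P x = 0 → homotopyForm P hτ x = 0 := fun x hx =>
    homotopyForm_eq_zero P hτ (by simp [hx])
  obtain ⟨X, hX, hX0, hX1, hX2⟩ := exists_moser_field hnd hτ (contDiff_homotopyForm P hτ) hZ hτz
    (fun z hz => hαP z (hZP z hz))
    (fun z hz => fderiv_homotopyForm_eq_zero P hτ (hZP z hz) (hτz z hz))
  obtain ⟨Γ, hΓ⟩ := exists_flow_near_zeros hX hZ hX0 hX1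
  refine ⟨fun x => Γ x 1, fun z hz => ?_⟩
  obtain ⟨hΓz, hΓ1, hΓ2⟩ := hΓ z hz
  have hΓc : Tendsto Γ (𝓝 z) (𝓝 (constCurve G z)) := by
    have := hΓ1.self_of_nhds.1.continuousAt.tendsto
    rwa [hΓz] at this
  have hid : (∀ᶠ x in 𝓝 z, ∀ t : I, homotopyForm P hτ x = 0 → Γ x t = x) := by
    filter_upwards [hX2 z hz, hΓ2] with x h1 h2 t h3
    rw [h2 fun s => (h1 s).2 h3]
    rfl
  refine ⟨?_, hid.mono fun x hx hp => hx 1 (hαP x hp), fun h => ?_⟩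
  · have g1 := hΓc.eventually (eventually_forall_curve ((hskew' z hz).eventually_nhds))
    have g2 := hΓc.eventually (eventually_forall_curve (hcl' z hz))
    have g3 := hΓc.eventually (eventually_forall_curve (hprim z hz))
    have g4 := hΓc.eventually (eventually_forall_curve (hX2 z hz).eventually_nhds)
    have g5 := hΓc.eventually (eventually_forall_curve (hτβ z hz))
    filter_upwards [g1, g2, g3, g4, g5, hΓ1.eventually_nhds] with x f1 f2 f3 f4 f5 f6
    have hs : ContDiffAt ℝ ∞ Γ x := f6.self_of_nhds.1
    have hd : HasFDerivAt Γ (fderiv ℝ Γ x) x := (hs.differentiableAt (by simp)).hasFDerivAt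
    have hψ : HasFDerivAt (fun y => Γ y 1)
        ((ContinuousMap.evalCLM ℝ (1 : I)).comp (fderiv ℝ Γ x)) x :=
      HasFDerivAt.comp x (ContinuousMap.evalCLM ℝ (1 : I) (M := G)).hasFDerivAt hd
    refine ⟨(ContinuousMap.evalCLM ℝ (1 : I) (M := G)).contDiff.contDiffAt.comp x hs,
      fun u v => ?_⟩
    -- Differentiating the integral equation in the initial point gives the linearized equation
    -- needed by `moser_transport`.
    have hη : ∀ u, fderiv ℝ Γ x u - integrateCLM G (fderiv ℝ (timeComp X hX.continuous) (Γ x)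
        (fderiv ℝ Γ x u)) = constCurve G u := by
      have e1 : HasFDerivAt (fun y => timeComp X hX.continuous (Γ y))
          ((fderiv ℝ (timeComp X hX.continuous) (Γ x)).comp (fderiv ℝ Γ x)) x :=
        HasFDerivAt.comp x ((contDiff_timeComp hX).differentiable (by simp) _).hasFDerivAt hd
      have e2 := hd.sub (HasFDerivAt.comp x (integrateCLM G).hasFDerivAt e1)
      have e3 := e2.congr_of_eventuallyEq (f₁ := constCurve G)
        (f6.mono fun y hy => hy.2.symm)
      intro u
      exact congrArg (fun A : G →L[ℝ] C(I, G) => A u) (e3.unique (constCurve G).hasFDerivAt)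
    have key := moser_transport (α := homotopyForm P hτ) hsk hτ hX f6.self_of_nhds.2 hη f1 f2 f3
      (fun t a b => moser_field_fderiv hτ (contDiff_homotopyForm P hτ) hX
        ((f4 t).mono fun y hy => (hy t).1) a b) u v
    rw [hψ.fderiv, ← key, f5 1]
    simp
  -- If the form is already `ω₀` near `z`, then `τ` vanishes along the whole segment from `x` to `x
  -- - P x`, so the primitive vanishes at `x` and the flow does not move it.
  · have h1 : ∀ᶠ x in 𝓝 z, τ x = 0 := by
      filter_upwards [hτβ z hz, h] with x hx hx2
      ext u v
      rw [hx, hx2]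
      exact sub_self (ω₀ u v)
    filter_upwards [hid, hscale z hz h1] with x hx hx2
    exact hx 1 (homotopyForm_eq_zero P hτ fun s => by rw [hx2 s]; simp)

end MoserTheorem

end

section

open scoped RealInnerProductSpace

/-! ### Symplectic linear algebra and pullbacks -/

section ClmApply

variable {X V W : Type*} [NormedAddCommGroup X] [NormedSpace ℝ X] [NormedAddCommGroup V]
  [NormedSpace ℝ V] [FiniteDimensional ℝ V] [NormedAddCommGroup W] [NormedSpace ℝ W]

lemma contDiffAt_of_clm_apply {f : X → V →L[ℝ] W} {x : X}
    (h : ∀ v, ContDiffAt ℝ ∞ (fun x => f x v) x) : ContDiffAt ℝ ∞ f x := by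
  let d := Module.finrank ℝ V
  have hd : d = Module.finrank ℝ (Fin d → ℝ) := (Module.finrank_fin_fun ℝ).symm
  let e₁ := ContinuousLinearEquiv.ofFinrankEq hd
  let e₂ := (e₁.arrowCongr (1 : W ≃L[ℝ] W)).trans (ContinuousLinearEquiv.piRing (Fin d))
  rw [← Function.id_comp f, ← e₂.symm_comp_self]
  exact e₂.symm.contDiff.contDiffAt.comp x (contDiffAt_pi.mpr fun i => h _)

end ClmApply

section LinearAlgebra

variable {E F : Type} [NormedAddCommGroup E] [InnerProductSpace ℝ E] [FiniteDimensional ℝ E]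
  [NormedAddCommGroup F] [InnerProductSpace ℝ F] [FiniteDimensional ℝ F]

/-- The vector dual to a covector. -/
def sharp (E : Type) [NormedAddCommGroup E] [InnerProductSpace ℝ E] [FiniteDimensional ℝ E] :
    (E →L[ℝ] ℝ) ≃L[ℝ] E :=
  haveI := FiniteDimensional.complete ℝ E
  LinearEquiv.toContinuousLinearEquiv
    { toFun := (InnerProductSpace.toDual ℝ E).symm
      invFun := InnerProductSpace.toDual ℝ E
      map_add' := by simp
      map_smul' := by simp
      left_inv := fun x => by simp
      right_inv := fun x => by simp }

@[simp] lemma inner_sharp (p : E →L[ℝ] ℝ) (w : E) : ⟪sharp E p, w⟫ = p w := by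
  have := FiniteDimensional.complete ℝ E
  exact InnerProductSpace.toDual_symm_apply (𝕜 := ℝ)

@[simp] lemma sharp_symm_apply (v w : E) : (sharp E).symm v w = ⟪v, w⟫ := by
  rw [← inner_sharp, ContinuousLinearEquiv.apply_symm_apply]

/-- The bilinear form `(v, w) ↦ ⟪v, w⟫`. -/
def flat (E : Type) [NormedAddCommGroup E] [InnerProductSpace ℝ E] [FiniteDimensional ℝ E] :
    E →L[ℝ] E →L[ℝ] ℝ := ((sharp E).symm : E →L[ℝ] E →L[ℝ] ℝ)

@[simp] lemma flat_apply (v w : E) : flat E v w = ⟪v, w⟫ := sharp_symm_apply v w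

/-- The standard symplectic form `dy ∧ dx` on `E × E`. -/
def stdBil (E : Type) [NormedAddCommGroup E] [InnerProductSpace ℝ E] [FiniteDimensional ℝ E] :
    (E × E) →L[ℝ] (E × E) →L[ℝ] ℝ :=
  (flat E).bilinearComp (ContinuousLinearMap.snd ℝ E E) (ContinuousLinearMap.fst ℝ E E) -
    ((flat E).bilinearComp (ContinuousLinearMap.snd ℝ E E) (ContinuousLinearMap.fst ℝ E E)).flip

@[simp] lemma stdBil_apply (u v : E × E) : stdBil E u v = ⟪u.2, v.1⟫ - ⟪v.2, u.1⟫ := by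
  simp [stdBil]

lemma stdBil_skew (u v : E × E) : stdBil E u v = -stdBil E v u := by simp

lemma stdBil_nondegenerate (u : E × E) (h : stdBil E u = 0) : u = 0 := by
  have h1 := congrArg (fun A : E × E →L[ℝ] ℝ => A (u.2, -u.1)) h
  simp only [stdBil_apply, inner_neg_left, zero_apply, sub_neg_eq_add] at h1
  have h2 := real_inner_self_nonneg (x := u.1)
  have h3 := real_inner_self_nonneg (x := u.2)
  have h4 : ⟪u.1, u.1⟫ = 0 := by linarith
  have h5 : ⟪u.2, u.2⟫ = 0 := by linarith
  exact Prod.ext (inner_self_eq_zero.1 h4) (inner_self_eq_zero.1 h5)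

/-- The composition `S ∘ J`, where `⟪S u, w⟫ = b u w`. -/
def raise (b : F →L[ℝ] F →L[ℝ] ℝ) (J : E →L[ℝ] F) : E →L[ℝ] F :=
  ((sharp F : (F →L[ℝ] ℝ) →L[ℝ] F).comp b).comp J

lemma inner_raise (b : F →L[ℝ] F →L[ℝ] ℝ) (J : E →L[ℝ] F) (v : E) (w : F) :
    ⟪raise b J v, w⟫ = b (J v) w := by simp [raise]

/-- The Gram form of `raise b J`. -/
def gram (b : F →L[ℝ] F →L[ℝ] ℝ) (J : E →L[ℝ] F) : E →L[ℝ] E →L[ℝ] ℝ :=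
  (flat F).bilinearComp (raise b J) (raise b J)

lemma gram_apply (b : F →L[ℝ] F →L[ℝ] ℝ) (J : E →L[ℝ] F) (v w : E) :
    gram b J v w = ⟪raise b J v, raise b J w⟫ := by simp [gram]

/-- A map dual to `J` with respect to `b`. -/
def dualMap (b : F →L[ℝ] F →L[ℝ] ℝ) (J : E →L[ℝ] F) : E →L[ℝ] F :=
  -((raise b J).comp ((ContinuousLinearMap.inverse (gram b J)).comp (flat E)))

lemma exists_gram_equiv {b : F →L[ℝ] F →L[ℝ] ℝ} (hb : ∀ u, b u = 0 → u = 0) {J : E →L[ℝ] F}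
    (hJ : Function.Injective J) :
    ∃ e : E ≃L[ℝ] (E →L[ℝ] ℝ), (e : E →L[ℝ] E →L[ℝ] ℝ) = gram b J := by
  refine exists_equiv_of_nondegenerate _ fun u hu => ?_
  have h1 : gram b J u u = 0 := by rw [hu]; rfl
  rw [gram_apply, inner_self_eq_zero] at h1
  have h2 : b (J u) = 0 := by
    ext w; rw [← inner_raise, h1]; simp
  exact (map_eq_zero_iff J hJ).1 (hb _ h2)

/-- The left side is minus the Gram form evaluated at `v` and at the Gram-inverse of `⟪p, ·⟫`. An
explicit formula for the dual map is preferred to a choice because it depends smoothly on `b` and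
`J`. -/
lemma dualMap_spec {b : F →L[ℝ] F →L[ℝ] ℝ} (hb : ∀ u, b u = 0 → u = 0) {J : E →L[ℝ] F}
    (hJ : Function.Injective J) (v p : E) : b (J v) (dualMap b J p) = -⟪p, v⟫ := by
  obtain ⟨e, he⟩ := exists_gram_equiv hb hJ
  rw [← inner_raise]
  simp only [dualMap, neg_apply, ContinuousLinearMap.comp_apply, inner_neg_right,
    neg_inj]
  rw [real_inner_comm, ← gram_apply, ← he, ContinuousLinearMap.inverse_equiv]
  simp

/-- The correction which makes `A` isotropic. -/
def isotropicCorrection (b : F →L[ℝ] F →L[ℝ] ℝ) (A : E →L[ℝ] F) : E →L[ℝ] E :=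
  (1 / 2 : ℝ) • (sharp E : (E →L[ℝ] ℝ) →L[ℝ] E).comp (b.bilinearComp A A)

lemma inner_isotropicCorrection (b : F →L[ℝ] F →L[ℝ] ℝ) (A : E →L[ℝ] F) (p w : E) :
    ⟪w, isotropicCorrection b A p⟫ = 1 / 2 * b (A p) (A w) := by
  rw [real_inner_comm]
  simp [isotropicCorrection, inner_smul_left]

/-- Since the image of `J` is isotropic, adding `J ∘ C` to `A` keeps the pairing with `J` and
changes `b (A p) (A w)` by two terms, each minus one half of it. This explains the `1 / 2` in
`isotropicCorrection`. -/
lemma corrected_spec {b : F →L[ℝ] F →L[ℝ] ℝ} (hb : ∀ u v, b u v = -b v u) {J A : E →L[ℝ] F}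
    (hJ : ∀ v w, b (J v) (J w) = 0) (hA : ∀ v p, b (J v) (A p) = -⟪p, v⟫) (u v : E × E) :
    b (J u.1 + (A u.2 + J (isotropicCorrection b A u.2)))
      (J v.1 + (A v.2 + J (isotropicCorrection b A v.2))) = stdBil E u v := by
  have h1 := inner_isotropicCorrection b A u.2 v.2
  have h2 := inner_isotropicCorrection b A v.2 u.2
  have h3 := hb (A u.2) (A v.2)
  simp only [map_add, add_apply, hJ, hA, stdBil_apply,
    hb (A u.2) (J v.1), hb (A u.2) (J (isotropicCorrection b A v.2)), h1, h2]
  rw [h3]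
  ring

variable {X : Type} [NormedAddCommGroup X] [NormedSpace ℝ X]

lemma contDiffAt_bilinearComp {b : X → F →L[ℝ] F →L[ℝ] ℝ} {A B : X → E →L[ℝ] F} {x : X}
    (hb : ContDiffAt ℝ ∞ b x) (hA : ContDiffAt ℝ ∞ A x) (hB : ContDiffAt ℝ ∞ B x) :
    ContDiffAt ℝ ∞ (fun x => (b x).bilinearComp (A x) (B x)) x :=
  contDiffAt_of_clm_apply fun _ => contDiffAt_of_clm_apply fun _ =>
    (hb.clm_apply (hA.clm_apply contDiffAt_const)).clm_apply (hB.clm_apply contDiffAt_const)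

lemma contDiffAt_raise {b : X → F →L[ℝ] F →L[ℝ] ℝ} {J : X → E →L[ℝ] F} {x : X}
    (hb : ContDiffAt ℝ ∞ b x) (hJ : ContDiffAt ℝ ∞ J x) :
    ContDiffAt ℝ ∞ (fun x => raise (b x) (J x)) x :=
  (contDiffAt_const.clm_comp hb).clm_comp hJ

set_option synthInstance.maxHeartbeats 400000 in
lemma contDiffAt_dualMap {b : X → F →L[ℝ] F →L[ℝ] ℝ} {J : X → E →L[ℝ] F} {x : X}
    (hb : ContDiffAt ℝ ∞ b x) (hJ : ContDiffAt ℝ ∞ J x) (hnd : ∀ u, b x u = 0 → u = 0)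
    (hinj : Function.Injective (J x)) : ContDiffAt ℝ ∞ (fun x => dualMap (b x) (J x)) x := by
  have := FiniteDimensional.complete ℝ E
  obtain ⟨e, he⟩ := exists_gram_equiv hnd hinj
  have h1 := contDiffAt_raise hb hJ
  have h2 : ContDiffAt ℝ ∞ (fun x => gram (b x) (J x)) x :=
    contDiffAt_bilinearComp contDiffAt_const h1 h1
  have h3 : ContDiffAt ℝ ∞ (ContinuousLinearMap.inverse :
      (E →L[ℝ] E →L[ℝ] ℝ) → (E →L[ℝ] ℝ) →L[ℝ] E) (gram (b x) (J x)) := by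
    rw [← he]; exact contDiffAt_map_inverse e
  have h4 : ContDiffAt ℝ ∞ (fun x => ContinuousLinearMap.inverse (gram (b x) (J x))) x :=
    (ContDiffAt.comp x h3 h2 :)
  exact (h1.clm_comp (h4.clm_comp contDiffAt_const)).neg

lemma contDiffAt_isotropicCorrection {b : X → F →L[ℝ] F →L[ℝ] ℝ} {A : X → E →L[ℝ] F} {x : X}
    (hb : ContDiffAt ℝ ∞ b x) (hA : ContDiffAt ℝ ∞ A x) :
    ContDiffAt ℝ ∞ (fun x => isotropicCorrection (b x) (A x)) x :=
  contDiffAt_of_clm_apply fun _ => contDiffAt_const.smul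
    ((sharp E).contDiff.contDiffAt.comp x
      ((contDiffAt_bilinearComp hb hA hA).clm_apply contDiffAt_const))

end LinearAlgebra

section Pullback

variable {G F : Type} [NormedAddCommGroup G] [NormedSpace ℝ G] [FiniteDimensional ℝ G]
  [NormedAddCommGroup F] [NormedSpace ℝ F] [FiniteDimensional ℝ F]

/-- The pullback of a bilinear-form valued map. -/
def pullBil (β : F → F →L[ℝ] F →L[ℝ] ℝ) (f : G → F) (y : G) : G →L[ℝ] G →L[ℝ] ℝ :=
  (β (f y)).bilinearComp (fderiv ℝ f y) (fderiv ℝ f y)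

@[simp] lemma pullBil_apply (β : F → F →L[ℝ] F →L[ℝ] ℝ) (f : G → F) (y u v : G) :
    pullBil β f y u v = β (f y) (fderiv ℝ f y u) (fderiv ℝ f y v) := rfl

lemma contDiffAt_pullBil {β : F → F →L[ℝ] F →L[ℝ] ℝ} {f : G → F} {y : G}
    (hf : ContDiffAt ℝ ∞ f y) (hβ : ContDiffAt ℝ ∞ β (f y)) :
    ContDiffAt ℝ ∞ (pullBil β f) y := by
  have h1 : ContDiffAt ℝ ∞ (fun y => β (f y)) y := hβ.comp y hf
  have h2 : ContDiffAt ℝ ∞ (fderiv ℝ f) y := hf.fderiv_right (m := ∞) (by simp)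
  exact contDiffAt_of_clm_apply fun _ => contDiffAt_of_clm_apply fun _ =>
    (h1.clm_apply (h2.clm_apply contDiffAt_const)).clm_apply (h2.clm_apply contDiffAt_const)

/-- Besides the closedness identity of `β`, the cyclic sum contains only terms with second
derivatives of `f`; these cancel in pairs by symmetry of the Hessian and skewness of `β`. -/
lemma isClosedAt_pullBil {β : F → F →L[ℝ] F →L[ℝ] ℝ} {f : G → F} {y : G}
    (hf : ContDiffAt ℝ ∞ f y) (hβ : ContDiffAt ℝ ∞ β (f y)) (hcl : IsClosedAt β (f y))
    (hsk : ∀ u v, β (f y) u v = -β (f y) v u) : IsClosedAt (pullBil β f) y := by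
  have h2 : ContDiffAt ℝ ∞ (fderiv ℝ f) y := hf.fderiv_right (m := ∞) (by simp)
  have d2 : DifferentiableAt ℝ (fderiv ℝ f) y := h2.differentiableAt (by simp)
  have d1 : DifferentiableAt ℝ f y := hf.differentiableAt (by simp)
  have dβ : DifferentiableAt ℝ β (f y) := hβ.differentiableAt (by simp)
  have d3 : DifferentiableAt ℝ (pullBil β f) y :=
    (contDiffAt_pullBil hf hβ).differentiableAt (by simp)
  have key : ∀ a b c, fderiv ℝ (pullBil β f) y a b c =
      fderiv ℝ β (f y) (fderiv ℝ f y a) (fderiv ℝ f y b) (fderiv ℝ f y c) +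
      β (f y) (fderiv ℝ (fderiv ℝ f) y a b) (fderiv ℝ f y c) +
      β (f y) (fderiv ℝ f y b) (fderiv ℝ (fderiv ℝ f) y a c) := by
    intro a b c
    have hl : HasDerivAt (fun r : ℝ => y + r • a) a 0 := hasDerivAt_line y a
    have e1 : HasDerivAt (fun r : ℝ => pullBil β f (y + r • a) b c)
        (fderiv ℝ (pullBil β f) y a b c) 0 := by
      have := hasDerivAt_bilin_comp (x := fun r : ℝ => y + r • a) (t := 0) (by simpa using d3) hl
        (hasDerivAt_const (0 : ℝ) b) (hasDerivAt_const (0 : ℝ) c)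
      simpa using this
    have e2 : HasDerivAt (fun r : ℝ => f (y + r • a)) (fderiv ℝ f y a) 0 := by
      have := hasDerivAt_comp_curve (u := fun r : ℝ => y + r • a) (t := 0) (by simpa using d1) hl
      simpa using this
    have e3 : ∀ w, HasDerivAt (fun r : ℝ => fderiv ℝ f (y + r • a) w)
        (fderiv ℝ (fderiv ℝ f) y a w) 0 := by
      intro w
      have h := hasDerivAt_comp_curve (F := G →L[ℝ] F) (τ := fderiv ℝ f)
        (u := fun r : ℝ => y + r • a) (t := 0) (by simpa using d2) hl
      have := h.clm_apply (hasDerivAt_const (0 : ℝ) w)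
      simpa using this
    have e4 := hasDerivAt_bilin_comp (τ := β) (x := fun r : ℝ => f (y + r • a)) (t := 0)
      (by simpa using dβ) e2 (e3 b) (e3 c)
    refine (e1.unique e4).trans ?_
    simp
  have hsymm : ∀ a b, fderiv ℝ (fderiv ℝ f) y a b = fderiv ℝ (fderiv ℝ f) y b a := fun a b =>
    (hf.isSymmSndFDerivAt (by simpa using WithTop.coe_le_coe.2 (le_top : (2 : ℕ∞) ≤ ⊤))).eq a b
  intro u v w
  rw [key, key, key, hsymm v u, hsymm w u, hsymm w v]
  have k := hcl (fderiv ℝ f y u) (fderiv ℝ f y v) (fderiv ℝ f y w)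
  have k1 := hsk (fderiv ℝ f y u) (fderiv ℝ (fderiv ℝ f) y v w)
  have k2 := hsk (fderiv ℝ f y v) (fderiv ℝ (fderiv ℝ f) y u w)
  have k3 := hsk (fderiv ℝ f y w) (fderiv ℝ (fderiv ℝ f) y u v)
  linarith

end Pullback

end

section

open scoped RealInnerProductSpace

/-! ### The relative Weinstein theorem in coordinates -/

section LocalWeinstein

variable {E F : Type} [NormedAddCommGroup E] [InnerProductSpace ℝ E] [FiniteDimensional ℝ E]
  [NormedAddCommGroup F] [InnerProductSpace ℝ F] [FiniteDimensional ℝ F]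

/-- `f` is smooth at `y` and pulls `β` back to the standard form at `y`. -/
def IsSymplAt (β : F → F →L[ℝ] F →L[ℝ] ℝ) (f : E × E → F) (y : E × E) : Prop :=
  ContDiffAt ℝ ∞ f y ∧ ∀ u v, β (f y) (fderiv ℝ f y u) (fderiv ℝ f y v) = stdBil E u v

/-- Near `(x, 0)`, `f` is symplectic and restricts to `j` on `E × 0`. -/
def IsLocalWeinsteinAt (β : F → F →L[ℝ] F →L[ℝ] ℝ) (j : E → F) (f : E × E → F) (x : E) : Prop :=
  (∀ᶠ y in 𝓝 (x, (0 : E)), IsSymplAt β f y) ∧ ∀ᶠ x' in 𝓝 x, f (x', 0) = j x'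

lemma tendsto_prodMk_zero (x : E) : Tendsto (fun x' : E => (x', (0 : E))) (𝓝 x) (𝓝 (x, 0)) :=
  (by fun_prop : Continuous fun x' : E => (x', (0 : E))).continuousAt

lemma tendsto_fst_nhds (x : E) : Tendsto (Prod.fst : E × E → E) (𝓝 (x, 0)) (𝓝 x) :=
  continuous_fst.continuousAt

lemma IsLocalWeinsteinAt.eventually {β : F → F →L[ℝ] F →L[ℝ] ℝ} {j : E → F} {f : E × E → F} {x : E}
    (h : IsLocalWeinsteinAt β j f x) : ∀ᶠ x' in 𝓝 x, IsLocalWeinsteinAt β j f x' :=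
  ((tendsto_prodMk_zero x).eventually h.1.eventually_nhds).and h.2.eventually_nhds

/-- The restriction of the derivative to the fibre direction. -/
def fibreDeriv (f : E × E → F) (x : E) : E →L[ℝ] F :=
  (fderiv ℝ f (x, 0)).comp (ContinuousLinearMap.inr ℝ E E)

lemma fderiv_prod_eq {f : E × E → F} {j : E → F} {x : E} (hf : DifferentiableAt ℝ f (x, 0))
    (hj : ∀ᶠ x' in 𝓝 x, f (x', 0) = j x') (u : E × E) :
    fderiv ℝ f (x, 0) u = fderiv ℝ j x u.1 + fibreDeriv f x u.2 := by
  have h1 : HasFDerivAt (fun x' : E => f (x', 0))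
      ((fderiv ℝ f (x, 0)).comp (ContinuousLinearMap.inl ℝ E E)) x :=
    HasFDerivAt.comp x hf.hasFDerivAt (ContinuousLinearMap.inl ℝ E E).hasFDerivAt
  have h2 : fderiv ℝ j x = (fderiv ℝ f (x, 0)).comp (ContinuousLinearMap.inl ℝ E E) := by
    rw [← h1.fderiv]
    exact Filter.EventuallyEq.fderiv_eq (hj.mono fun y hy => hy.symm)
  rw [h2]
  simp only [fibreDeriv, ContinuousLinearMap.comp_apply, ← map_add]
  simp

/-- A local form of Weinstein's theorem, relative to a set `A` near which a solution `Ψ` is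
given. -/
theorem exists_local_weinstein {β : F → F →L[ℝ] F →L[ℝ] ℝ} {O : Set F} (hO : IsOpen O)
    (hβ : ∀ x ∈ O, ContDiffAt ℝ ∞ β x) (hcl : ∀ x ∈ O, IsClosedAt β x)
    (hsk : ∀ x ∈ O, ∀ u v, β x u v = -β x v u) (hnd : ∀ x ∈ O, ∀ u, β x u = 0 → u = 0)
    {U : Set E} (hU : IsOpen U) {j : E → F} (hj : ∀ x ∈ U, ContDiffAt ℝ ∞ j x)
    (hjO : ∀ x ∈ U, j x ∈ O) (hinj : ∀ x ∈ U, Function.Injective (fderiv ℝ j x))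
    (hiso : ∀ x ∈ U, ∀ u v, β (j x) (fderiv ℝ j x u) (fderiv ℝ j x v) = 0)
    {A K : Set E} (hA : IsClosed A) (hK : IsCompact K) (hKU : K ⊆ U) {Ψ : E × E → F}
    (hΨ : ∀ x ∈ A ∩ K, IsLocalWeinsteinAt β j Ψ x) :
    ∃ Ψ' : E × E → F, (∀ x ∈ K, IsLocalWeinsteinAt β j Ψ' x) ∧
      ∀ x ∈ A ∩ K, Ψ' =ᶠ[𝓝 (x, 0)] Ψ := by
  -- a cutoff function for the region where `Ψ` is defined
  let UA : Set E := {x | IsLocalWeinsteinAt β j Ψ x}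
  have hUA : IsOpen UA := isOpen_iff_mem_nhds.2 fun x hx => IsLocalWeinsteinAt.eventually hx
  obtain ⟨χ, hχ, hχ1, hχ0⟩ := exists_contDiff_cutoff (hK.inter_left hA) hUA hΨ
  have hdich : ∀ x, x ∈ UA ∨ χ x = 0 := fun x => by
    by_cases hx : x ∈ UA
    · exact Or.inl hx
    · exact Or.inr (hχ0 x hx).self_of_nhds
  -- the first order data along the zero section
  let b : E → F →L[ℝ] F →L[ℝ] ℝ := fun x => β (j x)
  let J : E → E →L[ℝ] F := fun x => fderiv ℝ j x
  let B : E → E →L[ℝ] F := fun x => dualMap (b x) (J x)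
  let A₀ : E → E →L[ℝ] F := fun x => χ x • fibreDeriv Ψ x + (1 - χ x) • B x
  let C : E → E →L[ℝ] E := fun x => isotropicCorrection (b x) (A₀ x)
  -- Interpolates between `Ψ` and the fibrewise affine map `j x + B x p`. Both have the correct
  -- pairing with the image of `J`, which survives convex combination; isotropy of the fibre
  -- directions does not, and the last term restores it.
  let Φ : E × E → F := fun y => χ y.1 • Ψ y + (1 - χ y.1) • (j y.1 + B y.1 y.2) +
    J y.1 (C y.1 y.2)
  have hb : ∀ x ∈ U, ContDiffAt ℝ ∞ b x := fun x hx => (hβ _ (hjO x hx)).comp x (hj x hx)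
  have hJ : ∀ x ∈ U, ContDiffAt ℝ ∞ J x := fun x hx => (hj x hx).fderiv_right (m := ∞) (by simp)
  have hB : ∀ x ∈ U, ContDiffAt ℝ ∞ B x := fun x hx =>
    contDiffAt_dualMap (hb x hx) (hJ x hx) (hnd _ (hjO x hx)) (hinj x hx)
  have hA₀ : ∀ x ∈ U, ContDiffAt ℝ ∞ A₀ x := by
    intro x hx
    refine ContDiffAt.add ?_ ((contDiffAt_const.sub hχ.contDiffAt).smul (hB x hx))
    by_cases hxA : x ∈ UA
    · have h1 : ContDiffAt ℝ ∞ (fderiv ℝ Ψ) (x, 0) :=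
        hxA.1.self_of_nhds.1.fderiv_right (m := ∞) (by simp)
      have h2 : ContDiffAt ℝ ∞ (fun x => fderiv ℝ Ψ (x, 0)) x :=
        (h1.comp x (contDiffAt_id.prodMk contDiffAt_const) :)
      exact hχ.contDiffAt.smul (h2.clm_comp contDiffAt_const)
    · refine (contDiffAt_const (c := (0 : E →L[ℝ] F))).congr_of_eventuallyEq ?_
      filter_upwards [hχ0 x hxA] with y hy
      simp [hy]
  have hC : ∀ x ∈ U, ContDiffAt ℝ ∞ C x := fun x hx =>
    contDiffAt_isotropicCorrection (hb x hx) (hA₀ x hx)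
  have hΦ : ∀ x ∈ U, ∀ᶠ y in 𝓝 (x, (0 : E)), ContDiffAt ℝ ∞ Φ y := by
    intro x hx
    have hU' : ∀ᶠ y : E × E in 𝓝 (x, 0), y.1 ∈ U :=
      (tendsto_fst_nhds x).eventually (hU.mem_nhds hx)
    have h1 : ∀ᶠ y : E × E in 𝓝 (x, 0), ContDiffAt ℝ ∞ (fun y : E × E => χ y.1 • Ψ y) y := by
      by_cases hxA : x ∈ UA
      · filter_upwards [hxA.1] with y hy
        exact (hχ.comp contDiff_fst).contDiffAt.smul hy.1
      · filter_upwards [((tendsto_fst_nhds x).eventually (hχ0 x hxA)).eventually_nhds] with y hy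
        refine (contDiffAt_const (c := (0 : F))).congr_of_eventuallyEq ?_
        filter_upwards [hy] with w hw
        simp [hw]
    filter_upwards [hU', h1] with y hy hy1
    have e1 : ContDiffAt ℝ ∞ (fun y : E × E => B y.1) y := (hB _ hy).comp y contDiffAt_fst
    have e2 : ContDiffAt ℝ ∞ (fun y : E × E => J y.1) y := (hJ _ hy).comp y contDiffAt_fst
    have e3 : ContDiffAt ℝ ∞ (fun y : E × E => C y.1) y := (hC _ hy).comp y contDiffAt_fst
    have e4 : ContDiffAt ℝ ∞ (fun y : E × E => j y.1) y := (hj _ hy).comp y contDiffAt_fst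
    have e5 : ContDiffAt ℝ ∞ (fun y : E × E => χ y.1) y := (hχ.comp contDiff_fst).contDiffAt
    exact (hy1.add ((contDiffAt_const.sub e5).smul (e4.add (e1.clm_apply contDiffAt_snd)))).add
      (e2.clm_apply (e3.clm_apply contDiffAt_snd))
  have hΦ0 : ∀ x, Φ (x, 0) = j x := by
    intro x
    rcases hdich x with hx | hx
    · have : Ψ (x, 0) = j x := hx.2.self_of_nhds
      simp only [Φ, map_zero, add_zero, this, ← add_smul]
      simp
    · simp [Φ, hx]
  have hΦf : ∀ x ∈ U, fibreDeriv Φ x = A₀ x + (J x).comp (C x) := by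
    intro x hx
    have d1 : HasFDerivAt (fun p : E => Φ (x, p)) (fibreDeriv Φ x) 0 :=
      HasFDerivAt.comp (0 : E) ((hΦ x hx).self_of_nhds.differentiableAt (by simp)).hasFDerivAt
        (hasFDerivAt_prodMk_right x 0)
    have d2 : HasFDerivAt (fun p : E => χ x • Ψ (x, p)) (χ x • fibreDeriv Ψ x) 0 := by
      rcases hdich x with hxA | hx0
      · have : HasFDerivAt (fun p : E => Ψ (x, p)) (fibreDeriv Ψ x) 0 :=
          HasFDerivAt.comp (0 : E)
            (hxA.1.self_of_nhds.1.differentiableAt (by simp)).hasFDerivAt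
            (hasFDerivAt_prodMk_right x 0)
        exact this.const_smul _
      · simpa [hx0] using hasFDerivAt_const (0 : F) (0 : E)
    have d3 : HasFDerivAt (fun p : E => (1 - χ x) • (j x + B x p)) ((1 - χ x) • B x) 0 :=
      ((B x).hasFDerivAt.const_add (j x)).const_smul _
    have d4 : HasFDerivAt (fun p : E => J x (C x p)) ((J x).comp (C x)) 0 :=
      ((J x).comp (C x)).hasFDerivAt
    exact d1.unique ((d2.add d3).add d4)
  have hΨf : ∀ x ∈ UA, ∀ v p, b x (J x v) (fibreDeriv Ψ x p) = -⟪p, v⟫ := by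
    intro x hx v p
    have h := hx.1.self_of_nhds
    have e := fderiv_prod_eq (h.1.differentiableAt (by simp)) hx.2
    have h2 := h.2 (v, 0) (0, p)
    rw [e, e, hx.2.self_of_nhds] at h2
    simpa using h2
  have hΨff : ∀ x ∈ UA, ∀ p w, b x (fibreDeriv Ψ x p) (fibreDeriv Ψ x w) = 0 := by
    intro x hx v p
    have h := hx.1.self_of_nhds
    have e := fderiv_prod_eq (h.1.differentiableAt (by simp)) hx.2
    have h2 := h.2 (0, v) (0, p)
    rw [e, e, hx.2.self_of_nhds] at h2
    simpa using h2
  have hA₀J : ∀ x ∈ U, ∀ v p, b x (J x v) (A₀ x p) = -⟪p, v⟫ := by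
    intro x hx v p
    have h1 := dualMap_spec (hnd _ (hjO x hx)) (hinj x hx) v p
    have h2 : χ x * b x (J x v) (fibreDeriv Ψ x p) = χ x * -⟪p, v⟫ := by
      rcases hdich x with hxA | hx0
      · rw [hΨf x hxA]
      · rw [hx0, zero_mul, zero_mul]
    change b x (J x v) (χ x • fibreDeriv Ψ x p + (1 - χ x) • B x p) = _
    rw [map_add, map_smul, map_smul, smul_eq_mul, smul_eq_mul, h2, h1]
    ring
  have hΦpull : ∀ x ∈ U, pullBil β Φ (x, 0) = stdBil E := by
    intro x hx
    refine ContinuousLinearMap.ext fun u => ContinuousLinearMap.ext fun v => ?_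
    have e := fderiv_prod_eq ((hΦ x hx).self_of_nhds.differentiableAt (by simp))
      (Eventually.of_forall hΦ0)
    rw [pullBil_apply, e, e, hΦ0, hΦf x hx]
    exact corrected_spec (hsk _ (hjO x hx)) (hiso x hx) (hA₀J x hx) u v
  have hΦO : ∀ x ∈ U, ∀ᶠ y in 𝓝 (x, (0 : E)), Φ y ∈ O := fun x hx =>
    (hΦ x hx).self_of_nhds.continuousAt.eventually_mem
      (hO.mem_nhds (by rw [hΦ0]; exact hjO x hx))
  -- Here the cutoff is `1` and the fibre derivative of `Ψ` is already isotropic, so the correction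
  -- is zero.
  have hΦΨ : ∀ x ∈ A ∩ K, Φ =ᶠ[𝓝 (x, 0)] Ψ := by
    intro x hx
    have hxA := IsLocalWeinsteinAt.eventually (hΨ x hx)
    filter_upwards [(tendsto_fst_nhds x).eventually hxA,
      (tendsto_fst_nhds x).eventually (hχ1 x hx)] with y hy1 hy2
    have h0 : A₀ y.1 = fibreDeriv Ψ y.1 := by simp [A₀, hy2]
    have hC0 : C y.1 y.2 = 0 := by
      refine ext_inner_left ℝ fun w => ?_
      rw [inner_isotropicCorrection, h0]
      simpa using hΨff y.1 hy1 y.2 w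
    simp [Φ, hy2, hC0]
  -- Moser's theorem
  let P : E × E →L[ℝ] E × E := (ContinuousLinearMap.inr ℝ E E).comp (ContinuousLinearMap.snd ℝ E E)
  have hPz : ∀ y : E × E, P y = 0 ↔ y = (y.1, 0) := fun y => by
    simp [P, Prod.ext_iff]
  have hZ : IsCompact ((fun x : E => (x, (0 : E))) '' K) := hK.image (by fun_prop)
  obtain ⟨ψ, hψ⟩ := exists_moser_map (P := P) (fun x => by simp [P]) stdBil_nondegenerate
    stdBil_skew (β := pullBil β Φ) hZ
    (by rintro _ ⟨x, -, rfl⟩; simp [P])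
    (by
      rintro _ ⟨x, hx, rfl⟩
      filter_upwards [hΦ x (hKU hx), hΦO x (hKU hx)] with y h1 h2
      exact contDiffAt_pullBil h1 (hβ _ h2))
    (by
      rintro _ ⟨x, hx, rfl⟩
      filter_upwards [hΦO x (hKU hx)] with y h2 u v
      exact hsk _ h2 _ _)
    (by
      rintro _ ⟨x, hx, rfl⟩
      filter_upwards [hΦ x (hKU hx), hΦO x (hKU hx)] with y h1 h2
      exact isClosedAt_pullBil h1 (hβ _ h2) (hcl _ h2) (hsk _ h2))
    (by
      rintro _ ⟨x, hx, rfl⟩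
      filter_upwards [(tendsto_fst_nhds x).eventually (hU.mem_nhds (hKU hx))] with y h1 h2
      rw [(hPz y).1 h2]
      exact hΦpull _ h1)
  refine ⟨fun y => Φ (ψ y), fun x hx => ?_, fun x hx => ?_⟩
  · obtain ⟨h1, h2, -⟩ := hψ _ ⟨x, hx, rfl⟩
    have hz : ψ (x, 0) = (x, 0) := h2.self_of_nhds (by simp [P])
    have hc : Tendsto ψ (𝓝 (x, 0)) (𝓝 (x, 0)) := by
      have := h1.self_of_nhds.1.continuousAt.tendsto
      rwa [hz] at this
    refine ⟨?_, ?_⟩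
    · filter_upwards [h1, hc.eventually (hΦ x (hKU hx))] with y f1 f2
      refine ⟨f2.comp y f1.1, fun u v => ?_⟩
      rw [← f1.2 u v]
      have : fderiv ℝ (fun y => Φ (ψ y)) y = (fderiv ℝ Φ (ψ y)).comp (fderiv ℝ ψ y) :=
        fderiv_comp y (f2.differentiableAt (by simp)) (f1.1.differentiableAt (by simp))
      rw [this]
      rfl
    · filter_upwards [(tendsto_prodMk_zero x).eventually h2] with y hy
      rw [hy (by simp [P]), hΦ0]
  · obtain ⟨-, -, h3⟩ := hψ _ ⟨x, hx.2, rfl⟩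
    -- Where `Φ` equals the symplectic `Ψ`, the pulled back form is standard, so Moser's map is the
    -- identity and the prescribed germ is kept.
    have hstd : ∀ᶠ y in 𝓝 (x, (0 : E)), pullBil β Φ y = stdBil E := by
      filter_upwards [(hΦΨ x hx).eventually_nhds, (hΨ x hx).1] with y f1 f2
      refine ContinuousLinearMap.ext fun u => ContinuousLinearMap.ext fun v => ?_
      rw [pullBil_apply, Filter.EventuallyEq.fderiv_eq f1, f1.self_of_nhds]
      exact f2.2 u v
    filter_upwards [h3 hstd, hΦΨ x hx] with y f1 f2
    rw [f1, f2]

end LocalWeinstein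

end

/-! ### Forms and exterior derivatives in charts -/

section Naturality

variable {E H : Type*} [NormedAddCommGroup E] [NormedSpace ℝ E] [TopologicalSpace H]
  {I : ModelWithCorners ℝ E H} [I.Boundaryless] {M : Type*} [TopologicalSpace M] [ChartedSpace H M]
  [IsManifold I ∞ M] {k : ℕ}
  {E' H' : Type*} [NormedAddCommGroup E'] [NormedSpace ℝ E'] [TopologicalSpace H']
  {I' : ModelWithCorners ℝ E' H'} {N : Type*} [TopologicalSpace N] [ChartedSpace H' N]

lemma Form.inChart_eq (θ : Form I M k) (x₀ : M) (y : E) :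
    Form.inChart I θ x₀ y = (θ ((extChartAt I x₀).symm y)).compContinuousLinearMap
      (mfderiv 𝓘(ℝ, E) I (extChartAt I x₀).symm y) := by
  unfold Form.inChart
  rw [I.range_eq_univ, mfderivWithin_univ]
  rfl

lemma contMDiffAt_extChartAt_symm {x₀ : M} {y : E} (hy : y ∈ (extChartAt I x₀).target) :
    ContMDiffAt 𝓘(ℝ, E) I ∞ (extChartAt I x₀).symm y :=
  (contMDiffOn_extChartAt_symm x₀).contMDiffAt ((isOpen_extChartAt_target x₀).mem_nhds hy)

lemma contMDiffAt_extChartAt_of_mem {x₀ x : M} (hx : x ∈ (extChartAt I x₀).source) :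
    ContMDiffAt I 𝓘(ℝ, E) ∞ (extChartAt I x₀) x :=
  contMDiffAt_extChartAt' (by rwa [extChartAt_source] at hx)

/-- The derivative of a map through a chart of the target. -/
lemma mfderiv_eq_comp_extChartAt {f : N → M} {a : N} (hf : ContMDiffAt I' I ∞ f a) {x₀ : M}
    (hx : f a ∈ (extChartAt I x₀).source) :
    mfderiv I' I f a = (mfderiv 𝓘(ℝ, E) I (extChartAt I x₀).symm (extChartAt I x₀ (f a))).comp
      (mfderiv I' 𝓘(ℝ, E) (extChartAt I x₀ ∘ f) a) := by
  have h1 : MDifferentiableAt I' 𝓘(ℝ, E) (extChartAt I x₀ ∘ f) a :=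
    ((contMDiffAt_extChartAt_of_mem hx).comp a hf).mdifferentiableAt (by simp)
  have h2 : MDifferentiableAt 𝓘(ℝ, E) I (extChartAt I x₀).symm ((extChartAt I x₀ ∘ f) a) :=
    (contMDiffAt_extChartAt_symm ((extChartAt I x₀).map_source hx)).mdifferentiableAt (by simp)
  refine Eq.trans (Filter.EventuallyEq.mfderiv_eq
    (f := (extChartAt I x₀).symm ∘ (extChartAt I x₀ ∘ f)) ?_) (mfderiv_comp a h2 h1)
  filter_upwards [hf.continuousAt.preimage_mem_nhds (extChartAt_source_mem_nhds' hx)] with b hb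
  exact ((extChartAt I x₀).left_inv hb).symm

/-- The pullback of a form under a map, computed in a chart. -/
lemma Form.pullback_eq_inChart (θ : Form I M k) {f : N → M} {a : N} (hf : ContMDiffAt I' I ∞ f a)
    {x₀ : M} (hx : f a ∈ (extChartAt I x₀).source) :
    (θ (f a)).compContinuousLinearMap (mfderiv I' I f a) =
      (Form.inChart I θ x₀ (extChartAt I x₀ (f a))).compContinuousLinearMap
        (mfderiv I' 𝓘(ℝ, E) (extChartAt I x₀ ∘ f) a) := by
  rw [mfderiv_eq_comp_extChartAt hf hx, Form.inChart_eq, (extChartAt I x₀).left_inv hx]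
  rfl

/-- The exterior derivative can be computed in any chart. -/
lemma Form.d_eq (θ : Form I M k) {x x₀ : M} (hx : x ∈ (extChartAt I x₀).source)
    (hθ : DifferentiableAt ℝ (Form.inChart I θ x) (extChartAt I x x)) :
    Form.d I θ x = (extDeriv (Form.inChart I θ x₀) (extChartAt I x₀ x)).compContinuousLinearMap
      (mfderiv I 𝓘(ℝ, E) (extChartAt I x₀) x) := by
  set T : E → E := extChartAt I x ∘ (extChartAt I x₀).symm with hT
  set y₀ : E := extChartAt I x₀ x with hy₀
  have hy₀t : y₀ ∈ (extChartAt I x₀).target := (extChartAt I x₀).map_source hx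
  have hsy : (extChartAt I x₀).symm y₀ = x := (extChartAt I x₀).left_inv hx
  have hTy : T y₀ = extChartAt I x x := by rw [hT, Function.comp_apply, hsy]
  have hev : ∀ᶠ y in 𝓝 y₀, y ∈ (extChartAt I x₀).target ∧
      (extChartAt I x₀).symm y ∈ (extChartAt I x).source := by
    have h : ∀ᶠ y in 𝓝 y₀, y ∈ (extChartAt I x₀).target :=
      (isOpen_extChartAt_target x₀).mem_nhds hy₀t
    refine h.and ?_
    refine (contMDiffAt_extChartAt_symm hy₀t).continuousAt.preimage_mem_nhds ?_
    rw [hsy]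
    exact extChartAt_source_mem_nhds x
  have hTc : ContDiffAt ℝ ∞ T y₀ := by
    rw [← contMDiffAt_iff_contDiffAt]
    refine ContMDiffAt.comp y₀ (contMDiffAt_extChartAt_of_mem ?_) (contMDiffAt_extChartAt_symm hy₀t)
    rw [hsy]; exact mem_extChartAt_source x
  -- The two coordinate expressions differ by pullback under the transition map `T`, with which the
  -- exterior derivative commutes.
  have h1 : Form.inChart I θ x₀ =ᶠ[𝓝 y₀] fun y =>
      (Form.inChart I θ x (T y)).compContinuousLinearMap (fderiv ℝ T y) := by
    filter_upwards [hev] with y hy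
    rw [Form.inChart_eq, Form.pullback_eq_inChart θ (contMDiffAt_extChartAt_symm hy.1) hy.2,
      mfderiv_eq_fderiv]
    rfl
  have h2 : extDeriv (Form.inChart I θ x₀) y₀ =
      (extDeriv (Form.inChart I θ x) (T y₀)).compContinuousLinearMap (fderiv ℝ T y₀) := by
    rw [h1.extDeriv_eq]
    exact extDeriv_pullback (by rw [hTy]; exact hθ) hTc
      (by simpa using WithTop.coe_le_coe.2 (le_top : (2 : ℕ∞) ≤ ⊤))
  have h3 : mfderiv I 𝓘(ℝ, E) (extChartAt I x) x =
      (fderiv ℝ T y₀).comp (mfderiv I 𝓘(ℝ, E) (extChartAt I x₀) x) := by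
    have e1 : MDifferentiableAt I 𝓘(ℝ, E) (extChartAt I x₀) x :=
      (contMDiffAt_extChartAt_of_mem hx).mdifferentiableAt (by simp)
    have e2 : MDifferentiableAt 𝓘(ℝ, E) 𝓘(ℝ, E) T (extChartAt I x₀ x) :=
      (hTc.differentiableAt (by simp)).mdifferentiableAt
    rw [← mfderiv_eq_fderiv]
    refine Eq.trans (Filter.EventuallyEq.mfderiv_eq
      (f := T ∘ extChartAt I x₀) ?_) (mfderiv_comp x e2 e1)
    filter_upwards [extChartAt_source_mem_nhds' hx] with z hz
    simp only [hT, Function.comp_apply, (extChartAt I x₀).left_inv hz]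
  unfold Form.d
  rw [I.range_eq_univ, extDerivWithin_univ, h2, h3, hTy]
  rfl

end Naturality

/-! ### The cotangent bundle and its canonical form in charts -/

section CotangentChart

variable {E : Type} [NormedAddCommGroup E] [InnerProductSpace ℝ E] [FiniteDimensional ℝ E]
  {Q : Type*} [TopologicalSpace Q] [ChartedSpace E Q] [IsManifold 𝓘(ℝ, E) ∞ Q]

/-- The chart of the cotangent bundle over the chart of `Q` around `q₀`. -/
def cotChart (q₀ : Q) : PartialEquiv (CotangentBundle 𝓘(ℝ, E) Q) (E × (E →L[ℝ] ℝ)) :=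
  extChartAt (𝓘(ℝ, E).prod 𝓘(ℝ, E →L[ℝ] ℝ)) (zeroCovector 𝓘(ℝ, E) Q q₀)

/-- A bundle chart depends on its centre only through the base point, so charts at zero covectors
suffice. -/
lemma extChartAt_cotangentBundle (a : CotangentBundle 𝓘(ℝ, E) Q) :
    extChartAt (𝓘(ℝ, E).prod 𝓘(ℝ, E →L[ℝ] ℝ)) a = cotChart a.1 := by
  rw [cotChart, FiberBundle.extChartAt, FiberBundle.extChartAt]
  rfl

lemma mem_cotChart_source {q₀ : Q} {a : CotangentBundle 𝓘(ℝ, E) Q} :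
    a ∈ (cotChart q₀).source ↔ a.1 ∈ (extChartAt 𝓘(ℝ, E) q₀).source := by
  rw [cotChart, FiberBundle.extChartAt]
  simp only [zeroCovector, PartialEquiv.trans_source, PartialEquiv.prod_source, mem_inter_iff,
    mem_preimage, Trivialization.source_eq, PartialEquiv.refl_source, mem_prod, mem_univ, and_true]
  constructor
  · intro h
    rw [← (trivializationAt (E →L[ℝ] ℝ) (fun x : Q => TangentSpace 𝓘(ℝ, E) x →L[ℝ] ℝ) q₀).coe_fst'
      h.1]
    exact h.2
  · intro h
    have h1 : a.1 ∈ (trivializationAt (E →L[ℝ] ℝ)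
        (fun x : Q => TangentSpace 𝓘(ℝ, E) x →L[ℝ] ℝ) q₀).baseSet := by
      rw [hom_trivializationAt_baseSet]
      simpa using h
    refine ⟨h1, ?_⟩
    rw [← (trivializationAt (E →L[ℝ] ℝ) (fun x : Q => TangentSpace 𝓘(ℝ, E) x →L[ℝ] ℝ) q₀).coe_fst'
      h1] at h
    exact h

lemma cotChart_target (q₀ : Q) :
    (cotChart q₀).target = (extChartAt 𝓘(ℝ, E) q₀).target ×ˢ (univ : Set (E →L[ℝ] ℝ)) := by
  rw [cotChart, FiberBundle.extChartAt_target]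
  congr 1
  refine inter_eq_left.2 fun y hy => ?_
  have h := (extChartAt 𝓘(ℝ, E) q₀).map_target hy
  rw [mem_preimage, hom_trivializationAt_baseSet]
  simpa [zeroCovector] using h

lemma cotChart_apply {q₀ : Q} {a : CotangentBundle 𝓘(ℝ, E) Q}
    (ha : a.1 ∈ (extChartAt 𝓘(ℝ, E) q₀).source) :
    cotChart q₀ a = (extChartAt 𝓘(ℝ, E) q₀ a.1, (a.2 : TangentSpace 𝓘(ℝ, E) a.1 →L[ℝ] ℝ).comp
      (mfderiv 𝓘(ℝ, E) 𝓘(ℝ, E) (extChartAt 𝓘(ℝ, E) q₀).symm (extChartAt 𝓘(ℝ, E) q₀ a.1))) := by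
  rw [cotChart, FiberBundle.extChartAt]
  have h := TangentBundle.symmL_trivializationAt (I := 𝓘(ℝ, E)) (x₀ := q₀) (x := a.1)
    (by simpa using ha)
  rw [modelWithCornersSelf_coe, range_id, mfderivWithin_univ] at h
  rw [← h]
  refine Prod.ext rfl (ContinuousLinearMap.ext fun v => ?_)
  exact congrArg (fun A : ℝ →L[ℝ] ℝ => A (a.2
    ((trivializationAt E (TangentSpace 𝓘(ℝ, E)) q₀).symmL ℝ a.1 v)))
    (Bundle.Trivial.continuousLinearMapAt_trivialization ℝ Q ℝ a.1)

lemma cotChart_zeroCovector {q₀ q : Q} (hq : q ∈ (extChartAt 𝓘(ℝ, E) q₀).source) :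
    cotChart q₀ (zeroCovector 𝓘(ℝ, E) Q q) = (extChartAt 𝓘(ℝ, E) q₀ q, 0) := by
  rw [cotChart_apply (a := zeroCovector 𝓘(ℝ, E) Q q) hq]
  refine Prod.ext rfl (ContinuousLinearMap.ext fun v => rfl)

/-- The chart of the cotangent bundle over the chart of `Q` around `q₀`, with values in `E × E`. -/
def cotCoord (q₀ : Q) (a : CotangentBundle 𝓘(ℝ, E) Q) : E × E :=
  ((cotChart q₀ a).1, sharp E (cotChart q₀ a).2)

/-- The inverse of `cotCoord`. -/
def cotParam (q₀ : Q) (y : E × E) : CotangentBundle 𝓘(ℝ, E) Q :=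
  (cotChart q₀).symm (y.1, (sharp E).symm y.2)

variable {q₀ q : Q} {a : CotangentBundle 𝓘(ℝ, E) Q} {y : E × E}

lemma cotParam_cotCoord (ha : a.1 ∈ (extChartAt 𝓘(ℝ, E) q₀).source) :
    cotParam q₀ (cotCoord q₀ a) = a := by
  simp only [cotParam, cotCoord, ContinuousLinearEquiv.symm_apply_apply, Prod.mk.eta]
  exact (cotChart q₀).left_inv (mem_cotChart_source.2 ha)

lemma mem_target_aux (hy : y.1 ∈ (extChartAt 𝓘(ℝ, E) q₀).target) :
    (y.1, (sharp E).symm y.2) ∈ (cotChart q₀).target := by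
  rw [cotChart_target]; exact ⟨hy, mem_univ _⟩

lemma cotParam_mem (hy : y.1 ∈ (extChartAt 𝓘(ℝ, E) q₀).target) :
    (cotParam q₀ y).1 ∈ (extChartAt 𝓘(ℝ, E) q₀).source :=
  mem_cotChart_source.1 ((cotChart q₀).map_target (mem_target_aux hy))

lemma cotCoord_cotParam (hy : y.1 ∈ (extChartAt 𝓘(ℝ, E) q₀).target) :
    cotCoord q₀ (cotParam q₀ y) = y := by
  simp [cotParam, cotCoord, (cotChart q₀).right_inv (mem_target_aux hy)]

lemma cotCoord_fst (ha : a.1 ∈ (extChartAt 𝓘(ℝ, E) q₀).source) :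
    (cotCoord q₀ a).1 = extChartAt 𝓘(ℝ, E) q₀ a.1 := by
  rw [cotCoord, cotChart_apply ha]

lemma cotCoord_fst_mem (ha : a.1 ∈ (extChartAt 𝓘(ℝ, E) q₀).source) :
    (cotCoord q₀ a).1 ∈ (extChartAt 𝓘(ℝ, E) q₀).target := by
  rw [cotCoord_fst ha]; exact (extChartAt 𝓘(ℝ, E) q₀).map_source ha

lemma cotCoord_zeroCovector (hq : q ∈ (extChartAt 𝓘(ℝ, E) q₀).source) :
    cotCoord q₀ (zeroCovector 𝓘(ℝ, E) Q q) = (extChartAt 𝓘(ℝ, E) q₀ q, 0) := by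
  rw [cotCoord, cotChart_zeroCovector hq]; simp

lemma cotParam_zero {x : E} (hx : x ∈ (extChartAt 𝓘(ℝ, E) q₀).target) :
    cotParam q₀ (x, 0) = zeroCovector 𝓘(ℝ, E) Q ((extChartAt 𝓘(ℝ, E) q₀).symm x) := by
  have h := (extChartAt 𝓘(ℝ, E) q₀).map_target hx
  have h1 := cotCoord_zeroCovector h
  rw [(extChartAt 𝓘(ℝ, E) q₀).right_inv hx] at h1
  rw [← h1, cotParam_cotCoord h]

lemma contMDiffAt_cotCoord (ha : a.1 ∈ (extChartAt 𝓘(ℝ, E) q₀).source) :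
    ContMDiffAt (𝓘(ℝ, E).prod 𝓘(ℝ, E →L[ℝ] ℝ)) 𝓘(ℝ, E × E) ∞ (cotCoord q₀) a := by
  have h : ContMDiffAt (𝓘(ℝ, E).prod 𝓘(ℝ, E →L[ℝ] ℝ)) 𝓘(ℝ, E × (E →L[ℝ] ℝ)) ∞ (cotChart q₀) a :=
    contMDiffAt_extChartAt_of_mem (mem_cotChart_source.2 ha)
  exact ((ContinuousLinearEquiv.refl ℝ E).prodCongr
    (sharp E)).contDiff.contDiffAt.contMDiffAt.comp a h

lemma contMDiffAt_cotParam (hy : y.1 ∈ (extChartAt 𝓘(ℝ, E) q₀).target) :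
    ContMDiffAt 𝓘(ℝ, E × E) (𝓘(ℝ, E).prod 𝓘(ℝ, E →L[ℝ] ℝ)) ∞ (cotParam q₀) y := by
  have h : ContMDiffAt 𝓘(ℝ, E × (E →L[ℝ] ℝ)) (𝓘(ℝ, E).prod 𝓘(ℝ, E →L[ℝ] ℝ)) ∞ (cotChart q₀).symm
      (y.1, (sharp E).symm y.2) :=
    contMDiffAt_extChartAt_symm (mem_target_aux hy)
  exact h.comp y ((ContinuousLinearEquiv.refl ℝ E).prodCongr
    (sharp E).symm).contDiff.contDiffAt.contMDiffAt

end CotangentChart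

lemma contDiff_ofSubsingletonLIE {X W : Type*} [NormedAddCommGroup X] [NormedSpace ℝ X]
    [NormedAddCommGroup W] [NormedSpace ℝ W] {p : X → W →L[ℝ] ℝ} (hp : ContDiff ℝ ∞ p) :
    ContDiff ℝ ∞ (fun x => ContinuousAlternatingMap.ofSubsingletonLIE (0 : Fin 1) (p x)) := by
  let L : (W →L[ℝ] ℝ) →L[ℝ] (W [⋀^Fin 1]→L[ℝ] ℝ) :=
    (ContinuousAlternatingMap.ofSubsingletonLIE (𝕜 := ℝ) (E := W) (F := ℝ)
      (0 : Fin 1)).toContinuousLinearEquiv.toContinuousLinearMap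
  exact L.contDiff.comp hp

section CanonicalForm

variable {E : Type} [NormedAddCommGroup E] [InnerProductSpace ℝ E] [FiniteDimensional ℝ E]

/-- The canonical form in coordinates. -/
def coordCanonicalForm (E : Type) [NormedAddCommGroup E] [InnerProductSpace ℝ E]
    (z : E × (E →L[ℝ] ℝ)) : (E × (E →L[ℝ] ℝ)) [⋀^Fin 1]→L[ℝ] ℝ :=
  ContinuousAlternatingMap.ofSubsingletonLIE (0 : Fin 1)
    (z.2.comp (ContinuousLinearMap.fst ℝ E (E →L[ℝ] ℝ)))

lemma coordCanonicalForm_apply (z : E × (E →L[ℝ] ℝ)) (v : Fin 1 → E × (E →L[ℝ] ℝ)) :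
    coordCanonicalForm E z v = z.2 (v 0).1 := rfl

lemma contDiff_coordCanonicalForm : ContDiff ℝ ∞ (coordCanonicalForm E) := by
  exact contDiff_ofSubsingletonLIE (contDiff_snd.clm_comp contDiff_const)

/-- This is `dp ∧ dq`; after `sharp` it has the same sign as `stdBil`. -/
lemma extDeriv_coordCanonicalForm (z u v : E × (E →L[ℝ] ℝ)) :
    extDeriv (coordCanonicalForm E) z ![u, v] = u.2 v.1 - v.2 u.1 := by
  have h : ∀ w x : E × (E →L[ℝ] ℝ),
      fderiv ℝ (fun z : E × (E →L[ℝ] ℝ) => z.2 w.1) z x = x.2 w.1 := by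
    intro w x
    exact congrArg (fun A : (E × (E →L[ℝ] ℝ)) →L[ℝ] ℝ => A x)
      ((((ContinuousLinearMap.apply ℝ ℝ w.1).comp
        (ContinuousLinearMap.snd ℝ E (E →L[ℝ] ℝ))).hasFDerivAt (x := z)).fderiv)
  rw [extDeriv_apply (contDiff_coordCanonicalForm.differentiable (by simp) z)]
  simp only [coordCanonicalForm_apply]
  simp [Fin.removeNth, h, Fin.succAbove]
  ring

variable {Q : Type*} [TopologicalSpace Q] [ChartedSpace E Q] [IsManifold 𝓘(ℝ, E) ∞ Q]

/-- In charts the bundle projection is `Prod.fst`, and the fibre coordinate is the covector composed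
with the derivative of the inverse chart; the tautological form thus becomes `p dq`. -/
lemma inChart_canonicalForm {q₀ : Q} {z : E × (E →L[ℝ] ℝ)} (hz : z ∈ (cotChart q₀).target) :
    Form.inChart (𝓘(ℝ, E).prod 𝓘(ℝ, E →L[ℝ] ℝ)) (canonicalForm 𝓘(ℝ, E) Q)
      (zeroCovector 𝓘(ℝ, E) Q q₀) z = coordCanonicalForm E z := by
  rw [Form.inChart_eq]
  ext v
  refine Eq.trans ?_ (coordCanonicalForm_apply z v).symm
  set a := (cotChart q₀).symm z with ha
  have haz : cotChart q₀ a = z := (cotChart q₀).right_inv hz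
  have has : a.1 ∈ (extChartAt 𝓘(ℝ, E) q₀).source :=
    mem_cotChart_source.1 ((cotChart q₀).map_target hz)
  have hz1 : z.1 = extChartAt 𝓘(ℝ, E) q₀ a.1 := by rw [← haz, cotChart_apply has]
  have hz2 : z.2 = (a.2 : TangentSpace 𝓘(ℝ, E) a.1 →L[ℝ] ℝ).comp
      (mfderiv 𝓘(ℝ, E) 𝓘(ℝ, E) (extChartAt 𝓘(ℝ, E) q₀).symm (extChartAt 𝓘(ℝ, E) q₀ a.1)) := by
    conv_lhs => rw [← haz, cotChart_apply has]
  have h1 : MDifferentiableAt 𝓘(ℝ, E × (E →L[ℝ] ℝ)) (𝓘(ℝ, E).prod 𝓘(ℝ, E →L[ℝ] ℝ))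
      (cotChart q₀).symm z := (contMDiffAt_extChartAt_symm hz).mdifferentiableAt (by simp)
  have h2 : MDifferentiableAt (𝓘(ℝ, E).prod 𝓘(ℝ, E →L[ℝ] ℝ)) 𝓘(ℝ, E)
      (fun b : CotangentBundle 𝓘(ℝ, E) Q => b.1) ((cotChart q₀).symm z) :=
    (contMDiff_proj (IB := 𝓘(ℝ, E)) (n := ∞)
      (fun q : Q => TangentSpace 𝓘(ℝ, E) q →L[ℝ] ℝ)).mdifferentiableAt (by simp)
  have h3 : MDifferentiableAt 𝓘(ℝ, E) 𝓘(ℝ, E) (extChartAt 𝓘(ℝ, E) q₀).symm z.1 := by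
    rw [hz1]
    exact (contMDiffAt_extChartAt_symm
      ((extChartAt 𝓘(ℝ, E) q₀).map_source has)).mdifferentiableAt (by simp)
  have h4 : MDifferentiableAt 𝓘(ℝ, E × (E →L[ℝ] ℝ)) 𝓘(ℝ, E)
      (Prod.fst : E × (E →L[ℝ] ℝ) → E) z := differentiableAt_fst.mdifferentiableAt
  have h5 : (mfderiv (𝓘(ℝ, E).prod 𝓘(ℝ, E →L[ℝ] ℝ)) 𝓘(ℝ, E)
      (fun b : CotangentBundle 𝓘(ℝ, E) Q => b.1) ((cotChart q₀).symm z)).comp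
      (mfderiv 𝓘(ℝ, E × (E →L[ℝ] ℝ)) (𝓘(ℝ, E).prod 𝓘(ℝ, E →L[ℝ] ℝ)) (cotChart q₀).symm z) =
      (mfderiv 𝓘(ℝ, E) 𝓘(ℝ, E) (extChartAt 𝓘(ℝ, E) q₀).symm z.1).comp
        (ContinuousLinearMap.fst ℝ E (E →L[ℝ] ℝ)) := by
    have e1 := mfderiv_comp z h2 h1
    have e2 := mfderiv_comp z h3 h4
    have e3 : mfderiv 𝓘(ℝ, E × (E →L[ℝ] ℝ)) 𝓘(ℝ, E) (Prod.fst : E × (E →L[ℝ] ℝ) → E) z =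
      ContinuousLinearMap.fst ℝ E (E →L[ℝ] ℝ) := by
      rw [mfderiv_eq_fderiv]; exact fderiv_fst
    rw [e3] at e2
    refine e1.symm.trans (Eq.trans (Filter.EventuallyEq.mfderiv_eq ?_) e2)
    exact Filter.Eventually.of_forall fun w => rfl
  rw [hz2, ← hz1]
  exact congrArg (a.2 : TangentSpace 𝓘(ℝ, E) a.1 →L[ℝ] ℝ)
    (congrArg (fun A : (E × (E →L[ℝ] ℝ)) →L[ℝ] E => A (v 0)) h5)

/-- The exterior derivative may be taken in the chart over `q₀` even when `a` does not lie over its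
centre; symplecticity on `T*Q` is thereby reduced to coordinates. -/
lemma d_canonicalForm {q₀ : Q} {a : CotangentBundle 𝓘(ℝ, E) Q}
    (ha : a.1 ∈ (extChartAt 𝓘(ℝ, E) q₀).source)
    (ξ η : TangentSpace (𝓘(ℝ, E).prod 𝓘(ℝ, E →L[ℝ] ℝ)) a) :
    Form.d (𝓘(ℝ, E).prod 𝓘(ℝ, E →L[ℝ] ℝ)) (canonicalForm 𝓘(ℝ, E) Q) a ![ξ, η] =
      stdBil E (mfderiv (𝓘(ℝ, E).prod 𝓘(ℝ, E →L[ℝ] ℝ)) 𝓘(ℝ, E × E) (cotCoord q₀) a ξ)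
        (mfderiv (𝓘(ℝ, E).prod 𝓘(ℝ, E →L[ℝ] ℝ)) 𝓘(ℝ, E × E) (cotCoord q₀) a η) := by
  have hev : ∀ q : Q, ∀ z ∈ (cotChart q).target,
      Form.inChart (𝓘(ℝ, E).prod 𝓘(ℝ, E →L[ℝ] ℝ)) (canonicalForm 𝓘(ℝ, E) Q)
        (zeroCovector 𝓘(ℝ, E) Q q) =ᶠ[𝓝 z] coordCanonicalForm E := by
    intro q z hz
    filter_upwards [(isOpen_extChartAt_target _).mem_nhds hz] with w hw
    exact inChart_canonicalForm hw
  have ha' : a ∈ (cotChart q₀).source := mem_cotChart_source.2 ha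
  have hd : DifferentiableAt ℝ (Form.inChart (𝓘(ℝ, E).prod 𝓘(ℝ, E →L[ℝ] ℝ))
      (canonicalForm 𝓘(ℝ, E) Q) a)
      (extChartAt (𝓘(ℝ, E).prod 𝓘(ℝ, E →L[ℝ] ℝ)) a a) := by
    have e : Form.inChart (𝓘(ℝ, E).prod 𝓘(ℝ, E →L[ℝ] ℝ)) (canonicalForm 𝓘(ℝ, E) Q) a =
      Form.inChart (𝓘(ℝ, E).prod 𝓘(ℝ, E →L[ℝ] ℝ)) (canonicalForm 𝓘(ℝ, E) Q)
        (zeroCovector 𝓘(ℝ, E) Q a.1) := by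
      funext y
      unfold Form.inChart
      rw [extChartAt_cotangentBundle, extChartAt_cotangentBundle]
      rfl
    rw [e, extChartAt_cotangentBundle]
    refine DifferentiableAt.congr_of_eventuallyEq
      (contDiff_coordCanonicalForm.differentiable (by simp) _) (hev a.1 _ ?_)
    exact (cotChart a.1).map_source (mem_cotChart_source.2 (mem_extChartAt_source _))
  rw [Form.d_eq (x₀ := zeroCovector 𝓘(ℝ, E) Q q₀) _ ha' hd]
  have h1 := (hev q₀ _ ((cotChart q₀).map_source ha')).extDeriv_eq
  have h2 : MDifferentiableAt (𝓘(ℝ, E).prod 𝓘(ℝ, E →L[ℝ] ℝ)) 𝓘(ℝ, E × (E →L[ℝ] ℝ))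
      (cotChart q₀) a := (contMDiffAt_extChartAt_of_mem ha').mdifferentiableAt (by simp)
  set A : (E × (E →L[ℝ] ℝ)) ≃L[ℝ] (E × E) := (ContinuousLinearEquiv.refl ℝ E).prodCongr (sharp E)
    with hA
  have h3 : mfderiv (𝓘(ℝ, E).prod 𝓘(ℝ, E →L[ℝ] ℝ)) 𝓘(ℝ, E × E) (cotCoord q₀) a =
      (A : (E × (E →L[ℝ] ℝ)) →L[ℝ] (E × E)).comp
        (mfderiv (𝓘(ℝ, E).prod 𝓘(ℝ, E →L[ℝ] ℝ)) 𝓘(ℝ, E × (E →L[ℝ] ℝ)) (cotChart q₀) a) := by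
    have e1 := mfderiv_comp (I'' := 𝓘(ℝ, E × E)) (g := A) a
      (A.differentiableAt.mdifferentiableAt) h2
    have e2 : mfderiv 𝓘(ℝ, E × (E →L[ℝ] ℝ)) 𝓘(ℝ, E × E) A (cotChart q₀ a) =
      (A : (E × (E →L[ℝ] ℝ)) →L[ℝ] (E × E)) := by
      rw [mfderiv_eq_fderiv]; exact A.fderiv
    rw [e2] at e1
    exact e1
  rw [h3]
  refine Eq.trans (b := extDeriv (coordCanonicalForm E) (cotChart q₀ a)
    ![mfderiv (𝓘(ℝ, E).prod 𝓘(ℝ, E →L[ℝ] ℝ)) 𝓘(ℝ, E × (E →L[ℝ] ℝ)) (cotChart q₀) a ξ,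
      mfderiv (𝓘(ℝ, E).prod 𝓘(ℝ, E →L[ℝ] ℝ)) 𝓘(ℝ, E × (E →L[ℝ] ℝ)) (cotChart q₀) a η]) ?_ ?_
  · rw [← h1]
    refine congrArg (extDeriv _ _) ?_
    funext i
    fin_cases i <;> rfl
  · refine (extDeriv_coordCanonicalForm _ _ _).trans (Eq.trans ?_ (stdBil_apply _ _).symm)
    exact congrArg₂ (· - ·) (inner_sharp _ _).symm (inner_sharp _ _).symm

end CanonicalForm

/-! ### Symplectic forms as bilinear maps in charts -/

section BilinearForm

variable {F : Type} [NormedAddCommGroup F] [InnerProductSpace ℝ F] [FiniteDimensional ℝ F]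

/-- An alternating 2-form as a bilinear map. -/
def altBil (A : F [⋀^Fin 2]→L[ℝ] ℝ) : F →L[ℝ] F →L[ℝ] ℝ :=
  ((ContinuousAlternatingMap.ofSubsingletonLIE (𝕜 := ℝ) (E := F) (F := ℝ)
      (0 : Fin 1)).symm.toContinuousLinearEquiv.toContinuousLinearMap).comp
    (ContinuousAlternatingMap.curryLeft A)

lemma altBil_apply (A : F [⋀^Fin 2]→L[ℝ] ℝ) (u v : F) : altBil A u v = A ![u, v] := by
  change A (Matrix.vecCons u fun _ => v) = A ![u, v]
  congr 1
  funext i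
  fin_cases i <;> rfl

lemma altBil_skew (A : F [⋀^Fin 2]→L[ℝ] ℝ) (u v : F) : altBil A u v = -altBil A v u := by
  rw [altBil_apply, altBil_apply]
  refine Eq.trans ?_ (A.toAlternatingMap.map_swap ![v, u] (i := 0) (j := 1) (by simp))
  change A _ = A _
  congr 1
  funext i
  fin_cases i <;> rfl

lemma contDiffAt_altBil {X : Type*} [NormedAddCommGroup X] [NormedSpace ℝ X]
    {A : X → F [⋀^Fin 2]→L[ℝ] ℝ} {x : X} (hA : ContDiffAt ℝ ∞ A x) :
    ContDiffAt ℝ ∞ (fun x => altBil (A x)) x := by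
  refine contDiffAt_of_clm_apply fun u => contDiffAt_of_clm_apply fun v => ?_
  simp only [altBil_apply]
  let L : (F [⋀^Fin 2]→L[ℝ] ℝ) →ₗ[ℝ] ℝ :=
    { toFun := fun A => A ![u, v]
      map_add' := fun _ _ => rfl
      map_smul' := fun _ _ => rfl }
  let L' : (F [⋀^Fin 2]→L[ℝ] ℝ) →L[ℝ] ℝ :=
    L.mkContinuous (∏ i, ‖![u, v] i‖) fun A => by
      rw [mul_comm]; exact A.le_opNorm _
  exact L'.contDiff.contDiffAt.comp x hA

lemma fderiv_altBil {X : Type*} [NormedAddCommGroup X] [NormedSpace ℝ X]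
    {A : X → F [⋀^Fin 2]→L[ℝ] ℝ} {x : X} (hA : ContDiffAt ℝ ∞ A x) (u : X) (v w : F) :
    fderiv ℝ (fun x => altBil (A x)) x u v w = fderiv ℝ (fun x => A x ![v, w]) x u := by
  have h := (contDiffAt_altBil hA).differentiableAt (by simp)
  have h1 := ((h.hasFDerivAt.clm_apply (hasFDerivAt_const v x)).clm_apply
    (hasFDerivAt_const w x)).fderiv
  simp only [altBil_apply] at h1
  rw [h1]
  simp

/-- The three terms of the exterior derivative carry the signs `+`, `-`, `+`; skewness turns the
middle one into the missing cyclic term. -/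
lemma isClosedAt_altBil {A : F → F [⋀^Fin 2]→L[ℝ] ℝ} {x : F} (hA : ContDiffAt ℝ ∞ A x)
    (h : extDeriv A x = 0) : IsClosedAt (fun x => altBil (A x)) x := by
  intro u v w
  have h1 := extDeriv_apply (hA.differentiableAt (by simp)) ![u, v, w]
  rw [h, Fin.sum_univ_three] at h1
  have e0 : Fin.removeNth (0 : Fin 3) ![u, v, w] = ![v, w] := by
    funext i; fin_cases i <;> rfl
  have e1 : Fin.removeNth (1 : Fin 3) ![u, v, w] = ![u, w] := by
    funext i; fin_cases i <;> rfl
  have e2 : Fin.removeNth (2 : Fin 3) ![u, v, w] = ![u, v] := by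
    funext i; fin_cases i <;> rfl
  rw [e0, e1, e2] at h1
  rw [← fderiv_altBil hA, ← fderiv_altBil hA, ← fderiv_altBil hA] at h1
  have h2 : fderiv ℝ (fun x => altBil (A x)) x v w u =
      -fderiv ℝ (fun x => altBil (A x)) x v u w :=
    fderiv_skew ((contDiffAt_altBil hA).differentiableAt (by simp))
      (Filter.Eventually.of_forall fun x => altBil_skew (A x)) v w u
  rw [h2]
  simp at h1
  linarith

end BilinearForm

section SymplecticChart

variable {F : Type} [NormedAddCommGroup F] [InnerProductSpace ℝ F] [FiniteDimensional ℝ F]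
  {M : Type*} [TopologicalSpace M] [ChartedSpace F M] [IsManifold 𝓘(ℝ, F) ∞ M]

/-- A 2-form in a chart, as a bilinear map. -/
def Form.bil (Ω : Form 𝓘(ℝ, F) M 2) (m₀ : M) (y : F) : F →L[ℝ] F →L[ℝ] ℝ :=
  altBil (Form.inChart 𝓘(ℝ, F) Ω m₀ y)

variable {Ω : Form 𝓘(ℝ, F) M 2} {m₀ : M} {y : F}

lemma Form.bil_skew (u v : F) : Form.bil Ω m₀ y u v = -Form.bil Ω m₀ y v u := altBil_skew _ u v

lemma IsSymplectic.contDiffAt_inChart (hΩ : IsSymplectic 𝓘(ℝ, F) Ω)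
    (hy : y ∈ (extChartAt 𝓘(ℝ, F) m₀).target) :
    ContDiffAt ℝ ∞ (Form.inChart 𝓘(ℝ, F) Ω m₀) y :=
  (hΩ.smooth m₀).contDiffAt ((isOpen_extChartAt_target m₀).mem_nhds hy)

lemma IsSymplectic.contDiffAt_bil (hΩ : IsSymplectic 𝓘(ℝ, F) Ω)
    (hy : y ∈ (extChartAt 𝓘(ℝ, F) m₀).target) : ContDiffAt ℝ ∞ (Form.bil Ω m₀) y :=
  contDiffAt_altBil (hΩ.contDiffAt_inChart hy)

/-- The derivative of the chart is invertible, so vanishing of the exterior derivative on the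
manifold passes to the coordinate expression. -/
lemma IsSymplectic.isClosedAt_bil (hΩ : IsSymplectic 𝓘(ℝ, F) Ω)
    (hy : y ∈ (extChartAt 𝓘(ℝ, F) m₀).target) : IsClosedAt (Form.bil Ω m₀) y := by
  refine isClosedAt_altBil (hΩ.contDiffAt_inChart hy) ?_
  have hx := (extChartAt 𝓘(ℝ, F) m₀).map_target hy
  have h := Form.d_eq Ω hx ((hΩ.contDiffAt_inChart
    (mem_extChartAt_target _)).differentiableAt (by simp))
  have := IsManifold.of_le (I := 𝓘(ℝ, F)) (M := M) (m := 1) (n := ∞) (by simp)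
  obtain ⟨T, hT⟩ := isInvertible_mfderiv_extChartAt (I := 𝓘(ℝ, F)) hx
  rw [hΩ.closed, (extChartAt 𝓘(ℝ, F) m₀).right_inv hy, ← hT] at h
  ext v
  have h1 := congrArg (fun A => A (fun i => T.symm (v i))) h
  refine Eq.trans ?_ h1.symm
  refine congrArg (extDeriv (Form.inChart 𝓘(ℝ, F) Ω m₀) y) ?_
  funext i
  exact (T.apply_symm_apply (v i)).symm

lemma IsSymplectic.bil_nondegenerate (hΩ : IsSymplectic 𝓘(ℝ, F) Ω)
    (hy : y ∈ (extChartAt 𝓘(ℝ, F) m₀).target) (u : F) (hu : Form.bil Ω m₀ y u = 0) : u = 0 := by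
  have hx := (extChartAt 𝓘(ℝ, F) m₀).map_target hy
  have := IsManifold.of_le (I := 𝓘(ℝ, F)) (M := M) (m := 1) (n := ∞) (by simp)
  obtain ⟨T, hT⟩ := isInvertible_mfderivWithin_extChartAt_symm (I := 𝓘(ℝ, F)) hy
  rw [modelWithCornersSelf_coe, range_id, mfderivWithin_univ] at hT
  have h1 : T u = 0 := by
    refine hΩ.nondegenerate _ _ fun w => ?_
    have h2 := congrArg (fun A : F →L[ℝ] ℝ => A (T.symm w)) hu
    simp only [Form.bil, Form.inChart_eq, ← hT] at h2
    refine Eq.trans ?_ h2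
    refine congrArg (Ω ((extChartAt 𝓘(ℝ, F) m₀).symm y)) ?_
    funext i
    fin_cases i
    · rfl
    · exact (T.apply_symm_apply w).symm
  exact (map_eq_zero_iff T T.injective).1 h1

variable {E' H' : Type*} [NormedAddCommGroup E'] [NormedSpace ℝ E'] [TopologicalSpace H']
  {I' : ModelWithCorners ℝ E' H'} {N : Type*} [TopologicalSpace N] [ChartedSpace H' N]

/-- The pullback of a 2-form under a map, computed in a chart. -/
lemma Form.pullback_eq_bil {f : N → M} {a : N} (hf : ContMDiffAt I' 𝓘(ℝ, F) ∞ f a)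
    (hx : f a ∈ (extChartAt 𝓘(ℝ, F) m₀).source) (u v : TangentSpace I' a) :
    Ω (f a) ![mfderiv I' 𝓘(ℝ, F) f a u, mfderiv I' 𝓘(ℝ, F) f a v] =
      Form.bil Ω m₀ (extChartAt 𝓘(ℝ, F) m₀ (f a))
        (mfderiv I' 𝓘(ℝ, F) (extChartAt 𝓘(ℝ, F) m₀ ∘ f) a u)
        (mfderiv I' 𝓘(ℝ, F) (extChartAt 𝓘(ℝ, F) m₀ ∘ f) a v) := by
  have h := congrArg (fun A => A ![u, v]) (Form.pullback_eq_inChart Ω hf hx)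
  refine Eq.trans ?_ (h.trans (Eq.trans ?_ (altBil_apply _ _ _).symm))
  · refine congrArg (Ω (f a)) ?_
    funext i
    fin_cases i <;> rfl
  · refine congrArg (Form.inChart 𝓘(ℝ, F) Ω m₀ _) ?_
    funext i
    fin_cases i <;> rfl

end SymplecticChart

/-! ### Local inverses between manifolds -/

section LocalInverse

variable {E' H' : Type*} [NormedAddCommGroup E'] [NormedSpace ℝ E'] [CompleteSpace E']
  [TopologicalSpace H'] {I' : ModelWithCorners ℝ E' H'} [I'.Boundaryless]
  {N : Type*} [TopologicalSpace N] [ChartedSpace H' N] [IsManifold I' ∞ N]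
  {E H : Type*} [NormedAddCommGroup E] [NormedSpace ℝ E] [CompleteSpace E]
  [TopologicalSpace H] {I : ModelWithCorners ℝ E H} [I.Boundaryless]
  {M : Type*} [TopologicalSpace M] [ChartedSpace H M] [IsManifold I ∞ M]

variable (I' I) in
/-- The map `f` has a smooth local inverse at `a`. -/
def HasLocalInverseAt (f : N → M) (a : N) : Prop :=
  ∃ g : M → N, g (f a) = a ∧ (∀ᶠ y in 𝓝 (f a), f (g y) = y ∧ ContMDiffAt I I' ∞ g y) ∧
    ∀ᶠ x in 𝓝 a, g (f x) = x

lemma hasLocalInverseAt_of_isInvertible {f : N → M} {a : N}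
    (hf : ∀ᶠ x in 𝓝 a, ContMDiffAt I' I ∞ f x) (hf' : (mfderiv I' I f a).IsInvertible) :
    HasLocalInverseAt I' I f a := by
  have i1 : IsManifold I 1 M := IsManifold.of_le (n := ∞) (by simp)
  have i2 : IsManifold I' 1 N := IsManifold.of_le (n := ∞) (by simp)
  set φ := extChartAt I' a with hφ
  set ψ := extChartAt I (f a) with hψ
  have ha : a ∈ φ.source := mem_extChartAt_source a
  have hfa : f a ∈ ψ.source := mem_extChartAt_source (f a)
  have hat : φ a ∈ φ.target := φ.map_source ha
  have hφs : φ.symm (φ a) = a := φ.left_inv ha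
  have hc : Tendsto φ.symm (𝓝 (φ a)) (𝓝 a) := by
    have h := (contMDiffAt_extChartAt_symm hat).continuousAt.tendsto
    rwa [hφs] at h
  have hfc : Tendsto f (𝓝 a) (𝓝 (f a)) := hf.self_of_nhds.continuousAt
  have hψc : Tendsto ψ (𝓝 (f a)) (𝓝 (ψ (f a))) :=
    (contMDiffAt_extChartAt_of_mem hfa).continuousAt
  have hφc : Tendsto φ (𝓝 a) (𝓝 (φ a)) := (contMDiffAt_extChartAt_of_mem ha).continuousAt
  have hψsource : ∀ᶠ y in 𝓝 (f a), y ∈ ψ.source := extChartAt_source_mem_nhds (f a)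
  have hφsource : ∀ᶠ y in 𝓝 a, y ∈ φ.source := extChartAt_source_mem_nhds a
  have hφtarget : ∀ᶠ y in 𝓝 (φ a), y ∈ φ.target := (isOpen_extChartAt_target a).mem_nhds hat
  set h : E' → E := ψ ∘ (f ∘ φ.symm) with hh
  have hha : h (φ a) = ψ (f a) := by simp only [hh, Function.comp_apply, hφs]
  have hsm : ∀ᶠ x in 𝓝 (φ a), ContDiffAt ℝ ∞ h x := by
    filter_upwards [hφtarget, hc.eventually hf, hc.eventually (hfc.eventually hψsource)]
      with x h1 h2 h3
    rw [← contMDiffAt_iff_contDiffAt]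
    exact (contMDiffAt_extChartAt_of_mem h3).comp x (h2.comp x (contMDiffAt_extChartAt_symm h1))
  have hd : (fderiv ℝ h (φ a)).IsInvertible := by
    have e1 : MDifferentiableAt 𝓘(ℝ, E') I' φ.symm (φ a) :=
      (contMDiffAt_extChartAt_symm hat).mdifferentiableAt (by simp)
    have e2 : MDifferentiableAt I' I f (φ.symm (φ a)) := by
      rw [hφs]; exact hf.self_of_nhds.mdifferentiableAt (by simp)
    have e3 : MDifferentiableAt I 𝓘(ℝ, E) ψ ((f ∘ φ.symm) (φ a)) := by
      rw [Function.comp_apply, hφs]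
      exact (contMDiffAt_extChartAt_of_mem hfa).mdifferentiableAt (by simp)
    rw [← mfderiv_eq_fderiv, hh, mfderiv_comp _ e3 (e2.comp _ e1), mfderiv_comp _ e2 e1]
    refine ContinuousLinearMap.IsInvertible.comp ?_ (ContinuousLinearMap.IsInvertible.comp ?_ ?_)
    · refine isInvertible_mfderiv_extChartAt ?_
      rwa [Function.comp_apply, hφs]
    · rwa [hφs]
    · have := isInvertible_mfderivWithin_extChartAt_symm (I := I') hat
      rwa [I'.range_eq_univ, mfderivWithin_univ] at this
  obtain ⟨h', hh'⟩ := hd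
  obtain ⟨g, hg1, hg2, hg3⟩ := exists_local_inverse h' hsm hh'.symm
  rw [hha] at hg1 hg2
  have hgc : Tendsto g (𝓝 (ψ (f a))) (𝓝 (φ a)) := by
    have := hg2.self_of_nhds.2.continuousAt.tendsto
    rwa [hg1] at this
  refine ⟨φ.symm ∘ g ∘ ψ, ?_, ?_, ?_⟩
  · simp only [Function.comp_apply, hg1, hφs]
  · filter_upwards [hψsource, hψc.eventually hg2, hψc.eventually (hgc.eventually hφtarget),
      hψc.eventually (hgc.eventually (hc.eventually (hfc.eventually hψsource)))] with y h1 h2 h3 h4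
    refine ⟨ψ.injOn h4 h1 h2.1, ?_⟩
    exact (contMDiffAt_extChartAt_symm h3).comp y
      (h2.2.contMDiffAt.comp y (contMDiffAt_extChartAt_of_mem h1))
  · filter_upwards [hφsource, hφc.eventually hg3] with x h1 h2
    simp only [hh, Function.comp_apply, φ.left_inv h1] at h2 ⊢
    rw [h2, φ.left_inv h1]

lemma HasLocalInverseAt.exists_injOn {f : N → M} {a : N} (h : HasLocalInverseAt I' I f a) :
    ∃ u ∈ 𝓝 a, InjOn f u := by
  obtain ⟨g, -, -, h⟩ := h
  refine ⟨_, h, fun x hx y hy hxy => ?_⟩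
  rw [← show g (f x) = x from hx, ← show g (f y) = y from hy, hxy]

/-- An injective local diffeomorphism is a diffeomorphism onto its open image. -/
lemma exists_openPartialHomeomorph [Nonempty N] {f : N → M} {W : Set N} (hW : IsOpen W)
    (hf : ∀ x ∈ W, ContMDiffAt I' I ∞ f x) (hloc : ∀ x ∈ W, HasLocalInverseAt I' I f x)
    (hinj : InjOn f W) :
    ∃ Φ : OpenPartialHomeomorph N M, Φ.source = W ∧ ⇑Φ = f ∧ Φ.target = f '' W ∧
      ∀ y ∈ Φ.target, ContMDiffAt I I' ∞ Φ.symm y := by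
  have key : ∀ x ∈ W, ∃ g : M → N, (∀ᶠ y in 𝓝 (f x), f (g y) = y ∧ g y ∈ W) ∧
      ContMDiffAt I I' ∞ g (f x) := by
    intro x hx
    obtain ⟨g, h1, h2, -⟩ := hloc x hx
    refine ⟨g, ?_, h2.self_of_nhds.2⟩
    have h3 : Tendsto g (𝓝 (f x)) (𝓝 x) := by
      have := h2.self_of_nhds.2.continuousAt.tendsto
      rwa [h1] at this
    filter_upwards [h2, h3.eventually (hW.mem_nhds hx)] with y h4 h5
    exact ⟨h4.1, h5⟩
  set e := hinj.toPartialEquiv f W with he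
  have hsm : ∀ y ∈ f '' W, ContMDiffAt I I' ∞ e.symm y := by
    rintro _ ⟨x, hx, rfl⟩
    obtain ⟨g, h1, h2⟩ := key x hx
    refine h2.congr_of_eventuallyEq ?_
    filter_upwards [h1] with y hy
    have h4 : e.symm (e (g y)) = g y := e.left_inv hy.2
    rw [← h4]
    exact congrArg e.symm hy.1.symm
  refine ⟨{ toPartialEquiv := e
            open_source := hW
            open_target := ?_
            continuousOn_toFun := fun x hx => (hf x hx).continuousAt.continuousWithinAt
            continuousOn_invFun := fun y hy => (hsm y hy).continuousAt.continuousWithinAt },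
    rfl, rfl, rfl, hsm⟩
  refine isOpen_iff_mem_nhds.2 ?_
  rintro _ ⟨x, hx, rfl⟩
  obtain ⟨g, h1, h2⟩ := key x hx
  filter_upwards [h1] with y hy
  exact ⟨g y, hy.2, hy.1⟩

lemma isInvertible_of_injective {V W : Type*} [NormedAddCommGroup V] [NormedSpace ℝ V]
    [FiniteDimensional ℝ V] [NormedAddCommGroup W] [NormedSpace ℝ W] [FiniteDimensional ℝ W]
    (h : Module.finrank ℝ V = Module.finrank ℝ W) {A : V →L[ℝ] W} (hA : Function.Injective A) :
    A.IsInvertible :=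
  ⟨(LinearMap.linearEquivOfInjective (A : V →ₗ[ℝ] W) hA h).toContinuousLinearEquiv, by ext; rfl⟩

end LocalInverse

/-! ### Symplectic maps on the cotangent bundle and germs along the zero section -/

section WeinsteinAt

variable {E : Type} [NormedAddCommGroup E] [InnerProductSpace ℝ E] [FiniteDimensional ℝ E]
  {Q : Type*} [TopologicalSpace Q] [ChartedSpace E Q] [IsManifold 𝓘(ℝ, E) ∞ Q]
  {F : Type} [NormedAddCommGroup F] [InnerProductSpace ℝ F] [FiniteDimensional ℝ F]
  {M : Type*} [TopologicalSpace M] [ChartedSpace F M] [IsManifold 𝓘(ℝ, F) ∞ M]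

/-- The map `Ψ` from the cotangent bundle is smooth at `a`, and preserves the symplectic forms
there. -/
def IsWeinsteinAt (Ω : Form 𝓘(ℝ, F) M 2) (Ψ : CotangentBundle 𝓘(ℝ, E) Q → M)
    (a : CotangentBundle 𝓘(ℝ, E) Q) : Prop :=
  ContMDiffAt (𝓘(ℝ, E).prod 𝓘(ℝ, E →L[ℝ] ℝ)) 𝓘(ℝ, F) ∞ Ψ a ∧
    ∀ ξ η : TangentSpace (𝓘(ℝ, E).prod 𝓘(ℝ, E →L[ℝ] ℝ)) a,
      Ω (Ψ a) ![mfderiv (𝓘(ℝ, E).prod 𝓘(ℝ, E →L[ℝ] ℝ)) 𝓘(ℝ, F) Ψ a ξ,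
        mfderiv (𝓘(ℝ, E).prod 𝓘(ℝ, E →L[ℝ] ℝ)) 𝓘(ℝ, F) Ψ a η] =
      Form.d (𝓘(ℝ, E).prod 𝓘(ℝ, E →L[ℝ] ℝ)) (canonicalForm 𝓘(ℝ, E) Q) a ![ξ, η]

variable {Ω : Form 𝓘(ℝ, F) M 2} {Ψ Ψ' : CotangentBundle 𝓘(ℝ, E) Q → M}
  {a : CotangentBundle 𝓘(ℝ, E) Q} {q₀ q : Q} {m₀ : M} {y : E × E}

lemma IsWeinsteinAt.congr (h : IsWeinsteinAt Ω Ψ a) (h' : Ψ' =ᶠ[𝓝 a] Ψ) :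
    IsWeinsteinAt Ω Ψ' a := by
  refine ⟨h.1.congr_of_eventuallyEq h', fun ξ η => ?_⟩
  rw [← h.2 ξ η, h'.mfderiv_eq]
  have := h'.self_of_nhds
  rw [this]

lemma mfderiv_cotCoord_cotParam (hy : y.1 ∈ (extChartAt 𝓘(ℝ, E) q₀).target) (u : E × E) :
    mfderiv (𝓘(ℝ, E).prod 𝓘(ℝ, E →L[ℝ] ℝ)) 𝓘(ℝ, E × E) (cotCoord q₀) (cotParam q₀ y)
      (mfderiv 𝓘(ℝ, E × E) (𝓘(ℝ, E).prod 𝓘(ℝ, E →L[ℝ] ℝ)) (cotParam q₀) y u) = u := by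
  have h1 : MDifferentiableAt 𝓘(ℝ, E × E) (𝓘(ℝ, E).prod 𝓘(ℝ, E →L[ℝ] ℝ)) (cotParam q₀) y :=
    (contMDiffAt_cotParam hy).mdifferentiableAt (by simp)
  have h2 : MDifferentiableAt (𝓘(ℝ, E).prod 𝓘(ℝ, E →L[ℝ] ℝ)) 𝓘(ℝ, E × E) (cotCoord q₀)
      (cotParam q₀ y) := (contMDiffAt_cotCoord (cotParam_mem hy)).mdifferentiableAt (by simp)
  have h3 := mfderiv_comp y h2 h1
  have h4 : cotCoord q₀ ∘ cotParam q₀ =ᶠ[𝓝 y] id := by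
    filter_upwards [(continuous_fst.tendsto y).eventually
      ((isOpen_extChartAt_target q₀).mem_nhds hy)] with z hz
    exact cotCoord_cotParam hz
  rw [h4.mfderiv_eq, mfderiv_id] at h3
  exact congrArg (fun A : E × E →L[ℝ] E × E => A u) h3.symm

lemma eventually_mem_source (ha : a.1 ∈ (extChartAt 𝓘(ℝ, E) q₀).source) :
    ∀ᶠ b : CotangentBundle 𝓘(ℝ, E) Q in 𝓝 a, b.1 ∈ (extChartAt 𝓘(ℝ, E) q₀).source :=
  ((contMDiff_proj (IB := 𝓘(ℝ, E)) (n := ∞)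
    (fun q : Q => TangentSpace 𝓘(ℝ, E) q →L[ℝ] ℝ)).continuous.tendsto a).eventually
    ((isOpen_extChartAt_source q₀).mem_nhds ha)

lemma mfderiv_cotParam_cotCoord (ha : a.1 ∈ (extChartAt 𝓘(ℝ, E) q₀).source)
    (ξ : TangentSpace (𝓘(ℝ, E).prod 𝓘(ℝ, E →L[ℝ] ℝ)) a) :
    mfderiv 𝓘(ℝ, E × E) (𝓘(ℝ, E).prod 𝓘(ℝ, E →L[ℝ] ℝ)) (cotParam q₀) (cotCoord q₀ a)
      (mfderiv (𝓘(ℝ, E).prod 𝓘(ℝ, E →L[ℝ] ℝ)) 𝓘(ℝ, E × E) (cotCoord q₀) a ξ) = ξ := by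
  have h1 : MDifferentiableAt 𝓘(ℝ, E × E) (𝓘(ℝ, E).prod 𝓘(ℝ, E →L[ℝ] ℝ)) (cotParam q₀)
      (cotCoord q₀ a) := (contMDiffAt_cotParam (cotCoord_fst_mem ha)).mdifferentiableAt (by simp)
  have h2 : MDifferentiableAt (𝓘(ℝ, E).prod 𝓘(ℝ, E →L[ℝ] ℝ)) 𝓘(ℝ, E × E) (cotCoord q₀) a :=
    (contMDiffAt_cotCoord ha).mdifferentiableAt (by simp)
  have h3 := mfderiv_comp a h1 h2
  have h4 : cotParam q₀ ∘ cotCoord q₀ =ᶠ[𝓝 a] id := by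
    filter_upwards [eventually_mem_source ha] with z hz
    exact cotParam_cotCoord hz
  rw [h4.mfderiv_eq, mfderiv_id] at h3
  exact congrArg (fun A : E × (E →L[ℝ] ℝ) →L[ℝ] E × (E →L[ℝ] ℝ) => A ξ) h3.symm

/-- A symplectic map from the cotangent bundle, read in charts. -/
lemma IsWeinsteinAt.isSymplAt (hy : y.1 ∈ (extChartAt 𝓘(ℝ, E) q₀).target)
    (h : IsWeinsteinAt Ω Ψ (cotParam q₀ y))
    (hm : Ψ (cotParam q₀ y) ∈ (extChartAt 𝓘(ℝ, F) m₀).source) :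
    IsSymplAt (Form.bil Ω m₀) (fun z => extChartAt 𝓘(ℝ, F) m₀ (Ψ (cotParam q₀ z))) y := by
  have h0 : ContMDiffAt (𝓘(ℝ, E).prod 𝓘(ℝ, E →L[ℝ] ℝ)) 𝓘(ℝ, F) ∞ (extChartAt 𝓘(ℝ, F) m₀ ∘ Ψ)
    (cotParam q₀ y) := (contMDiffAt_extChartAt_of_mem hm).comp _ h.1
  have h1 : ContMDiffAt 𝓘(ℝ, E × E) 𝓘(ℝ, F) ∞
      ((extChartAt 𝓘(ℝ, F) m₀ ∘ Ψ) ∘ cotParam q₀) y := h0.comp y (contMDiffAt_cotParam hy)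
  refine ⟨contMDiffAt_iff_contDiffAt.1 h1, fun u v => ?_⟩
  have h2 := mfderiv_comp y (h0.mdifferentiableAt (by simp))
    ((contMDiffAt_cotParam hy).mdifferentiableAt (by simp))
  rw [mfderiv_eq_fderiv] at h2
  have h3 : ∀ w : E × E, fderiv ℝ (fun z => extChartAt 𝓘(ℝ, F) m₀ (Ψ (cotParam q₀ z))) y w =
    mfderiv (𝓘(ℝ, E).prod 𝓘(ℝ, E →L[ℝ] ℝ)) 𝓘(ℝ, F) (extChartAt 𝓘(ℝ, F) m₀ ∘ Ψ) (cotParam q₀ y)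
      (mfderiv 𝓘(ℝ, E × E) (𝓘(ℝ, E).prod 𝓘(ℝ, E →L[ℝ] ℝ)) (cotParam q₀) y w) :=
    fun w => congrArg (fun A : E × E →L[ℝ] F => A w) h2
  rw [h3, h3]
  refine Eq.trans (Form.pullback_eq_bil h.1 hm _ _).symm ?_
  rw [h.2, d_canonicalForm (cotParam_mem hy), mfderiv_cotCoord_cotParam hy,
    mfderiv_cotCoord_cotParam hy]

/-- A map which is symplectic in charts is symplectic. -/
lemma IsSymplAt.isWeinsteinAt {g : E × E → F} (ha : a.1 ∈ (extChartAt 𝓘(ℝ, E) q₀).source)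
    (h : IsSymplAt (Form.bil Ω m₀) g (cotCoord q₀ a))
    (hm : g (cotCoord q₀ a) ∈ (extChartAt 𝓘(ℝ, F) m₀).target) :
    IsWeinsteinAt Ω (fun b => (extChartAt 𝓘(ℝ, F) m₀).symm (g (cotCoord q₀ b))) a := by
  have h0 : ContMDiffAt (𝓘(ℝ, E).prod 𝓘(ℝ, E →L[ℝ] ℝ)) 𝓘(ℝ, F) ∞ (g ∘ cotCoord q₀) a :=
    h.1.contMDiffAt.comp a (contMDiffAt_cotCoord ha)
  have h1 : ContMDiffAt (𝓘(ℝ, E).prod 𝓘(ℝ, E →L[ℝ] ℝ)) 𝓘(ℝ, F) ∞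
      (fun b => (extChartAt 𝓘(ℝ, F) m₀).symm (g (cotCoord q₀ b))) a :=
    (contMDiffAt_extChartAt_symm hm).comp a h0
  refine ⟨h1, fun ξ η => ?_⟩
  rw [Form.pullback_eq_bil (m₀ := m₀) h1 ((extChartAt 𝓘(ℝ, F) m₀).map_target hm),
    d_canonicalForm ha]
  refine Eq.trans ?_ (h.2 _ _)
  have h2 : extChartAt 𝓘(ℝ, F) m₀ ∘
      (fun b => (extChartAt 𝓘(ℝ, F) m₀).symm (g (cotCoord q₀ b))) =ᶠ[𝓝 a] g ∘ cotCoord q₀ := by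
    filter_upwards [h0.continuousAt.eventually
      ((isOpen_extChartAt_target m₀).mem_nhds hm)] with b hb
    exact (extChartAt 𝓘(ℝ, F) m₀).right_inv hb
  have h3 := h2.mfderiv_eq (I := 𝓘(ℝ, E).prod 𝓘(ℝ, E →L[ℝ] ℝ)) (I' := 𝓘(ℝ, F))
  have h4 := mfderiv_comp a (h.1.contMDiffAt.mdifferentiableAt (by simp))
    ((contMDiffAt_cotCoord ha).mdifferentiableAt (by simp))
  rw [mfderiv_eq_fderiv] at h4
  have h5 := h3.trans h4
  rw [(extChartAt 𝓘(ℝ, F) m₀).right_inv hm]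
  exact congrArg₂ (fun u v => Form.bil Ω m₀ (g (cotCoord q₀ a)) u v)
    (congrArg (fun A : E × (E →L[ℝ] ℝ) →L[ℝ] F => A ξ) h5)
    (congrArg (fun A : E × (E →L[ℝ] ℝ) →L[ℝ] F => A η) h5)

/-- A vector killed by the derivative lies in the kernel of the canonical symplectic form, hence is
zero; the dimensions agree. -/
lemma IsWeinsteinAt.isInvertible (h : IsWeinsteinAt Ω Ψ a)
    (hd : Module.finrank ℝ F = 2 * Module.finrank ℝ E) :
    (mfderiv (𝓘(ℝ, E).prod 𝓘(ℝ, E →L[ℝ] ℝ)) 𝓘(ℝ, F) Ψ a).IsInvertible := by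
  refine isInvertible_of_injective (V := E × (E →L[ℝ] ℝ)) (W := F) ?_ ?_
  · rw [Module.finrank_prod, (sharp E).toLinearEquiv.finrank_eq, hd]; ring
  · refine (injective_iff_map_eq_zero _).2 fun ξ hξ => ?_
    obtain ⟨q₀, y, hy, rfl⟩ : ∃ (q₀ : Q) (y : E × E), y.1 ∈ (extChartAt 𝓘(ℝ, E) q₀).target ∧
        cotParam q₀ y = a :=
      ⟨a.1, cotCoord a.1 a, cotCoord_fst_mem (mem_extChartAt_source _),
        cotParam_cotCoord (mem_extChartAt_source _)⟩
    have ha := cotParam_mem hy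
    have h1 : stdBil E (mfderiv (𝓘(ℝ, E).prod 𝓘(ℝ, E →L[ℝ] ℝ)) 𝓘(ℝ, E × E)
        (cotCoord q₀) (cotParam q₀ y) ξ) = 0 := by
      refine ContinuousLinearMap.ext fun w => ?_
      have h2 := h.2 ξ (mfderiv 𝓘(ℝ, E × E) (𝓘(ℝ, E).prod 𝓘(ℝ, E →L[ℝ] ℝ)) (cotParam q₀) y w)
      have h3 := d_canonicalForm ha ξ
        (mfderiv 𝓘(ℝ, E × E) (𝓘(ℝ, E).prod 𝓘(ℝ, E →L[ℝ] ℝ)) (cotParam q₀) y w)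
      rw [mfderiv_cotCoord_cotParam hy] at h3
      exact (h2.trans h3).symm.trans ((Ω (Ψ (cotParam q₀ y))).map_coord_zero (0 : Fin 2) hξ)
    have h2 := stdBil_nondegenerate _ h1
    let D : E × E →L[ℝ] E × (E →L[ℝ] ℝ) := mfderiv 𝓘(ℝ, E × E) (𝓘(ℝ, E).prod 𝓘(ℝ, E →L[ℝ] ℝ))
      (cotParam q₀) (cotCoord q₀ (cotParam q₀ y))
    exact (mfderiv_cotParam_cotCoord ha ξ).symm.trans
      ((congrArg D h2).trans (ContinuousLinearMap.map_zero D))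

end WeinsteinAt

section WeinsteinGerm

variable {E : Type} [NormedAddCommGroup E] [InnerProductSpace ℝ E] [FiniteDimensional ℝ E]
  {Q : Type*} [TopologicalSpace Q] [ChartedSpace E Q] [IsManifold 𝓘(ℝ, E) ∞ Q]
  {F : Type} [NormedAddCommGroup F] [InnerProductSpace ℝ F] [FiniteDimensional ℝ F]
  {M : Type*} [TopologicalSpace M] [ChartedSpace F M] [IsManifold 𝓘(ℝ, F) ∞ M]

/-- Near `0_q`, the map `Ψ` is symplectic and restricts to `j` on the zero section. -/
def IsWeinsteinGerm (Ω : Form 𝓘(ℝ, F) M 2) (j : Q → M) (Ψ : CotangentBundle 𝓘(ℝ, E) Q → M)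
    (q : Q) : Prop :=
  (∀ᶠ a in 𝓝 (zeroCovector 𝓘(ℝ, E) Q q), IsWeinsteinAt Ω Ψ a) ∧
    ∀ᶠ q' in 𝓝 q, Ψ (zeroCovector 𝓘(ℝ, E) Q q') = j q'

variable {Ω : Form 𝓘(ℝ, F) M 2} {j : Q → M} {Ψ Ψ' : CotangentBundle 𝓘(ℝ, E) Q → M}
  {q₀ q : Q} {m₀ : M}

lemma tendsto_zeroCovector (q : Q) :
    Tendsto (zeroCovector 𝓘(ℝ, E) Q) (𝓝 q) (𝓝 (zeroCovector 𝓘(ℝ, E) Q q)) :=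
  (contMDiff_zeroSection (IB := 𝓘(ℝ, E)) (n := ∞) ℝ
    (fun q : Q => TangentSpace 𝓘(ℝ, E) q →L[ℝ] ℝ)).continuous.tendsto q

lemma tendsto_proj (a : CotangentBundle 𝓘(ℝ, E) Q) :
    Tendsto (fun b : CotangentBundle 𝓘(ℝ, E) Q => b.1) (𝓝 a) (𝓝 a.1) :=
  (contMDiff_proj (IB := 𝓘(ℝ, E)) (n := ∞)
    (fun q : Q => TangentSpace 𝓘(ℝ, E) q →L[ℝ] ℝ)).continuous.tendsto a

lemma IsWeinsteinGerm.congr (h : IsWeinsteinGerm Ω j Ψ q)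
    (h' : Ψ' =ᶠ[𝓝 (zeroCovector 𝓘(ℝ, E) Q q)] Ψ) : IsWeinsteinGerm Ω j Ψ' q := by
  refine ⟨?_, ?_⟩
  · filter_upwards [h.1, h'.eventuallyEq_nhds] with a h1 h2 using h1.congr h2
  · filter_upwards [h.2, (tendsto_zeroCovector q).eventually h'] with q' h1 h2
    rw [h2, h1]

lemma tendsto_extChartAt (hq : q ∈ (extChartAt 𝓘(ℝ, E) q₀).source) :
    Tendsto (extChartAt 𝓘(ℝ, E) q₀) (𝓝 q) (𝓝 (extChartAt 𝓘(ℝ, E) q₀ q)) :=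
  (contMDiffAt_extChartAt_of_mem hq).continuousAt

lemma tendsto_extChartAt_symm {x : E} (hx : x ∈ (extChartAt 𝓘(ℝ, E) q₀).target) :
    Tendsto (extChartAt 𝓘(ℝ, E) q₀).symm (𝓝 x) (𝓝 ((extChartAt 𝓘(ℝ, E) q₀).symm x)) :=
  (contMDiffAt_extChartAt_symm hx).continuousAt

/-- Together with `isWeinsteinGerm_of_isLocalWeinsteinAt`, translates between germs on `T*Q` and the
coordinate germs treated by `exists_local_weinstein`. -/
lemma IsWeinsteinGerm.isLocalWeinsteinAt
    (h : IsWeinsteinGerm Ω j Ψ q) (hq : q ∈ (extChartAt 𝓘(ℝ, E) q₀).source)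
    (hm : j q ∈ (extChartAt 𝓘(ℝ, F) m₀).source) :
    IsLocalWeinsteinAt (Form.bil Ω m₀)
      (fun x => extChartAt 𝓘(ℝ, F) m₀ (j ((extChartAt 𝓘(ℝ, E) q₀).symm x)))
      (fun z => extChartAt 𝓘(ℝ, F) m₀ (Ψ (cotParam q₀ z))) (extChartAt 𝓘(ℝ, E) q₀ q) := by
  set φ := extChartAt 𝓘(ℝ, E) q₀ with hφ
  have hx : φ q ∈ φ.target := φ.map_source hq
  have hK0 : cotParam q₀ (φ q, (0 : E)) = zeroCovector 𝓘(ℝ, E) Q q := by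
    rw [cotParam_zero hx, φ.left_inv hq]
  have hK : Tendsto (cotParam q₀) (𝓝 (φ q, (0 : E))) (𝓝 (zeroCovector 𝓘(ℝ, E) Q q)) := by
    rw [← hK0]
    exact (contMDiffAt_cotParam (y := (φ q, (0 : E))) hx).continuousAt
  have ht : ∀ᶠ x in 𝓝 (φ q), x ∈ φ.target := (isOpen_extChartAt_target q₀).mem_nhds hx
  have hΨ : Tendsto Ψ (𝓝 (zeroCovector 𝓘(ℝ, E) Q q)) (𝓝 (j q)) := by
    rw [← h.2.self_of_nhds]
    exact h.1.self_of_nhds.1.continuousAt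
  have hs : ∀ᶠ m in 𝓝 (j q), m ∈ (extChartAt 𝓘(ℝ, F) m₀).source :=
    (isOpen_extChartAt_source m₀).mem_nhds hm
  refine ⟨?_, ?_⟩
  · filter_upwards [(continuous_fst.tendsto (φ q, (0 : E))).eventually ht, hK.eventually h.1,
      hK.eventually (hΨ.eventually hs)] with y h1 h2 h3
    exact h2.isSymplAt h1 h3
  · have h2 := tendsto_extChartAt_symm hx
    rw [φ.left_inv hq] at h2
    filter_upwards [ht, h2.eventually h.2] with x h3 h4
    rw [cotParam_zero h3, h4]

lemma isWeinsteinGerm_of_isLocalWeinsteinAt (hj : ContinuousAt j q) {g : E × E → F}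
    (hq : q ∈ (extChartAt 𝓘(ℝ, E) q₀).source) (hm : j q ∈ (extChartAt 𝓘(ℝ, F) m₀).source)
    (h : IsLocalWeinsteinAt (Form.bil Ω m₀)
      (fun x => extChartAt 𝓘(ℝ, F) m₀ (j ((extChartAt 𝓘(ℝ, E) q₀).symm x))) g
      (extChartAt 𝓘(ℝ, E) q₀ q)) :
    IsWeinsteinGerm Ω j (fun b => (extChartAt 𝓘(ℝ, F) m₀).symm (g (cotCoord q₀ b))) q := by
  set φ := extChartAt 𝓘(ℝ, E) q₀ with hφ
  have hC0 : cotCoord q₀ (zeroCovector 𝓘(ℝ, E) Q q) = (φ q, 0) := cotCoord_zeroCovector hq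
  have hC : Tendsto (cotCoord q₀) (𝓝 (zeroCovector 𝓘(ℝ, E) Q q)) (𝓝 (φ q, (0 : E))) := by
    rw [← hC0]
    exact (contMDiffAt_cotCoord (a := zeroCovector 𝓘(ℝ, E) Q q) hq).continuousAt
  have hqs : ∀ᶠ q' in 𝓝 q, q' ∈ φ.source := (isOpen_extChartAt_source q₀).mem_nhds hq
  have hjs : ∀ᶠ q' in 𝓝 q, j q' ∈ (extChartAt 𝓘(ℝ, F) m₀).source :=
    hj.eventually ((isOpen_extChartAt_source m₀).mem_nhds hm)
  have hg0 : g (φ q, 0) = extChartAt 𝓘(ℝ, F) m₀ (j q) := by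
    rw [h.2.self_of_nhds]
    simp only [φ.left_inv hq]
  have hg : Tendsto g (𝓝 (φ q, (0 : E))) (𝓝 (extChartAt 𝓘(ℝ, F) m₀ (j q))) := by
    rw [← hg0]; exact h.1.self_of_nhds.1.continuousAt
  have hgt : ∀ᶠ y in 𝓝 (extChartAt 𝓘(ℝ, F) m₀ (j q)), y ∈ (extChartAt 𝓘(ℝ, F) m₀).target :=
    (isOpen_extChartAt_target m₀).mem_nhds ((extChartAt 𝓘(ℝ, F) m₀).map_source hm)
  refine ⟨?_, ?_⟩
  · filter_upwards [eventually_mem_source (a := zeroCovector 𝓘(ℝ, E) Q q) hq, hC.eventually h.1,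
      hC.eventually (hg.eventually hgt)] with a h1 h2 h3
    exact h2.isWeinsteinAt h1 h3
  · filter_upwards [hqs, hjs, (tendsto_extChartAt hq).eventually h.2] with q' h1 h2 h3
    rw [cotCoord_zeroCovector h1, h3]
    simp only [← hφ, φ.left_inv h1]
    rw [(extChartAt 𝓘(ℝ, F) m₀).left_inv h2]

/-- Extending a symplectic germ over a coordinate ball. -/
lemma exists_isWeinsteinGerm_ball [T2Space Q]
    (hΩ : IsSymplectic 𝓘(ℝ, F) Ω) (hj : ContMDiff 𝓘(ℝ, E) 𝓘(ℝ, F) ∞ j)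
    (hinj : ∀ q, Function.Injective (mfderiv 𝓘(ℝ, E) 𝓘(ℝ, F) j q))
    (hiso : ∀ (q : Q) (u v : TangentSpace 𝓘(ℝ, E) q),
      Ω (j q) ![mfderiv 𝓘(ℝ, E) 𝓘(ℝ, F) j q u, mfderiv 𝓘(ℝ, E) 𝓘(ℝ, F) j q v] = 0)
    {D : Set Q} (hD : IsClosed D)
    (hΨ : ∀ q ∈ D, IsWeinsteinGerm Ω j Ψ q) {r : ℝ}
    (hr : Metric.closedBall (extChartAt 𝓘(ℝ, E) q₀ q₀) r ⊆ (extChartAt 𝓘(ℝ, E) q₀).target ∩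
      (extChartAt 𝓘(ℝ, E) q₀).symm ⁻¹' (j ⁻¹' (extChartAt 𝓘(ℝ, F) (j q₀)).source)) :
    ∃ Ψ' : CotangentBundle 𝓘(ℝ, E) Q → M,
      (∀ q ∈ D, Ψ' =ᶠ[𝓝 (zeroCovector 𝓘(ℝ, E) Q q)] Ψ) ∧
      ∀ x ∈ Metric.ball (extChartAt 𝓘(ℝ, E) q₀ q₀) r,
        IsWeinsteinGerm Ω j Ψ' ((extChartAt 𝓘(ℝ, E) q₀).symm x) := by
  set φ := extChartAt 𝓘(ℝ, E) q₀ with hφ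
  set e := extChartAt 𝓘(ℝ, F) (j q₀) with he
  set U := φ.target ∩ φ.symm ⁻¹' (j ⁻¹' e.source) with hU
  set K := Metric.closedBall (φ q₀) r with hK
  have hUo : IsOpen U :=
    (continuousOn_extChartAt_symm q₀).isOpen_inter_preimage (isOpen_extChartAt_target q₀)
      ((isOpen_extChartAt_source (j q₀)).preimage hj.continuous)
  have hKc : IsCompact K := isCompact_closedBall _ _
  have hsm : ∀ x ∈ U, ContMDiffAt 𝓘(ℝ, E) 𝓘(ℝ, F) ∞ (j ∘ φ.symm) x := fun x hx =>
    (hj _).comp x (contMDiffAt_extChartAt_symm hx.1)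
  have hd : ∀ x ∈ U, ∀ u : E, mfderiv 𝓘(ℝ, E) 𝓘(ℝ, F) (j ∘ φ.symm) x u =
      mfderiv 𝓘(ℝ, E) 𝓘(ℝ, F) j (φ.symm x) (mfderiv 𝓘(ℝ, E) 𝓘(ℝ, E) φ.symm x u) := fun x hx u =>
    congrArg (fun A : E →L[ℝ] F => A u) (mfderiv_comp x ((hj _).mdifferentiableAt (by simp))
      ((contMDiffAt_extChartAt_symm hx.1).mdifferentiableAt (by simp)))
  have hjU : ∀ x ∈ U, ContDiffAt ℝ ∞ (fun x => e (j (φ.symm x))) x := fun x hx =>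
    contMDiffAt_iff_contDiffAt.1 ((contMDiffAt_extChartAt_of_mem hx.2).comp x (hsm x hx))
  have hA : IsClosed (K ∩ φ.symm ⁻¹' D) :=
    ((continuousOn_extChartAt_symm q₀).mono fun x hx => (hr hx).1).preimage_isClosed_of_isClosed
      Metric.isClosed_closedBall hD
  have hinj' : ∀ x ∈ U, Function.Injective (fderiv ℝ (fun x => e (j (φ.symm x))) x) := by
    intro x hx
    refine (injective_iff_map_eq_zero _).2 fun u hu => ?_
    have h1 := congrArg (fun A : E →L[ℝ] F => A u) (mfderiv_eq_comp_extChartAt (hsm x hx) hx.2)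
    let T : F →L[ℝ] F := mfderiv 𝓘(ℝ, F) 𝓘(ℝ, F) e.symm (e (j (φ.symm x)))
    have h2 : mfderiv 𝓘(ℝ, E) 𝓘(ℝ, F) (j ∘ φ.symm) x u = 0 := by
      refine h1.trans ?_
      change T (mfderiv 𝓘(ℝ, E) 𝓘(ℝ, F) (e ∘ (j ∘ φ.symm)) x u) = 0
      rw [mfderiv_eq_fderiv]
      exact (congrArg T hu).trans (ContinuousLinearMap.map_zero T)
    rw [hd x hx] at h2
    have h3 := (injective_iff_map_eq_zero _).1 (hinj _) _ h2
    have := IsManifold.of_le (I := 𝓘(ℝ, E)) (M := Q) (m := 1) (n := ∞) (by simp)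
    obtain ⟨S, hS⟩ := isInvertible_mfderivWithin_extChartAt_symm (I := 𝓘(ℝ, E)) hx.1
    rw [modelWithCornersSelf_coe, range_id, mfderivWithin_univ] at hS
    rw [hφ, ← hS] at h3
    exact (map_eq_zero_iff S S.injective).1 h3
  have hiso' : ∀ x ∈ U, ∀ u v, Form.bil Ω (j q₀) (e (j (φ.symm x)))
      (fderiv ℝ (fun x => e (j (φ.symm x))) x u)
      (fderiv ℝ (fun x => e (j (φ.symm x))) x v) = 0 := by
    intro x hx u v
    have h1 := Form.pullback_eq_bil (Ω := Ω) (hsm x hx) hx.2 u v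
    rw [hd x hx, hd x hx, mfderiv_eq_fderiv] at h1
    exact h1.symm.trans (hiso _ _ _)
  have hΨ' : ∀ x ∈ K ∩ φ.symm ⁻¹' D ∩ K, IsLocalWeinsteinAt (Form.bil Ω (j q₀))
      (fun x => e (j (φ.symm x))) (fun z => e (Ψ (cotParam q₀ z))) x := by
    rintro x ⟨⟨hx1, hx2⟩, -⟩
    have h1 := (hΨ _ hx2).isLocalWeinsteinAt (q₀ := q₀) (m₀ := j q₀)
      (φ.map_target (hr hx1).1) (hr hx1).2
    rwa [← hφ, φ.right_inv (hr hx1).1] at h1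
  obtain ⟨g, hg1, hg2⟩ := exists_local_weinstein (β := Form.bil Ω (j q₀)) (O := e.target)
    (isOpen_extChartAt_target (j q₀)) (fun x hx => hΩ.contDiffAt_bil hx)
    (fun x hx => hΩ.isClosedAt_bil hx) (fun x _ u v => Form.bil_skew u v)
    (fun x hx u hu => hΩ.bil_nondegenerate hx u hu) hUo hjU
    (fun x hx => e.map_source hx.2) hinj' hiso' hA hKc hr
    (Ψ := fun z => e (Ψ (cotParam q₀ z))) hΨ'
  classical
  have hVc : IsClosed (φ.symm '' K) :=
    (hKc.image_of_continuousOn ((continuousOn_extChartAt_symm q₀).mono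
      fun x hx => (hr hx).1)).isClosed
  -- The new solution over the closed coordinate ball, the old map elsewhere. Along `D` both have
  -- the same germ, so the switch is harmless there; away from `D` only the open ball is claimed.
  refine ⟨fun a => if a.1 ∈ φ.symm '' K then e.symm (g (cotCoord q₀ a)) else Ψ a, ?_, ?_⟩
  · intro q hq
    by_cases hqV : q ∈ φ.symm '' K
    · obtain ⟨x, hx, rfl⟩ := hqV
      have hxs := φ.map_target (hr hx).1
      have h1 := hg2 x ⟨⟨hx, hq⟩, hx⟩
      have h2 : Tendsto (cotCoord q₀) (𝓝 (zeroCovector 𝓘(ℝ, E) Q (φ.symm x)))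
          (𝓝 (x, (0 : E))) := by
        have h3 := (contMDiffAt_cotCoord (a := zeroCovector 𝓘(ℝ, E) Q (φ.symm x))
          hxs).continuousAt.tendsto
        rwa [cotCoord_zeroCovector hxs, ← hφ, φ.right_inv (hr hx).1] at h3
      have h4 : Tendsto Ψ (𝓝 (zeroCovector 𝓘(ℝ, E) Q (φ.symm x))) (𝓝 (j (φ.symm x))) := by
        rw [← (hΨ _ hq).2.self_of_nhds]
        exact (hΨ _ hq).1.self_of_nhds.1.continuousAt
      filter_upwards [eventually_mem_source (a := zeroCovector 𝓘(ℝ, E) Q (φ.symm x)) hxs,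
        h2.eventually h1, h4.eventually ((isOpen_extChartAt_source (j q₀)).mem_nhds (hr hx).2)]
        with a h5 h6 h7
      split_ifs
      · rw [h6, cotParam_cotCoord h5]
        exact e.left_inv h7
      · rfl
    · filter_upwards [(tendsto_proj (zeroCovector 𝓘(ℝ, E) Q q)).eventually
        (hVc.isOpen_compl.mem_nhds hqV)] with a ha
      exact if_neg ha
  · intro x hx
    have hxK : x ∈ K := Metric.ball_subset_closedBall hx
    have hxs := φ.map_target (hr hxK).1
    have h1 : IsWeinsteinGerm Ω j (fun a => e.symm (g (cotCoord q₀ a))) (φ.symm x) := by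
      refine isWeinsteinGerm_of_isLocalWeinsteinAt (q₀ := q₀) hj.continuous.continuousAt hxs
        (hr hxK).2 ?_
      rw [← hφ, φ.right_inv (hr hxK).1]
      exact hg1 x hxK
    refine h1.congr ?_
    have h2 : ∀ᶠ q in 𝓝 (φ.symm x), q ∈ φ.symm '' K := by
      have h3 := tendsto_extChartAt hxs
      rw [← hφ, φ.right_inv (hr hxK).1] at h3
      filter_upwards [(isOpen_extChartAt_source q₀).mem_nhds hxs,
        h3.eventually (Metric.isOpen_ball.mem_nhds hx)] with q h4 h5
      exact ⟨φ q, Metric.ball_subset_closedBall h5, φ.left_inv h4⟩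
    filter_upwards [(tendsto_proj (zeroCovector 𝓘(ℝ, E) Q (φ.symm x))).eventually h2] with a ha
    exact if_pos ha

/-- **The relative Weinstein neighborhood theorem**: a germ of a symplectic map along a part of the
zero section extends to the whole zero section. -/
theorem exists_isWeinsteinGerm [T2Space Q] [CompactSpace Q]
    (hΩ : IsSymplectic 𝓘(ℝ, F) Ω) (hj : ContMDiff 𝓘(ℝ, E) 𝓘(ℝ, F) ∞ j)
    (hinj : ∀ q, Function.Injective (mfderiv 𝓘(ℝ, E) 𝓘(ℝ, F) j q))
    (hiso : ∀ (q : Q) (u v : TangentSpace 𝓘(ℝ, E) q),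
      Ω (j q) ![mfderiv 𝓘(ℝ, E) 𝓘(ℝ, F) j q u, mfderiv 𝓘(ℝ, E) 𝓘(ℝ, F) j q v] = 0)
    {D : Set Q} (hD : IsClosed D) (hΨ : ∀ q ∈ D, IsWeinsteinGerm Ω j Ψ q) :
    ∃ Ψ' : CotangentBundle 𝓘(ℝ, E) Q → M,
      (∀ q ∈ D, Ψ' =ᶠ[𝓝 (zeroCovector 𝓘(ℝ, E) Q q)] Ψ) ∧ ∀ q, IsWeinsteinGerm Ω j Ψ' q := by
  have hr : ∀ q₀ : Q, ∃ r > 0, Metric.closedBall (extChartAt 𝓘(ℝ, E) q₀ q₀) r ⊆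
      (extChartAt 𝓘(ℝ, E) q₀).target ∩
        (extChartAt 𝓘(ℝ, E) q₀).symm ⁻¹' (j ⁻¹' (extChartAt 𝓘(ℝ, F) (j q₀)).source) := by
    intro q₀
    refine Metric.nhds_basis_closedBall.mem_iff.1 (inter_mem
      ((isOpen_extChartAt_target q₀).mem_nhds (mem_extChartAt_target q₀)) ?_)
    have h := tendsto_extChartAt_symm (mem_extChartAt_target (I := 𝓘(ℝ, E)) q₀)
    rw [(extChartAt 𝓘(ℝ, E) q₀).left_inv (mem_extChartAt_source q₀)] at h
    exact h (hj.continuous.continuousAt (extChartAt_source_mem_nhds (j q₀)))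
  choose r hr0 hr using hr
  -- Half the radius puts the closed set `V q₀` inside the open ball on which germs are produced.
  -- Closedness allows the union of the sets already treated to serve as the prescribed set at the
  -- next stage.
  let V : Q → Set Q := fun q₀ => (extChartAt 𝓘(ℝ, E) q₀).symm ''
    Metric.closedBall (extChartAt 𝓘(ℝ, E) q₀ q₀) (r q₀ / 2)
  have hle : ∀ q₀, Metric.closedBall (extChartAt 𝓘(ℝ, E) q₀ q₀) (r q₀ / 2) ⊆
      Metric.ball (extChartAt 𝓘(ℝ, E) q₀ q₀) (r q₀) := fun q₀ =>
    Metric.closedBall_subset_ball (by linarith [hr0 q₀])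
  have hV : ∀ q₀, IsClosed (V q₀) := fun q₀ =>
    ((isCompact_closedBall _ _).image_of_continuousOn ((continuousOn_extChartAt_symm q₀).mono
      fun x hx => (hr q₀ (Metric.ball_subset_closedBall (hle q₀ hx))).1)).isClosed
  have hVn : ∀ q₀, V q₀ ∈ 𝓝 q₀ := by
    intro q₀
    filter_upwards [extChartAt_source_mem_nhds (I := 𝓘(ℝ, E)) q₀,
      tendsto_extChartAt (mem_extChartAt_source (I := 𝓘(ℝ, E)) q₀)
        (Metric.closedBall_mem_nhds _ (half_pos (hr0 q₀)))] with q h1 h2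
    exact ⟨_, h2, (extChartAt 𝓘(ℝ, E) q₀).left_inv h1⟩
  obtain ⟨t, ht⟩ := CompactSpace.elim_nhds_subcover V hVn
  have key : ∀ s : Finset Q, ∃ Ψ' : CotangentBundle 𝓘(ℝ, E) Q → M,
      (∀ q ∈ D, Ψ' =ᶠ[𝓝 (zeroCovector 𝓘(ℝ, E) Q q)] Ψ) ∧
      ∀ q ∈ D ∪ ⋃ x ∈ s, V x, IsWeinsteinGerm Ω j Ψ' q := by
    classical
    intro s
    induction s using Finset.induction_on with
    | empty => exact ⟨Ψ, fun q _ => EventuallyEq.rfl, by simpa using hΨ⟩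
    | insert q₀ s _ ih =>
      obtain ⟨Ψ₁, h1, h2⟩ := ih
      obtain ⟨Ψ₂, h3, h4⟩ := exists_isWeinsteinGerm_ball hΩ hj hinj hiso
        (hD.union (isClosed_biUnion_finset fun x _ => hV x)) h2 (hr q₀)
      refine ⟨Ψ₂, fun q hq => (h3 q (Or.inl hq)).trans (h1 q hq), fun q hq => ?_⟩
      by_cases hq' : q ∈ D ∪ ⋃ x ∈ s, V x
      · exact (h2 q hq').congr (h3 q hq')
      · rw [Finset.set_biUnion_insert] at hq
        have hqV : q ∈ V q₀ := by
          rcases hq with hq | hq | hq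
          · exact absurd (Or.inl hq) hq'
          · exact hq
          · exact absurd (Or.inr hq) hq'
        obtain ⟨x, hx, rfl⟩ := hqV
        exact h4 x (hle q₀ hx)
  obtain ⟨Ψ', h1, h2⟩ := key t
  exact ⟨Ψ', h1, fun q => h2 q (Or.inr (by rw [ht]; trivial))⟩

end WeinsteinGerm

section

open scoped RealInnerProductSpace

/-! ### Cotangent lifts of local diffeomorphisms -/

section CotangentLift

variable {E : Type} [NormedAddCommGroup E] [InnerProductSpace ℝ E] [FiniteDimensional ℝ E]

/-- The cotangent lift of a local diffeomorphism of `E`. -/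
def coordLift (h : E → E) (z : E × E) : E × E :=
  (h z.1, sharp E ((flat E z.2).comp (fderiv ℝ h z.1).inverse))

variable {h : E → E} {z : E × E}

lemma eventually_isInvertible (hh : ContDiffAt ℝ ∞ h z.1) (hi : (fderiv ℝ h z.1).IsInvertible) :
    ∀ᶠ x in 𝓝 z.1, (fderiv ℝ h x).IsInvertible := by
  have := FiniteDimensional.complete ℝ E
  obtain ⟨e, he⟩ := hi
  have h1 : Tendsto (fderiv ℝ h) (𝓝 z.1) (𝓝 (e : E →L[ℝ] E)) := by
    rw [he]
    exact (hh.fderiv_right (m := 0) (by simp)).continuousAt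
  filter_upwards [h1.eventually e.nhds] with x hx
  exact hx

/-- The lift preserves the pairing of covectors with vectors; differentiating this identity shows
that the lift is symplectic. -/
lemma inner_coordLift (hi : (fderiv ℝ h z.1).IsInvertible) (w : E) :
    ⟪(coordLift h z).2, fderiv ℝ h z.1 w⟫ = ⟪z.2, w⟫ := by
  rw [coordLift, inner_sharp, ContinuousLinearMap.comp_apply, hi.inverse_apply_self, flat_apply]

lemma contDiffAt_coordLift (hh : ContDiffAt ℝ ∞ h z.1) (hi : (fderiv ℝ h z.1).IsInvertible) :
    ContDiffAt ℝ ∞ (coordLift h) z := by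
  have := FiniteDimensional.complete ℝ E
  have h1 : ContDiffAt ℝ ∞ (fun z : E × E => fderiv ℝ h z.1) z :=
    (hh.fderiv_right (m := ∞) (by simp)).comp z contDiffAt_fst
  have h2 : ContDiffAt ℝ ∞ (fun z : E × E => (fderiv ℝ h z.1).inverse) z := by
    obtain ⟨e, he⟩ := hi
    refine ContDiffAt.comp z (g := ContinuousLinearMap.inverse) ?_ h1
    rw [← he]
    exact contDiffAt_map_inverse e
  exact (hh.comp z contDiffAt_fst).prodMk ((sharp E).contDiff.contDiffAt.comp z
    (((flat E).contDiff.contDiffAt.comp z contDiffAt_snd).clm_comp h2))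

/-- The derivative of `inner_coordLift` contains one term with the Hessian of `h`, which is
symmetric and so drops out of the skew form. -/
lemma stdBil_fderiv_coordLift (hh : ContDiffAt ℝ ∞ h z.1) (hi : (fderiv ℝ h z.1).IsInvertible)
    (u v : E × E) :
    stdBil E (fderiv ℝ (coordLift h) z u) (fderiv ℝ (coordLift h) z v) = stdBil E u v := by
  have hS := (contDiffAt_coordLift hh hi).differentiableAt (by simp)
  have hd : HasFDerivAt h (fderiv ℝ h z.1) z.1 := (hh.differentiableAt (by simp)).hasFDerivAt
  have hdd : HasFDerivAt (fderiv ℝ h) (fderiv ℝ (fderiv ℝ h) z.1) z.1 :=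
    ((hh.fderiv_right (m := ∞) (by simp)).differentiableAt (by simp)).hasFDerivAt
  have h1 : ∀ v, (fderiv ℝ (coordLift h) z v).1 = fderiv ℝ h z.1 v.1 := by
    intro v
    have e1 := (hd.comp z hasFDerivAt_fst).unique hS.hasFDerivAt.fst
    exact (congrArg (fun A : E × E →L[ℝ] E => A v) e1).symm
  have h2 : ∀ v w, ⟪(coordLift h z).2, fderiv ℝ (fderiv ℝ h) z.1 v.1 w⟫ +
      ⟪(fderiv ℝ (coordLift h) z v).2, fderiv ℝ h z.1 w⟫ = ⟪v.2, w⟫ := by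
    intro v w
    have e1 : HasFDerivAt (fun z : E × E => fderiv ℝ h z.1) _ z := hdd.comp z hasFDerivAt_fst
    have e2 := (hS.hasFDerivAt.snd).inner ℝ (e1.clm_apply (hasFDerivAt_const w z))
    have e3 : (fun z : E × E => ⟪(coordLift h z).2, fderiv ℝ h z.1 w⟫) =ᶠ[𝓝 z]
        fun z => ⟪z.2, w⟫ := by
      filter_upwards [(continuous_fst.tendsto z).eventually (eventually_isInvertible hh hi)]
        with y hy
      exact inner_coordLift hy w
    have e4 : HasFDerivAt (fun z : E × E => ⟪z.2, w⟫) _ z :=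
      (hasFDerivAt_snd (𝕜 := ℝ) (E := E) (F := E)).inner ℝ (hasFDerivAt_const w z)
    have e5 := congrArg (fun A : E × E →L[ℝ] ℝ => A v)
      ((e2.congr_of_eventuallyEq e3.symm).unique e4)
    simpa using e5
  have h3 : fderiv ℝ (fderiv ℝ h) z.1 u.1 v.1 = fderiv ℝ (fderiv ℝ h) z.1 v.1 u.1 :=
    (hh.isSymmSndFDerivAt
      (by simpa using WithTop.coe_le_coe.2 (le_top : (2 : ℕ∞) ≤ ⊤))).eq u.1 v.1
  have h4 := h2 u v.1
  have h5 := h2 v u.1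
  rw [stdBil_apply, stdBil_apply, h1, h1, ← h4, ← h5, h3]
  ring

variable {Q : Type*} [TopologicalSpace Q] [ChartedSpace E Q] [IsManifold 𝓘(ℝ, E) ∞ Q]

/-- The cotangent lift of a local diffeomorphism from `E` to a manifold. -/
def cotangentLift (φ : E → Q) (z : E × E) : CotangentBundle 𝓘(ℝ, E) Q :=
  ⟨φ z.1, (flat E z.2).comp (mfderiv 𝓘(ℝ, E) 𝓘(ℝ, E) φ z.1).inverse⟩

variable {φ : E → Q} {q₀ : Q}

lemma isInvertible_fderiv_comp (hφ : ContMDiffAt 𝓘(ℝ, E) 𝓘(ℝ, E) ∞ φ z.1)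
    (hi : (mfderiv 𝓘(ℝ, E) 𝓘(ℝ, E) φ z.1).IsInvertible)
    (hz : φ z.1 ∈ (extChartAt 𝓘(ℝ, E) q₀).source) :
    (fderiv ℝ (extChartAt 𝓘(ℝ, E) q₀ ∘ φ) z.1).IsInvertible := by
  have := IsManifold.of_le (I := 𝓘(ℝ, E)) (M := Q) (m := 1) (n := ∞) (by simp)
  rw [← mfderiv_eq_fderiv, mfderiv_comp z.1
    ((contMDiffAt_extChartAt_of_mem hz).mdifferentiableAt (by simp))
    (hφ.mdifferentiableAt (by simp))]
  exact (isInvertible_mfderiv_extChartAt hz).comp hi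

lemma inverse_comp_of_eq {A B D : E →L[ℝ] E} (hA : A.IsInvertible) (hD : D.IsInvertible)
    (h : A = B.comp D) : A.inverse.comp B = D.inverse := by
  refine ContinuousLinearMap.ext fun w => ?_
  conv_lhs => rw [← hD.self_apply_inverse w]
  change A.inverse ((B.comp D) (D.inverse w)) = _
  rw [← h, hA.inverse_apply_self]

lemma cotCoord_cotangentLift (hφ : ContMDiffAt 𝓘(ℝ, E) 𝓘(ℝ, E) ∞ φ z.1)
    (hi : (mfderiv 𝓘(ℝ, E) 𝓘(ℝ, E) φ z.1).IsInvertible)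
    (hz : φ z.1 ∈ (extChartAt 𝓘(ℝ, E) q₀).source) :
    cotCoord q₀ (cotangentLift φ z) = coordLift (extChartAt 𝓘(ℝ, E) q₀ ∘ φ) z := by
  have h1 := mfderiv_eq_comp_extChartAt hφ hz
  rw [mfderiv_eq_fderiv] at h1
  rw [cotCoord, cotChart_apply (a := cotangentLift φ z) hz, coordLift]
  refine Prod.ext rfl (congrArg (sharp E) ?_)
  exact congrArg (flat E z.2).comp (inverse_comp_of_eq hi (isInvertible_fderiv_comp hφ hi hz) h1)

lemma contMDiffAt_cotangentLift (hφ : ContMDiffAt 𝓘(ℝ, E) 𝓘(ℝ, E) ∞ φ z.1)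
    (hφ' : ∀ᶠ x in 𝓝 z.1, ContMDiffAt 𝓘(ℝ, E) 𝓘(ℝ, E) ∞ φ x ∧
      (mfderiv 𝓘(ℝ, E) 𝓘(ℝ, E) φ x).IsInvertible) :
    ContMDiffAt 𝓘(ℝ, E × E) (𝓘(ℝ, E).prod 𝓘(ℝ, E →L[ℝ] ℝ)) ∞ (cotangentLift φ) z := by
  have hs : φ z.1 ∈ (extChartAt 𝓘(ℝ, E) (φ z.1)).source := mem_extChartAt_source _
  have h1 : ContDiffAt ℝ ∞ (coordLift (extChartAt 𝓘(ℝ, E) (φ z.1) ∘ φ)) z :=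
    contDiffAt_coordLift (contMDiffAt_iff_contDiffAt.1
      ((contMDiffAt_extChartAt_of_mem hs).comp _ hφ))
      (isInvertible_fderiv_comp hφ hφ'.self_of_nhds.2 hs)
  have h2 : ContMDiffAt 𝓘(ℝ, E × E) (𝓘(ℝ, E).prod 𝓘(ℝ, E →L[ℝ] ℝ)) ∞
      (cotParam (φ z.1) ∘ coordLift (extChartAt 𝓘(ℝ, E) (φ z.1) ∘ φ)) z :=
    (contMDiffAt_cotParam (y := coordLift (extChartAt 𝓘(ℝ, E) (φ z.1) ∘ φ) z)
      ((extChartAt 𝓘(ℝ, E) (φ z.1)).map_source hs)).comp z h1.contMDiffAt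
  refine h2.congr_of_eventuallyEq ?_
  have h3 : ∀ᶠ x in 𝓝 z.1, φ x ∈ (extChartAt 𝓘(ℝ, E) (φ z.1)).source :=
    hφ.continuousAt.eventually ((isOpen_extChartAt_source _).mem_nhds hs)
  filter_upwards [(continuous_fst.tendsto z).eventually (hφ'.and h3)] with y hy
  rw [Function.comp_apply, ← cotCoord_cotangentLift hy.1.1 hy.1.2 hy.2,
    cotParam_cotCoord (a := cotangentLift φ y) hy.2]

lemma cotangentLift_zero (x : E) : cotangentLift φ (x, 0) = zeroCovector 𝓘(ℝ, E) Q (φ x) := by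
  unfold cotangentLift zeroCovector
  congr 1
  simp only [map_zero]
  exact ContinuousLinearMap.zero_comp _

/-- Base points agree by injectivity of `φ`; covectors over one point are separated by their
pairings with the image of the invertible derivative. -/
lemma injOn_cotangentLift {U : Set E} (hφ : InjOn φ U)
    (hφ' : ∀ x ∈ U, ContMDiffAt 𝓘(ℝ, E) 𝓘(ℝ, E) ∞ φ x ∧
      (mfderiv 𝓘(ℝ, E) 𝓘(ℝ, E) φ x).IsInvertible) :
    InjOn (cotangentLift φ) {z | z.1 ∈ U} := by
  rintro ⟨x, y⟩ hx ⟨x', y'⟩ hx' h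
  have h1 : x = x' := hφ hx hx' (congrArg (fun a => a.1) h)
  subst h1
  have hs : φ x ∈ (extChartAt 𝓘(ℝ, E) (φ x)).source := mem_extChartAt_source _
  have h2 := congrArg (cotCoord (φ x)) h
  rw [cotCoord_cotangentLift (z := (x, y)) (hφ' x hx).1 (hφ' x hx).2 hs,
    cotCoord_cotangentLift (z := (x, y')) (hφ' x hx).1 (hφ' x hx).2 hs] at h2
  have hi := isInvertible_fderiv_comp (z := (x, y)) (hφ' x hx).1 (hφ' x hx).2 hs
  refine Prod.ext rfl (ext_inner_right ℝ fun w => ?_)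
  rw [← inner_coordLift (z := (x, y)) hi, ← inner_coordLift (z := (x, y')) hi, h2]

/-- The cotangent lift pulls the canonical symplectic form back to the standard one. -/
lemma d_canonicalForm_cotangentLift (hφ' : ∀ᶠ x in 𝓝 z.1, ContMDiffAt 𝓘(ℝ, E) 𝓘(ℝ, E) ∞ φ x ∧
      (mfderiv 𝓘(ℝ, E) 𝓘(ℝ, E) φ x).IsInvertible) (u v : E × E) :
    Form.d (𝓘(ℝ, E).prod 𝓘(ℝ, E →L[ℝ] ℝ)) (canonicalForm 𝓘(ℝ, E) Q) (cotangentLift φ z)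
      ![mfderiv 𝓘(ℝ, E × E) (𝓘(ℝ, E).prod 𝓘(ℝ, E →L[ℝ] ℝ)) (cotangentLift φ) z u,
        mfderiv 𝓘(ℝ, E × E) (𝓘(ℝ, E).prod 𝓘(ℝ, E →L[ℝ] ℝ)) (cotangentLift φ) z v] =
      stdBil E u v := by
  have hφ := hφ'.self_of_nhds.1
  have hs : φ z.1 ∈ (extChartAt 𝓘(ℝ, E) (φ z.1)).source := mem_extChartAt_source _
  have h1 : ∀ w : E × E, mfderiv (𝓘(ℝ, E).prod 𝓘(ℝ, E →L[ℝ] ℝ)) 𝓘(ℝ, E × E) (cotCoord (φ z.1))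
      (cotangentLift φ z)
      (mfderiv 𝓘(ℝ, E × E) (𝓘(ℝ, E).prod 𝓘(ℝ, E →L[ℝ] ℝ)) (cotangentLift φ) z w) =
      fderiv ℝ (coordLift (extChartAt 𝓘(ℝ, E) (φ z.1) ∘ φ)) z w := by
    intro w
    have e1 := mfderiv_comp z
      ((contMDiffAt_cotCoord (a := cotangentLift φ z) hs).mdifferentiableAt (by simp))
      ((contMDiffAt_cotangentLift hφ hφ').mdifferentiableAt (by simp))
    have e2 : cotCoord (φ z.1) ∘ cotangentLift φ =ᶠ[𝓝 z]
        coordLift (extChartAt 𝓘(ℝ, E) (φ z.1) ∘ φ) := by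
      have h3 : ∀ᶠ x in 𝓝 z.1, φ x ∈ (extChartAt 𝓘(ℝ, E) (φ z.1)).source :=
        hφ.continuousAt.eventually ((isOpen_extChartAt_source _).mem_nhds hs)
      filter_upwards [(continuous_fst.tendsto z).eventually (hφ'.and h3)] with y hy
      exact cotCoord_cotangentLift hy.1.1 hy.1.2 hy.2
    rw [e2.mfderiv_eq, mfderiv_eq_fderiv] at e1
    exact congrArg (fun A : E × E →L[ℝ] E × E => A w) e1.symm
  rw [d_canonicalForm (a := cotangentLift φ z) hs, h1, h1]
  exact stdBil_fderiv_coordLift (contMDiffAt_iff_contDiffAt.1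
      ((contMDiffAt_extChartAt_of_mem hs).comp _ hφ))
      (isInvertible_fderiv_comp hφ hφ'.self_of_nhds.2 hs) u v

lemma hasLocalInverseAt_cotangentLift (hφ' : ∀ᶠ x in 𝓝 z.1, ContMDiffAt 𝓘(ℝ, E) 𝓘(ℝ, E) ∞ φ x ∧
      (mfderiv 𝓘(ℝ, E) 𝓘(ℝ, E) φ x).IsInvertible) :
    HasLocalInverseAt 𝓘(ℝ, E × E) (𝓘(ℝ, E).prod 𝓘(ℝ, E →L[ℝ] ℝ)) (cotangentLift φ) z := by
  have := FiniteDimensional.complete ℝ E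
  refine hasLocalInverseAt_of_isInvertible ?_ ?_
  · filter_upwards [(continuous_fst.tendsto z).eventually hφ'.eventually_nhds] with y hy
    exact contMDiffAt_cotangentLift hy.self_of_nhds.1 hy
  · refine isInvertible_of_injective (V := E × E) (W := E × (E →L[ℝ] ℝ)) ?_ ?_
    · rw [Module.finrank_prod, Module.finrank_prod, (sharp E).toLinearEquiv.finrank_eq]
    · refine (injective_iff_map_eq_zero _).2 fun u hu => ?_
      refine stdBil_nondegenerate u (ContinuousLinearMap.ext fun v => ?_)
      have h1 := d_canonicalForm_cotangentLift hφ' u v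
      exact h1.symm.trans ((Form.d (𝓘(ℝ, E).prod 𝓘(ℝ, E →L[ℝ] ℝ)) (canonicalForm 𝓘(ℝ, E) Q)
        (cotangentLift φ z)).map_coord_zero (0 : Fin 2) hu)

end CotangentLift

end

/-! ### Relative models and their restriction to the zero section -/

section Model

variable {E : Type} [NormedAddCommGroup E] [InnerProductSpace ℝ E] [FiniteDimensional ℝ E]
  {Q : Type*} [TopologicalSpace Q] [ChartedSpace E Q] [IsManifold 𝓘(ℝ, E) ∞ Q]
  {F : Type} [NormedAddCommGroup F] [InnerProductSpace ℝ F] [FiniteDimensional ℝ F]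
  {M : Type*} [TopologicalSpace M] [ChartedSpace F M] [IsManifold 𝓘(ℝ, F) ∞ M]

/-- A symplectic embedding of an open set of `E × E` in `M`, such that exactly the points of
`E × 0` are mapped to the image of `j`. -/
structure IsRelativeModel (Ω : Form 𝓘(ℝ, F) M 2) (j : Q → M) (B : Set (E × E)) (G : E × E → M) :
    Prop where
  isOpen : IsOpen B
  zero_mem : ∀ z ∈ B, (z.1, (0 : E)) ∈ B
  smooth : ∀ z ∈ B, ContMDiffAt 𝓘(ℝ, E × E) 𝓘(ℝ, F) ∞ G z
  symplectic : ∀ z ∈ B, ∀ u v : E × E,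
    Ω (G z) ![mfderiv 𝓘(ℝ, E × E) 𝓘(ℝ, F) G z u, mfderiv 𝓘(ℝ, E × E) 𝓘(ℝ, F) G z v] = stdBil E u v
  injOn : InjOn G B
  relative : ∀ z ∈ B, G z ∈ range j ↔ z.2 = 0

variable {Ω : Form 𝓘(ℝ, F) M 2} {j : Q → M} {B : Set (E × E)} {G : E × E → M}

lemma IsRelativeModel.injective_mfderiv (h : IsRelativeModel Ω j B G) {z : E × E} (hz : z ∈ B) :
    Function.Injective (mfderiv 𝓘(ℝ, E × E) 𝓘(ℝ, F) G z) := by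
  refine (injective_iff_map_eq_zero _).2 fun u hu => ?_
  refine stdBil_nondegenerate u (ContinuousLinearMap.ext fun v => ?_)
  exact (h.symplectic z hz u v).symm.trans ((Ω (G z)).map_coord_zero (0 : Fin 2) hu)

/-- The restriction of a relative model to `E × 0`, as a map to `Q`. -/
lemma IsRelativeModel.exists_base (h : IsRelativeModel Ω j B G) [Nonempty Q]
    (hj : IsSmoothEmbedding 𝓘(ℝ, E) 𝓘(ℝ, F) ∞ j) :
    ∃ φ : E → Q, ∀ x, (x, (0 : E)) ∈ B → j (φ x) = G (x, 0) ∧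
      ContMDiffAt 𝓘(ℝ, E) 𝓘(ℝ, E) ∞ φ x ∧ (mfderiv 𝓘(ℝ, E) 𝓘(ℝ, E) φ x).IsInvertible := by
  set φ : E → Q := fun x => Function.invFun j (G (x, 0)) with hφ
  have h1 : ∀ x, (x, (0 : E)) ∈ B → j (φ x) = G (x, 0) := fun x hx =>
    Function.invFun_eq ((h.relative _ hx).2 rfl)
  have hc : Continuous fun x : E => (x, (0 : E)) := by fun_prop
  have hsm : ∀ x, (x, (0 : E)) ∈ B → ContMDiffAt 𝓘(ℝ, E) 𝓘(ℝ, F) ∞ (fun x => G (x, 0)) x :=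
    fun x hx => (h.smooth _ hx).comp x (by
      refine ContDiffAt.contMDiffAt ?_
      exact contDiffAt_id.prodMk contDiffAt_const)
  have hev : ∀ x, (x, (0 : E)) ∈ B → j ∘ φ =ᶠ[𝓝 x] fun x => G (x, 0) := by
    intro x hx
    filter_upwards [hc.continuousAt.eventually (h.isOpen.mem_nhds hx)] with x' hx'
    exact h1 x' hx'
  have h2 : ∀ x, (x, (0 : E)) ∈ B → ContMDiffAt 𝓘(ℝ, E) 𝓘(ℝ, E) ∞ φ x := by
    intro x hx
    have h3 : ContMDiffAt 𝓘(ℝ, E) 𝓘(ℝ, F) ∞ (j ∘ φ) x := (hsm x hx).congr_of_eventuallyEq (hev x hx)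
    have h4 : ContinuousAt φ x :=
      hj.isEmbedding.isInducing.continuousAt_iff.2 h3.continuousAt
    -- A continuous map into `Q` is smooth once its composite with the immersion `j` is; continuity
    -- holds because `j` is a topological embedding.
    exact (ContMDiffAt.iff_comp_isImmersionAt (hj.isImmersion.isImmersionAt _)).2 ⟨h4, h3⟩
  refine ⟨φ, fun x hx => ⟨h1 x hx, h2 x hx, ?_⟩⟩
  refine isInvertible_of_injective (V := E) (W := E) rfl ?_
  refine (injective_iff_map_eq_zero _).2 fun u hu => ?_
  have hjs : ContMDiff 𝓘(ℝ, E) 𝓘(ℝ, F) ∞ j := hj.contMDiff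
  have e1 := mfderiv_comp x ((hjs (φ x)).mdifferentiableAt (by simp))
    ((h2 x hx).mdifferentiableAt (by simp))
  have e2 := mfderiv_comp (f := fun x : E => (x, (0 : E))) (I' := 𝓘(ℝ, E × E)) x
    ((h.smooth _ hx).mdifferentiableAt (by simp))
    (by
      refine DifferentiableAt.mdifferentiableAt ?_
      fun_prop)
  have e3 : mfderiv 𝓘(ℝ, E) 𝓘(ℝ, E × E) (fun x : E => (x, (0 : E))) x =
      ContinuousLinearMap.inl ℝ E E := by
    rw [mfderiv_eq_fderiv]
    exact ((ContinuousLinearMap.inl ℝ E E).hasFDerivAt (x := x)).fderiv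
  have e4 := (hev x hx).mfderiv_eq (I := 𝓘(ℝ, E)) (I' := 𝓘(ℝ, F))
  rw [e3] at e2
  have e5 := congrArg (fun A : E →L[ℝ] F => A u) (e1.symm.trans (e4.trans e2))
  let T : E →L[ℝ] F := mfderiv 𝓘(ℝ, E) 𝓘(ℝ, F) j (φ x)
  have e6 : mfderiv 𝓘(ℝ, E × E) 𝓘(ℝ, F) G (x, 0) (u, 0) = 0 :=
    e5.symm.trans ((congrArg T hu).trans (ContinuousLinearMap.map_zero T))
  have e7 := (injective_iff_map_eq_zero _).1 (h.injective_mfderiv hx) _ e6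
  exact congrArg Prod.fst e7

variable {φ : E → Q}

/-- Both `G` and the cotangent lift pull their symplectic forms back to `stdBil`, so `G` after the
inverse lift matches the two forms. -/
lemma IsRelativeModel.isWeinsteinAt_comp (h : IsRelativeModel Ω j B G)
    (hφ : ∀ x, (x, (0 : E)) ∈ B → ContMDiffAt 𝓘(ℝ, E) 𝓘(ℝ, E) ∞ φ x ∧
      (mfderiv 𝓘(ℝ, E) 𝓘(ℝ, E) φ x).IsInvertible)
    {Φ : OpenPartialHomeomorph (E × E) (CotangentBundle 𝓘(ℝ, E) Q)}
    (hs : Φ.source = B) (hΦ : ⇑Φ = cotangentLift φ)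
    (hsymm : ∀ a ∈ Φ.target,
      ContMDiffAt (𝓘(ℝ, E).prod 𝓘(ℝ, E →L[ℝ] ℝ)) 𝓘(ℝ, E × E) ∞ Φ.symm a) {z : E × E} (hz : z ∈ B) :
    IsWeinsteinAt Ω (G ∘ Φ.symm) (cotangentLift φ z) := by
  have hzs : z ∈ Φ.source := hs.symm ▸ hz
  have ht : cotangentLift φ z ∈ Φ.target := by
    rw [← hΦ]; exact Φ.map_source hzs
  have hinv : Φ.symm (cotangentLift φ z) = z := by
    rw [← hΦ]; exact Φ.left_inv hzs
  have hc : Continuous fun x : E => (x, (0 : E)) := by fun_prop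
  have hφ' : ∀ᶠ x in 𝓝 z.1, ContMDiffAt 𝓘(ℝ, E) 𝓘(ℝ, E) ∞ φ x ∧
      (mfderiv 𝓘(ℝ, E) 𝓘(ℝ, E) φ x).IsInvertible := by
    filter_upwards [hc.continuousAt.eventually (h.isOpen.mem_nhds (h.zero_mem z hz))] with x hx
    exact hφ x hx
  have h1 := hsymm _ ht
  have h2 : ContMDiffAt 𝓘(ℝ, E × E) 𝓘(ℝ, F) ∞ G (Φ.symm (cotangentLift φ z)) := by
    rw [hinv]; exact h.smooth z hz
  refine ⟨h2.comp _ h1, fun ξ η => ?_⟩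
  have h3 := mfderiv_comp _ (h2.mdifferentiableAt (by simp)) (h1.mdifferentiableAt (by simp))
  have h4 := h.symplectic (Φ.symm (cotangentLift φ z)) (by rw [hinv]; exact hz)
    (mfderiv (𝓘(ℝ, E).prod 𝓘(ℝ, E →L[ℝ] ℝ)) 𝓘(ℝ, E × E) Φ.symm (cotangentLift φ z) ξ)
    (mfderiv (𝓘(ℝ, E).prod 𝓘(ℝ, E →L[ℝ] ℝ)) 𝓘(ℝ, E × E) Φ.symm (cotangentLift φ z) η)
  have h5 := d_canonicalForm_cotangentLift hφ'
    (mfderiv (𝓘(ℝ, E).prod 𝓘(ℝ, E →L[ℝ] ℝ)) 𝓘(ℝ, E × E) Φ.symm (cotangentLift φ z) ξ)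
    (mfderiv (𝓘(ℝ, E).prod 𝓘(ℝ, E →L[ℝ] ℝ)) 𝓘(ℝ, E × E) Φ.symm (cotangentLift φ z) η)
  have h6 : ∀ ζ : TangentSpace (𝓘(ℝ, E).prod 𝓘(ℝ, E →L[ℝ] ℝ)) (cotangentLift φ z),
      mfderiv 𝓘(ℝ, E × E) (𝓘(ℝ, E).prod 𝓘(ℝ, E →L[ℝ] ℝ)) (cotangentLift φ) z
        (mfderiv (𝓘(ℝ, E).prod 𝓘(ℝ, E →L[ℝ] ℝ)) 𝓘(ℝ, E × E) Φ.symm (cotangentLift φ z) ζ) = ζ := by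
    intro ζ
    have e1 : MDifferentiableAt 𝓘(ℝ, E × E) (𝓘(ℝ, E).prod 𝓘(ℝ, E →L[ℝ] ℝ)) (cotangentLift φ)
        (Φ.symm (cotangentLift φ z)) := by
      rw [hinv]
      exact (contMDiffAt_cotangentLift hφ'.self_of_nhds.1 hφ').mdifferentiableAt (by simp)
    have e2 := mfderiv_comp _ e1 (h1.mdifferentiableAt (by simp))
    have e3 : cotangentLift φ ∘ Φ.symm =ᶠ[𝓝 (cotangentLift φ z)] id := by
      filter_upwards [Φ.open_target.mem_nhds ht] with a ha
      rw [Function.comp_apply, ← hΦ]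
      exact Φ.right_inv ha
    rw [e3.mfderiv_eq, mfderiv_id, hinv] at e2
    exact congrArg (fun A : E × (E →L[ℝ] ℝ) →L[ℝ] E × (E →L[ℝ] ℝ) => A ζ) e2.symm
  rw [h6, h6] at h5
  rw [h5, ← h4, h3]
  rfl

lemma IsRelativeModel.isWeinsteinGerm_comp (h : IsRelativeModel Ω j B G)
    (hφ : ∀ x, (x, (0 : E)) ∈ B → j (φ x) = G (x, 0) ∧ ContMDiffAt 𝓘(ℝ, E) 𝓘(ℝ, E) ∞ φ x ∧
      (mfderiv 𝓘(ℝ, E) 𝓘(ℝ, E) φ x).IsInvertible)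
    {Φ : OpenPartialHomeomorph (E × E) (CotangentBundle 𝓘(ℝ, E) Q)}
    (hs : Φ.source = B) (hΦ : ⇑Φ = cotangentLift φ)
    (hsymm : ∀ a ∈ Φ.target,
      ContMDiffAt (𝓘(ℝ, E).prod 𝓘(ℝ, E →L[ℝ] ℝ)) 𝓘(ℝ, E × E) ∞ Φ.symm a)
    {x : E} (hx : (x, (0 : E)) ∈ B) :
    IsWeinsteinGerm Ω j (G ∘ Φ.symm) (φ x) := by
  have ht : ∀ᶠ a in 𝓝 (zeroCovector 𝓘(ℝ, E) Q (φ x)), a ∈ Φ.target := by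
    refine Φ.open_target.mem_nhds ?_
    rw [← cotangentLift_zero, ← hΦ]
    exact Φ.map_source (hs.symm ▸ hx)
  have hinv : ∀ a ∈ Φ.target, cotangentLift φ (Φ.symm a) = a := fun a ha => by
    rw [← hΦ]; exact Φ.right_inv ha
  refine ⟨?_, ?_⟩
  · filter_upwards [ht] with a ha
    rw [← hinv a ha]
    exact h.isWeinsteinAt_comp (fun x hx => (hφ x hx).2) hs hΦ hsymm (hs ▸ Φ.map_target ha)
  · filter_upwards [(tendsto_zeroCovector (φ x)).eventually ht] with q hq
    set z := Φ.symm (zeroCovector 𝓘(ℝ, E) Q q) with hz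
    have hzs : z ∈ Φ.source := Φ.map_target hq
    have h0 : (z.1, (0 : E)) ∈ B := h.zero_mem z (hs ▸ hzs)
    have h1 : φ z.1 = q := congrArg (fun a => a.1) (hinv _ hq)
    -- The preimage `z` of a zero covector could a priori have a fibre part; but `(z.1, 0)` also
    -- lies in `B` and has the same lift, so injectivity identifies them.
    have h2 : z = (z.1, 0) := by
      refine Φ.injOn hzs (hs.symm ▸ h0) ?_
      rw [hΦ, cotangentLift_zero, h1]
      exact hinv _ hq
    rw [Function.comp_apply, ← hz, h2, ← (hφ z.1 h0).1, h1]

end Model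

section Immersion

variable {E : Type*} [NormedAddCommGroup E] [NormedSpace ℝ E]
  {Q : Type*} [TopologicalSpace Q] [ChartedSpace E Q] [IsManifold 𝓘(ℝ, E) ∞ Q]
  {F : Type*} [NormedAddCommGroup F] [NormedSpace ℝ F]
  {M : Type*} [TopologicalSpace M] [ChartedSpace F M] [IsManifold 𝓘(ℝ, F) ∞ M]

/-- The normal form of an immersion supplies a smooth local left inverse: project the target chart
to its first factor and return through the source chart. -/
lemma injective_mfderiv_of_isImmersionAt {j : Q → M} {q : Q}
    (h : IsImmersionAt 𝓘(ℝ, E) 𝓘(ℝ, F) ∞ j q) :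
    Function.Injective (mfderiv 𝓘(ℝ, E) 𝓘(ℝ, F) j q) := by
  set c := h.domChart.extend 𝓘(ℝ, E) with hc
  set d := h.codChart.extend 𝓘(ℝ, F) with hd
  have hqs : q ∈ c.source := by
    rw [hc, OpenPartialHomeomorph.extend_source]; exact h.mem_domChart_source
  have key : ∀ q' ∈ c.source, (h.equiv.symm (d (j q'))).1 = c q' := by
    intro q' hq'
    have h1 := h.writtenInCharts (c.map_source hq')
    simp only [Function.comp_apply] at h1
    rw [← hc, ← hd, c.left_inv hq'] at h1
    rw [h1, ContinuousLinearEquiv.symm_apply_apply]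
  have h1 : ContMDiffAt 𝓘(ℝ, F) 𝓘(ℝ, F) ∞ d (j q) :=
    h.codChart.contMDiffAt_extend h.codChart_mem_maximalAtlas h.mem_codChart_source
  have h2 : ContMDiffAt 𝓘(ℝ, E) 𝓘(ℝ, E) ∞ c.symm (c q) := by
    refine (contMDiffOn_extend_symm h.domChart_mem_maximalAtlas).contMDiffAt ?_
    simpa [hc] using h.domChart.open_target.mem_nhds (h.domChart.map_source h.mem_domChart_source)
  have h3 : ContMDiffAt 𝓘(ℝ, F) 𝓘(ℝ, E) ∞ (fun m => c.symm (h.equiv.symm (d m)).1) (j q) := by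
    have h4 : ContDiffAt ℝ ∞ (fun y => (h.equiv.symm y).1) (d (j q)) :=
      contDiffAt_fst.comp _ h.equiv.symm.contDiff.contDiffAt
    have h5 : ContMDiffAt 𝓘(ℝ, E) 𝓘(ℝ, E) ∞ c.symm ((h.equiv.symm (d (j q))).1) := by
      rw [key q hqs]; exact h2
    exact h5.comp (j q) (h4.contMDiffAt.comp (j q) h1)
  have h4 := mfderiv_comp q (h3.mdifferentiableAt (by simp))
    (h.contMDiffAt.mdifferentiableAt (by simp))
  have h5 : (fun m => c.symm (h.equiv.symm (d m)).1) ∘ j =ᶠ[𝓝 q] id := by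
    have hn : c.source ∈ 𝓝 q := by
      rw [hc, OpenPartialHomeomorph.extend_source]
      exact h.domChart.open_source.mem_nhds h.mem_domChart_source
    filter_upwards [hn] with q' hq'
    simp only [Function.comp_apply, key q' hq', c.left_inv hq', id]
  rw [h5.mfderiv_eq, mfderiv_id] at h4
  let T : F →L[ℝ] E := mfderiv 𝓘(ℝ, F) 𝓘(ℝ, E) (fun m => c.symm (h.equiv.symm (d m)).1) (j q)
  have h6 : ∀ u : E, T (mfderiv 𝓘(ℝ, E) 𝓘(ℝ, F) j q u) = u := fun u =>
    congrArg (fun A : E →L[ℝ] E => A u) h4.symm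
  exact Function.LeftInverse.injective h6

end Immersion

/-! ### Extension of a relative model to a Weinstein neighborhood -/

section Extension

variable {E : Type} [NormedAddCommGroup E] [InnerProductSpace ℝ E] [FiniteDimensional ℝ E]
  {Q : Type*} [TopologicalSpace Q] [CompactSpace Q] [ChartedSpace E Q] [IsManifold 𝓘(ℝ, E) ∞ Q]
  {F : Type} [NormedAddCommGroup F] [InnerProductSpace ℝ F] [FiniteDimensional ℝ F]
  {M : Type*} [TopologicalSpace M] [T2Space M] [ChartedSpace F M] [IsManifold 𝓘(ℝ, F) ∞ M]
  {Ω : Form 𝓘(ℝ, F) M 2} {j : Q → M} {B : Set (E × E)} {G : E × E → M}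

/-- A symplectic map near the zero section which, on the cotangent lift of a compact part `K` of a
relative model, restricts to the given map of the model. -/
lemma IsRelativeModel.exists_extension (h : IsRelativeModel Ω j B G)
    (hd : Module.finrank ℝ F = 2 * Module.finrank ℝ E) [Nonempty Q]
    (hΩ : IsSymplectic 𝓘(ℝ, F) Ω) (hj : IsSmoothEmbedding 𝓘(ℝ, E) 𝓘(ℝ, F) ∞ j)
    (hiso : ∀ (q : Q) (u v : TangentSpace 𝓘(ℝ, E) q),
      Ω (j q) ![mfderiv 𝓘(ℝ, E) 𝓘(ℝ, F) j q u, mfderiv 𝓘(ℝ, E) 𝓘(ℝ, F) j q v] = 0)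
    {K V D : Set (E × E)} (hK : IsCompact K) (hKV : K ⊆ V) (hV : IsOpen V) (hVD : V ⊆ D)
    (hD : IsCompact D) (hDB : D ⊆ B) :
    ∃ Φ : OpenPartialHomeomorph (CotangentBundle 𝓘(ℝ, E) Q) M,
      (∀ q, zeroCovector 𝓘(ℝ, E) Q q ∈ Φ.source ∧ Φ (zeroCovector 𝓘(ℝ, E) Q q) = j q) ∧
      (∀ a ∈ Φ.source, IsWeinsteinAt Ω Φ a) ∧
      (∀ y ∈ Φ.target, ContMDiffAt 𝓘(ℝ, F) (𝓘(ℝ, E).prod 𝓘(ℝ, E →L[ℝ] ℝ)) ∞ Φ.symm y) ∧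
      G '' K ⊆ Φ.target := by
  classical
  have hcE := FiniteDimensional.complete ℝ E
  have hcF := FiniteDimensional.complete ℝ F
  have hT2 : T2Space Q := hj.isEmbedding.t2Space
  obtain ⟨φ, hφ⟩ := h.exists_base hj
  have hc : Continuous fun x : E => (x, (0 : E)) := by fun_prop
  have hφ' : ∀ z ∈ B, ∀ᶠ x in 𝓝 z.1, ContMDiffAt 𝓘(ℝ, E) 𝓘(ℝ, E) ∞ φ x ∧
      (mfderiv 𝓘(ℝ, E) 𝓘(ℝ, E) φ x).IsInvertible := by
    intro z hz
    filter_upwards [hc.continuousAt.eventually (h.isOpen.mem_nhds (h.zero_mem z hz))] with x hx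
    exact (hφ x hx).2
  have hφi : InjOn φ {x | (x, (0 : E)) ∈ B} := by
    intro x hx x' hx' hxx
    have := h.injOn hx hx' (by rw [← (hφ x hx).1, ← (hφ x' hx').1, hxx])
    exact congrArg Prod.fst this
  have hΘi : InjOn (cotangentLift φ) B :=
    (injOn_cotangentLift hφi fun x hx => (hφ x hx).2).mono fun z hz => h.zero_mem z hz
  have hΘs : ∀ z ∈ B, ContMDiffAt 𝓘(ℝ, E × E) (𝓘(ℝ, E).prod 𝓘(ℝ, E →L[ℝ] ℝ)) ∞
      (cotangentLift φ) z := fun z hz =>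
    contMDiffAt_cotangentLift (hφ' z hz).self_of_nhds.1 (hφ' z hz)
  obtain ⟨Θ, hΘ1, hΘ2, hΘ3, hΘ4⟩ := exists_openPartialHomeomorph h.isOpen hΘs
    (fun z hz => hasLocalInverseAt_cotangentLift (hφ' z hz)) hΘi
  have hinv : ∀ z ∈ B, Θ.symm (cotangentLift φ z) = z := fun z hz => by
    rw [← hΘ2]; exact Θ.left_inv (hΘ1.symm ▸ hz)
  -- The germ is prescribed over the base of the compact set `D`, so that `V`, where the map below
  -- switches to `G ∘ Θ.symm`, lies over a closed set along which the germs agree.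
  have hDc : IsClosed (φ '' (Prod.fst '' D)) := by
    refine IsCompact.isClosed ((hD.image continuous_fst).image_of_continuousOn ?_)
    rintro _ ⟨z, hz, rfl⟩
    exact (hφ' z (hDB hz)).self_of_nhds.1.continuousAt.continuousWithinAt
  have hgerm : ∀ q ∈ φ '' (Prod.fst '' D), IsWeinsteinGerm Ω j (G ∘ Θ.symm) q := by
    rintro _ ⟨_, ⟨z, hz, rfl⟩, rfl⟩
    exact h.isWeinsteinGerm_comp hφ hΘ1 hΘ2 hΘ4 (h.zero_mem z (hDB hz))
  obtain ⟨Ψ', hΨ1, hΨ2⟩ := exists_isWeinsteinGerm hΩ hj.contMDiff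
    (fun q => injective_mfderiv_of_isImmersionAt (hj.isImmersion.isImmersionAt q)) hiso hDc hgerm
  have hVo : IsOpen (cotangentLift φ '' V) := by
    rw [← hΘ2]
    exact Θ.isOpen_image_of_subset_source hV (by rw [hΘ1]; exact hVD.trans hDB)
  -- Over the lift of `V` the model itself is used, not just its germ along the zero section, so
  -- that all of `G '' K` is reached. The map may jump at the boundary of this region, but only its
  -- behaviour near the compact set `A` below matters.
  set Ψ : CotangentBundle 𝓘(ℝ, E) Q → M :=
    fun a => if a ∈ cotangentLift φ '' V then G (Θ.symm a) else Ψ' a with hΨ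
  have hΨz : ∀ q, Ψ =ᶠ[𝓝 (zeroCovector 𝓘(ℝ, E) Q q)] Ψ' := by
    intro q
    by_cases hq : q ∈ φ '' (Prod.fst '' D)
    · filter_upwards [hΨ1 q hq] with a ha
      simp only [hΨ]
      split_ifs
      · exact ha.symm
      · rfl
    · filter_upwards [(tendsto_proj (zeroCovector 𝓘(ℝ, E) Q q)).eventually
        (hDc.isOpen_compl.mem_nhds hq)] with a ha
      refine if_neg ?_
      rintro ⟨z, hz, rfl⟩
      exact ha ⟨_, ⟨z, hVD hz, rfl⟩, rfl⟩
  have hΨK : ∀ z ∈ V, Ψ =ᶠ[𝓝 (cotangentLift φ z)] G ∘ Θ.symm := by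
    intro z hz
    filter_upwards [hVo.mem_nhds (mem_image_of_mem _ hz)] with a ha
    exact if_pos ha
  have hΨKz : ∀ z ∈ V, Ψ (cotangentLift φ z) = G z := fun z hz => by
    rw [(hΨK z hz).self_of_nhds, Function.comp_apply, hinv z (hDB (hVD hz))]
  have hΨzq : ∀ q, Ψ (zeroCovector 𝓘(ℝ, E) Q q) = j q := fun q => by
    rw [(hΨz q).self_of_nhds, (hΨ2 q).2.self_of_nhds]
  set A : Set (CotangentBundle 𝓘(ℝ, E) Q) :=
    range (zeroCovector 𝓘(ℝ, E) Q) ∪ cotangentLift φ '' K with hA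
  have hAc : IsCompact A := by
    refine (isCompact_range ?_).union (hK.image_of_continuousOn fun z hz =>
      (hΘs z (hDB (hVD (hKV hz)))).continuousAt.continuousWithinAt)
    exact continuous_iff_continuousAt.2 fun q => tendsto_zeroCovector q
  have hAw : ∀ a ∈ A, ∀ᶠ b in 𝓝 a, IsWeinsteinAt Ω Ψ b := by
    rintro _ (⟨q, rfl⟩ | ⟨z, hz, rfl⟩)
    · filter_upwards [(hΨ2 q).1, (hΨz q).eventuallyEq_nhds] with a h1 h2 using h1.congr h2
    · filter_upwards [hVo.mem_nhds (mem_image_of_mem _ (hKV hz)),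
        (hΨK z (hKV hz)).eventuallyEq_nhds] with a h1 h2
      obtain ⟨y, hy, rfl⟩ := h1
      exact (h.isWeinsteinAt_comp (fun x hx => (hφ x hx).2) hΘ1 hΘ2 hΘ4 (hDB (hVD hy))).congr h2
  have hloc : ∀ a, (∀ᶠ b in 𝓝 a, IsWeinsteinAt Ω Ψ b) →
      HasLocalInverseAt (𝓘(ℝ, E).prod 𝓘(ℝ, E →L[ℝ] ℝ)) 𝓘(ℝ, F) Ψ a := fun a ha =>
    hasLocalInverseAt_of_isInvertible (ha.mono fun b hb => hb.1)
      (ha.self_of_nhds.isInvertible hd)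
  -- The relative condition enters here: a point of `K` sent into the image of `j` has zero fibre
  -- part, so its lift is itself a zero covector.
  have hcross : ∀ q, ∀ z ∈ K, Ψ (zeroCovector 𝓘(ℝ, E) Q q) = Ψ (cotangentLift φ z) →
      zeroCovector 𝓘(ℝ, E) Q q = cotangentLift φ z := by
    intro q z hz hqz
    have hzB := hDB (hVD (hKV hz))
    rw [hΨzq, hΨKz z (hKV hz)] at hqz
    have h0 : z.2 = 0 := (h.relative z hzB).1 ⟨q, hqz⟩
    have h1 : z = (z.1, 0) := Prod.ext rfl h0
    rw [h1, cotangentLift_zero]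
    rw [h1, ← (hφ z.1 (h.zero_mem z hzB)).1] at hqz
    rw [hj.isEmbedding.injective hqz]
  have hAi : InjOn Ψ A := by
    rintro _ (⟨q, rfl⟩ | ⟨z, hz, rfl⟩) _ (⟨q', rfl⟩ | ⟨z', hz', rfl⟩) hab
    · rw [hΨzq, hΨzq] at hab
      rw [hj.isEmbedding.injective hab]
    · exact hcross q z' hz' hab
    · exact (hcross q' z hz hab.symm).symm
    · rw [hΨKz z (hKV hz), hΨKz z' (hKV hz')] at hab
      rw [h.injOn (hDB (hVD (hKV hz))) (hDB (hVD (hKV hz'))) hab]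
  -- As `M` is Hausdorff, injectivity on the compact set `A` and local injectivity at its points
  -- give injectivity on a neighborhood.
  obtain ⟨t, ht1, ht2⟩ := hAi.exists_mem_nhdsSet hAc
    (fun a ha => (hAw a ha).self_of_nhds.1.continuousAt)
    (fun a ha => (hloc a (hAw a ha)).exists_injOn)
  obtain ⟨W, hW1, hW2, hW3⟩ := mem_nhdsSet_iff_exists.1 ht1
  have hne : Nonempty (CotangentBundle 𝓘(ℝ, E) Q) :=
    ⟨zeroCovector 𝓘(ℝ, E) Q (Classical.arbitrary Q)⟩
  obtain ⟨Φ, hΦ1, hΦ2, hΦ3, hΦ4⟩ := exists_openPartialHomeomorph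
    (I' := 𝓘(ℝ, E).prod 𝓘(ℝ, E →L[ℝ] ℝ)) (I := 𝓘(ℝ, F)) (f := Ψ)
    (W := W ∩ {a | ∀ᶠ b in 𝓝 a, IsWeinsteinAt Ω Ψ b})
    (hW1.inter isOpen_setOfPred_eventually_nhds) (fun a ha => ha.2.self_of_nhds.1)
    (fun a ha => hloc a ha.2) (ht2.mono (inter_subset_left.trans hW3))
  refine ⟨Φ, fun q => ⟨?_, ?_⟩, fun a ha => ?_, hΦ4, ?_⟩
  · rw [hΦ1]
    exact ⟨hW2 (Or.inl ⟨q, rfl⟩), hAw _ (Or.inl ⟨q, rfl⟩)⟩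
  · rw [hΦ2, hΨzq]
  · rw [hΦ1] at ha
    rw [hΦ2]
    exact ha.2.self_of_nhds
  · rintro _ ⟨z, hz, rfl⟩
    rw [hΦ3, ← hΨKz z (hKV hz)]
    exact mem_image_of_mem _ ⟨hW2 (Or.inr ⟨z, hz, rfl⟩), hAw _ (Or.inr ⟨z, hz, rfl⟩)⟩

end Extension

/-! ### Balls of given capacity -/

section Ball

variable {n : ℕ}

/-- The linear symplectomorphism `(x, y) ↦ x - i y`. -/
def toCn (n : ℕ) : (EuclideanSpace ℝ (Fin n) × EuclideanSpace ℝ (Fin n)) ≃L[ℝ] Cn n :=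
  LinearEquiv.toContinuousLinearEquiv
    { toFun := fun z => WithLp.toLp 2 fun i => (⟨z.1 i, -z.2 i⟩ : ℂ)
      invFun := fun z => (WithLp.toLp 2 fun i => (z i).re, WithLp.toLp 2 fun i => -(z i).im)
      map_add' := fun x y => by
        ext i
        apply Complex.ext <;> simp [add_comm]
      map_smul' := fun c x => by
        ext i
        apply Complex.ext <;> simp
      left_inv := fun x => by
        refine Prod.ext ?_ ?_ <;> ext i <;> simp
      right_inv := fun z => by
        ext i
        apply Complex.ext <;> simp }

lemma toCn_apply (z : EuclideanSpace ℝ (Fin n) × EuclideanSpace ℝ (Fin n)) (i : Fin n) :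
    toCn n z i = ⟨z.1 i, -z.2 i⟩ := rfl

lemma norm_toCn_sq (z : EuclideanSpace ℝ (Fin n) × EuclideanSpace ℝ (Fin n)) :
    ‖toCn n z‖ ^ 2 = ‖z.1‖ ^ 2 + ‖z.2‖ ^ 2 := by
  rw [EuclideanSpace.norm_sq_eq, EuclideanSpace.norm_sq_eq, EuclideanSpace.norm_sq_eq,
    ← Finset.sum_add_distrib]
  refine Finset.sum_congr rfl fun i _ => ?_
  rw [toCn_apply, ← Complex.normSq_eq_norm_sq, Complex.normSq_mk, Real.norm_eq_abs,
    Real.norm_eq_abs, sq_abs, sq_abs]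
  ring

/-- The conjugation in `toCn` turns the `dy ∧ dx` of `stdBil` into `dx ∧ dy`; it preserves norms and
the real part. -/
lemma stdForm_toCn (u v : EuclideanSpace ℝ (Fin n) × EuclideanSpace ℝ (Fin n)) :
    stdForm (toCn n u) (toCn n v) = stdBil (EuclideanSpace ℝ (Fin n)) u v := by
  rw [stdBil_apply, PiLp.inner_apply, PiLp.inner_apply, ← Finset.sum_sub_distrib, stdForm]
  refine Finset.sum_congr rfl fun i _ => ?_
  simp only [toCn_apply, Real.inner_apply]
  ring

lemma toCn_mem_realPart (z : EuclideanSpace ℝ (Fin n) × EuclideanSpace ℝ (Fin n)) :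
    toCn n z ∈ realPart n ↔ z.2 = 0 := by
  constructor
  · intro h
    ext i
    have := h i
    rw [toCn_apply] at this
    simpa using this
  · intro h i
    rw [toCn_apply, h]
    simp

lemma isCompact_capBall (n : ℕ) (R : ℝ) : IsCompact (capBall n R) := by
  refine Metric.isCompact_of_isClosed_isBounded
    (isClosed_le (by fun_prop) continuous_const) ?_
  refine (Metric.isBounded_closedBall (x := (0 : Cn n)) (r := √(R / Real.pi))).subset ?_
  intro z hz
  rw [mem_closedBall_zero_iff]
  refine Real.le_sqrt_of_sq_le ?_
  rw [le_div_iff₀ Real.pi_pos, mul_comm]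
  exact hz

lemma isOpen_openCapBall (n : ℕ) (R : ℝ) : IsOpen {z : Cn n | Real.pi * ‖z‖ ^ 2 < R} :=
  isOpen_lt (by fun_prop) continuous_const

lemma capBall_mono {R R' : ℝ} (h : R' ≤ R) : capBall n R' ⊆ capBall n R := fun _ hz => le_trans hz h

lemma capBall_subset_open {R R' : ℝ} (h : R' < R) :
    capBall n R' ⊆ {z : Cn n | Real.pi * ‖z‖ ^ 2 < R} := fun _ hz => lt_of_le_of_lt hz h

lemma openCapBall_subset (R : ℝ) : {z : Cn n | Real.pi * ‖z‖ ^ 2 < R} ⊆ capBall n R :=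
  fun z (hz : Real.pi * ‖z‖ ^ 2 < R) => hz.le

/-- A convex set with nonempty interior. This makes derivatives within the ball well determined on
its boundary sphere too. -/
lemma uniqueDiffOn_capBall {R : ℝ} (hR : 0 < R) : UniqueDiffOn ℝ (capBall n R) := by
  refine uniqueDiffOn_convex ?_ ?_
  · have h : ConvexOn ℝ univ fun z : Cn n => Real.pi * ‖z‖ ^ 2 :=
      ((convexOn_norm convex_univ).pow (fun z _ => norm_nonneg z) 2).smul Real.pi_pos.le
    simpa [capBall] using h.convex_le R
  · refine ⟨0, mem_interior.2 ⟨_, openCapBall_subset R, isOpen_openCapBall n R, ?_⟩⟩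
    simpa using hR

variable {M : Type*} [TopologicalSpace M] [ChartedSpace (EuclideanSpace ℝ (Fin (2 * n))) M]
  {Ω : Form 𝓘(ℝ, EuclideanSpace ℝ (Fin (2 * n))) M 2} {S U N : Set M} {R R' : ℝ} {ι : Cn n → M}

lemma width_mono (h : U ⊆ N) : width Ω S U ≤ width Ω S N :=
  biSup_mono fun _ hR => ⟨hR.1, hR.2.imp fun _ hι =>
    ⟨hι.mapsTo.mono_right h, hι.smooth, hι.injOn, hι.symplectic, hι.relative⟩⟩

lemma IsRelativeBallEmbedding.contMDiffAt (h : IsRelativeBallEmbedding Ω S U R ι) {z : Cn n}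
    (hz : Real.pi * ‖z‖ ^ 2 < R) :
    ContMDiffAt 𝓘(ℝ, Cn n) 𝓘(ℝ, EuclideanSpace ℝ (Fin (2 * n))) ∞ ι z :=
  h.smooth.contMDiffAt (mem_of_superset ((isOpen_openCapBall n R).mem_nhds hz)
    (openCapBall_subset R))

lemma mfderivWithin_capBall
    {z : Cn n} (hz : Real.pi * ‖z‖ ^ 2 < R) :
    mfderivWithin 𝓘(ℝ, Cn n) 𝓘(ℝ, EuclideanSpace ℝ (Fin (2 * n))) ι (capBall n R) z =
      mfderiv 𝓘(ℝ, Cn n) 𝓘(ℝ, EuclideanSpace ℝ (Fin (2 * n))) ι z :=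
  mfderivWithin_of_mem_nhds (mem_of_superset ((isOpen_openCapBall n R).mem_nhds hz)
    (openCapBall_subset R))

/-- Points of the smaller closed ball are interior to the larger one, where the derivative within
either ball is the ordinary derivative. -/
lemma IsRelativeBallEmbedding.restrict (h : IsRelativeBallEmbedding Ω S U R ι) (hR' : 0 < R')
    (hlt : R' < R) (hN : MapsTo ι (capBall n R') N) : IsRelativeBallEmbedding Ω S N R' ι where
  mapsTo := hN
  smooth := h.smooth.mono (capBall_mono hlt.le)
  injOn := h.injOn.mono (capBall_mono hlt.le)
  symplectic := fun z hz u v => by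
    have hz' := capBall_subset_open hlt hz
    have e : mfderivWithin 𝓘(ℝ, Cn n) 𝓘(ℝ, EuclideanSpace ℝ (Fin (2 * n))) ι (capBall n R') z =
        mfderivWithin 𝓘(ℝ, Cn n) 𝓘(ℝ, EuclideanSpace ℝ (Fin (2 * n))) ι (capBall n R) z := by
      rw [mfderivWithin_capBall hz']
      exact mfderivWithin_eq_mfderiv (uniqueDiffOn_capBall hR' z hz).uniqueMDiffWithinAt
        ((h.contMDiffAt hz').mdifferentiableAt (by simp))
    rw [e]
    exact h.symplectic z (capBall_mono hlt.le hz) u v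
  relative := fun z hz => h.relative z (capBall_mono hlt.le hz)

variable {Q : Type*} [TopologicalSpace Q] [ChartedSpace (EuclideanSpace ℝ (Fin n)) Q]
  [IsManifold 𝓘(ℝ, EuclideanSpace ℝ (Fin n)) ∞ Q]
  [IsManifold 𝓘(ℝ, EuclideanSpace ℝ (Fin (2 * n))) ∞ M] {j : Q → M}

/-- The open ball as a relative model. -/
lemma IsRelativeBallEmbedding.isRelativeModel (h : IsRelativeBallEmbedding Ω (range j) U R ι) :
    IsRelativeModel Ω j (toCn n ⁻¹' {z : Cn n | Real.pi * ‖z‖ ^ 2 < R}) (ι ∘ toCn n) where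
  isOpen := (isOpen_openCapBall n R).preimage (toCn n).continuous
  zero_mem := fun z hz => by
    refine lt_of_le_of_lt ?_ (show Real.pi * ‖toCn n z‖ ^ 2 < R from hz)
    rw [norm_toCn_sq, norm_toCn_sq]
    have := sq_nonneg ‖z.2‖
    simp only [norm_zero]
    refine mul_le_mul_of_nonneg_left ?_ Real.pi_pos.le
    linarith
  smooth := fun z hz => (h.contMDiffAt hz).comp z (toCn n).contDiff.contDiffAt.contMDiffAt
  symplectic := fun z hz u v => by
    have e1 := mfderiv_comp z ((h.contMDiffAt hz).mdifferentiableAt (by simp))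
      (toCn n).differentiableAt.mdifferentiableAt
    have e2 : mfderiv 𝓘(ℝ, EuclideanSpace ℝ (Fin n) × EuclideanSpace ℝ (Fin n)) 𝓘(ℝ, Cn n)
        (toCn n) z =
        (toCn n : (EuclideanSpace ℝ (Fin n) × EuclideanSpace ℝ (Fin n)) →L[ℝ] Cn n) := by
      rw [mfderiv_eq_fderiv]; exact (toCn n).fderiv
    rw [e2] at e1
    have e3 := h.symplectic (toCn n z) (openCapBall_subset R hz) (toCn n u) (toCn n v)
    rw [mfderivWithin_capBall hz] at e3
    rw [← stdForm_toCn, ← e3, e1]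
    rfl
  injOn := fun z hz w hw hzw => (toCn n).injective
    (h.injOn (openCapBall_subset R hz) (openCapBall_subset R hw) hzw)
  relative := fun z hz => by
    rw [← toCn_mem_realPart, ← h.relative _ (openCapBall_subset R hz)]
    rfl

/-- A relative ball embedding factors, after shrinking the ball, through a Weinstein
neighborhood. -/
theorem IsRelativeBallEmbedding.exists_isWeinsteinNeighborhood [T2Space M] [CompactSpace Q]
    (h : IsRelativeBallEmbedding Ω (range j) U R ι)
    (hΩ : IsSymplectic 𝓘(ℝ, EuclideanSpace ℝ (Fin (2 * n))) Ω) (hj : IsLagrangianEmbedding Ω j)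
    (hR' : 0 < R') (hlt : R' < R) :
    ∃ N, IsWeinsteinNeighborhood Ω j N ∧ IsRelativeBallEmbedding Ω (range j) N R' ι := by
  -- The centre of the ball is real, so its image lies in the image of `j`: an empty `Q` admits no
  -- relative ball.
  have hne : Nonempty Q := by
    have h0 : (0 : Cn n) ∈ capBall n R := by
      simpa [capBall] using (hR'.trans hlt).le
    obtain ⟨q, -⟩ := (h.relative 0 h0).2 fun i => by simp
    exact ⟨q⟩
  have hcomp : ∀ r, IsCompact (toCn n ⁻¹' capBall n r) := fun r =>
    (toCn n).toHomeomorph.isCompact_preimage.2 (isCompact_capBall n r)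
  -- An intermediate capacity gives the required nesting: closed `R'`-ball, open `r`-ball, closed
  -- `r`-ball, open `R`-ball.
  obtain ⟨r, hr1, hr2⟩ := exists_between hlt
  obtain ⟨Φ, h1, h2, h3, h4⟩ := h.isRelativeModel.exists_extension (by simp) hΩ
    hj.isSmoothEmbedding hj.isotropic (K := toCn n ⁻¹' capBall n R')
    (V := toCn n ⁻¹' {z : Cn n | Real.pi * ‖z‖ ^ 2 < r}) (D := toCn n ⁻¹' capBall n r)
    (hcomp R') (preimage_mono (capBall_subset_open hr1))
    ((isOpen_openCapBall n r).preimage (toCn n).continuous)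
    (preimage_mono (openCapBall_subset r)) (hcomp r) (preimage_mono (capBall_subset_open hr2))
  refine ⟨Φ.target, ⟨Φ, rfl, fun q => (h1 q).1, fun q => (h1 q).2,
    fun a ha => (h2 a ha).1.contMDiffWithinAt, fun y hy => (h3 y hy).contMDiffWithinAt,
    fun a ha => (h2 a ha).2⟩, h.restrict hR' hlt fun z hz => ?_⟩
  refine h4 ⟨(toCn n).symm z, ?_, ?_⟩
  · simpa using hz
  · simp

end Ball

end LagrangianWidth

end

theorem proposition1p4 (n : ℕ)
    {M : Type*} [TopologicalSpace M] [T2Space M] [SecondCountableTopology M]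
    [ChartedSpace (EuclideanSpace ℝ (Fin (2 * n))) M]
    [IsManifold 𝓘(ℝ, EuclideanSpace ℝ (Fin (2 * n))) ∞ M]
    (Ω : LagrangianWidth.Form 𝓘(ℝ, EuclideanSpace ℝ (Fin (2 * n))) M 2)
    (hΩ : LagrangianWidth.IsSymplectic 𝓘(ℝ, EuclideanSpace ℝ (Fin (2 * n))) Ω)
    {Q : Type*} [TopologicalSpace Q] [CompactSpace Q]
    [ChartedSpace (EuclideanSpace ℝ (Fin n)) Q]
    [IsManifold 𝓘(ℝ, EuclideanSpace ℝ (Fin n)) ∞ Q]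
    (j : Q → M) (hj : LagrangianWidth.IsLagrangianEmbedding Ω j) :
    LagrangianWidth.width Ω (range j) univ =
      ⨆ N ∈ {N : Set M | LagrangianWidth.IsWeinsteinNeighborhood Ω j N},
        LagrangianWidth.width Ω (range j) N := by
  refine le_antisymm ?_ (iSup₂_le fun N _ => LagrangianWidth.width_mono (subset_univ N))
  refine iSup₂_le fun R hR => ?_
  obtain ⟨-, ι, hι⟩ := hR
  -- Shrinking `R` to an arbitrarily close `R'` costs nothing in a supremum.
  refine le_of_forall_lt fun c hc => ?_
  obtain ⟨R', -, hc1, hc2⟩ := ENNReal.lt_iff_exists_real_btwn.1 hc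
  have hR' : 0 < R' := ENNReal.ofReal_pos.1 (bot_le.trans_lt hc1)
  obtain ⟨N, hN, hιN⟩ := hι.exists_isWeinsteinNeighborhood hΩ hj hR'
    ((ENNReal.ofReal_lt_ofReal_iff_of_nonneg hR'.le).1 hc2)
  refine hc1.trans_le (le_trans ?_ (le_iSup₂ (f := fun N _ => LagrangianWidth.width Ω (range j) N)
    N hN))
  exact le_iSup₂ (f := fun (R : ℝ) _ => ENNReal.ofReal R) R' ⟨hR', ι, hιN⟩
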